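/- Fix an algebraic closure $\overline{\mathbf Q}$ of $\mathbf Q$. A $\mathbf Q$-curve is an elliptic curve over $\overline{\mathbf Q}$ without complex multiplication that is isogenous to all its Galois conjugates. A $\mathbf Q$-curve of degree 2 is a $\mathbf Q$-curve $C$ defined over a quadratic field $k\subset\overline{\mathbf Q}$, with $j(C)\notin\mathbf Q$, having an isogeny of degree 2 (over $\overline{\mathbf Q}$) to its conjugate curve. Let $\rho_{C,3}:\mathrm{Gal}(\overline{\mathbf Q}/k)\to\mathrm{Aut}(C[3])\simeq\mathrm{GL}_2(\mathbf F_3)$ be the representation on the 3-torsion points, and let $\overline\rho_{C,3}$ be its composition with the projection to $\mathrm{PGL}_2(\mathbf F_3)$. When $\rho_{C,3}$ is surjective, $K_C$ denotes the unique Galois extension of $\mathbf Q$ in $\overline{\mathbf Q}$ with group isomorphic to $\mathcal S_4$ whose compositum with $k$ is the fixed field of $\overline\rho_{C,3}$. A degree-4 extension $K_1/\mathbf Q$ inside $\overline{\mathbf Q}$ is a principal quartic if its Galois closure is the splitting field of a polynomial $X^4+bX+c$ with $b,c\in\mathbf Q$; $d_{K_1}$ denotes its discriminant, considered in $\mathbf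 Q^*/\mathbf Q^{*2}$. **Proposition 5.1.** (i) Let $C$ be a $\mathbf Q$-curve of degree 2 such that $\rho_{C,3}$ is surjective. Then $K_C$ exists and is unique, and it is the Galois closure of a principal quartic $K_1/\mathbf Q$ with $d_{K_1}\neq-3$ in $\mathbf Q^*/\mathbf Q^{*2}$. (ii) Conversely, let $K_1/\mathbf Q$ be a principal quartic whose Galois closure $K$ has Galois group over $\mathbf Q$ isomorphic to $\mathcal S_4$ and does not contain the cube roots of unity. Then there are infinitely many $\mathbf Q$-curves $C$ of degree 2, pairwise non-isomorphic over $\overline{\mathbf Q}$, defined over the quadratic field $k=\mathbf Q(\sqrt{-3d_{K_1}})$, with $\rho_{C,3}$ surjective and $K_C=K$. -/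

import Mathlib

open Polynomial WeierstrassCurve
open scoped Polynomial.Bivariate

/-! ### Isogenies, complex multiplication and `ℚ`-curves

An elliptic curve is given by a Weierstrass equation `W` with `W.IsElliptic`.  All homomorphisms are
geometric: they are considered over an algebraically closed field. -/

section Isogenies

variable {F : Type*} [Field F] [DecidableEq F]

/-- For elliptic curves `W`, `W'` over an algebraically closed field `F`, an isogeny from `W` to `W'`
is a group homomorphism `W(F) → W'(F)` given by rational functions: there are polynomials
`p`, `q`, `r`, `s` in two variables such that, for all but finitely many points `P`, one has
`P = (x, y)`, `q(x, y) ≠ 0`, `s(x, y) ≠ 0` and `φ(P) = (p(x, y) / q(x, y), r(x, y) / s(x, y))`.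
Such a homomorphism takes affine values at all but finitely many points, so it is not constant. -/
def IsIsogeny {W W' : WeierstrassCurve F} (φ : W.toAffine.Point →+ W'.toAffine.Point) : Prop :=
  ∃ p q r s : F[X][Y],
    {P : W.toAffine.Point | ¬ ∃ (x y : F) (h : W.toAffine.Nonsingular x y),
      P = .some x y h ∧ q.evalEval x y ≠ 0 ∧ s.evalEval x y ≠ 0 ∧
      ∃ h' : W'.toAffine.Nonsingular (p.evalEval x y / q.evalEval x y)
          (r.evalEval x y / s.evalEval x y),
        φ P = .some _ _ h'}.Finite

/-- An isogeny of degree `N`.  In characteristic zero every isogeny is separable, so over an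
algebraically closed field its degree is the number of points in its kernel. -/
def IsIsogenyOfDegree {W W' : WeierstrassCurve F} (φ : W.toAffine.Point →+ W'.toAffine.Point)
    (N : ℕ) : Prop :=
  IsIsogeny φ ∧ Nat.card φ.ker = N

/-- `W` over an algebraically closed field of characteristic zero has no complex multiplication: its
endomorphism ring (the zero map together with the isogenies from `W` to itself) is `ℤ`. -/
def NonCM (W : WeierstrassCurve F) : Prop :=
  ∀ φ : W.toAffine.Point →+ W.toAffine.Point, IsIsogeny φ →
    ∃ n : ℤ, ∀ P, φ P = n • P

end Isogenies

/-- A fixed algebraic closure of `ℚ`. -/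
local notation "ℚbar" => AlgebraicClosure ℚ

open Classical in
/-- A `ℚ`-curve: an elliptic curve over `ℚbar`, without complex multiplication, which is isogenous to
all its Galois conjugates. -/
def IsQCurve (E : WeierstrassCurve ℚbar) : Prop :=
  E.IsElliptic ∧ NonCM E ∧
    ∀ σ : ℚbar ≃ₐ[ℚ] ℚbar,
      ∃ φ : E.toAffine.Point →+ (E.map (σ : ℚbar →+* ℚbar)).toAffine.Point, IsIsogeny φ

open Classical in
/-- A `ℚ`-curve of degree `N`, over the quadratic field `k`: a `ℚ`-curve defined over `k`, with
non-rational `j`-invariant, and having (over `ℚbar`) an isogeny of degree `N` to its conjugate. -/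
def IsQCurveOfDegree (N : ℕ) {k : IntermediateField ℚ ℚbar} (C : WeierstrassCurve k)
    [C.IsElliptic] : Prop :=
  Module.finrank ℚ k = 2 ∧
  IsQCurve (C⁄ℚbar) ∧
  C.j ∉ (algebraMap ℚ k).range ∧
  ∃ σ : k ≃ₐ[ℚ] k, σ ≠ 1 ∧
    ∃ φ : (C⁄ℚbar).toAffine.Point →+ ((C.map (σ : k →+* k))⁄ℚbar).toAffine.Point,
      IsIsogenyOfDegree φ N

/-! ### The Galois representation on torsion points -/

section Torsion

variable {k : IntermediateField ℚ ℚbar}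

open Classical in
/-- The `p`-torsion group `C[p]` of `C(ℚbar)`. -/
noncomputable abbrev torsionPoints (C : WeierstrassCurve k) (p : ℕ) :
    AddSubgroup (C⁄ℚbar).toAffine.Point :=
  AddSubgroup.torsionBy (C⁄ℚbar).toAffine.Point (p : ℤ)

open Classical in
/-- The action of an element of `Gal(ℚbar/k)` on the coordinates of points of `C(ℚbar)`, restricted to
`C[p]`. -/
noncomputable def galoisActTorsion (C : WeierstrassCurve k) (p : ℕ) (σ : ℚbar ≃ₐ[k] ℚbar) :
    torsionPoints C p →+ torsionPoints C p :=
  ((Affine.Point.map (W' := C.toAffine) (σ : ℚbar →ₐ[k] ℚbar)).comp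
    (torsionPoints C p).subtype).codRestrict (torsionPoints C p) (by
      rintro ⟨P, hP⟩
      have hP' : (p : ℤ) • P = 0 := hP
      change (p : ℤ) • Affine.Point.map (W' := C.toAffine) (σ : ℚbar →ₐ[k] ℚbar) P = 0
      rw [← map_zsmul, hP', _root_.map_zero])

open Classical in
/-- The representation `ρ_{C,p} : Gal(ℚbar/k) → Aut(C[p])`.  Automorphisms of the abelian group `C[p]` are written
as `ℤ`-linear automorphisms; they are the same as its `𝔽_p`-linear automorphisms. -/
noncomputable def torsionRep (C : WeierstrassCurve k) (p : ℕ) :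
    (ℚbar ≃ₐ[k] ℚbar) →* (torsionPoints C p ≃ₗ[ℤ] torsionPoints C p) where
  toFun σ :=
    { toFun := galoisActTorsion C p σ
      invFun := galoisActTorsion C p σ⁻¹
      left_inv := by
        rintro ⟨P, hP⟩
        apply Subtype.ext
        change Affine.Point.map (W' := C.toAffine) _ (Affine.Point.map (W' := C.toAffine) _ P) = P
        rcases P with _ | ⟨x, y, h⟩
        · rfl
        · simp [Affine.Point.map_some, AlgEquiv.aut_inv]
      right_inv := by
        rintro ⟨P, hP⟩
        apply Subtype.ext
        change Affine.Point.map (W' := C.toAffine) _ (Affine.Point.map (W' := C.toAffine) _ P) = P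
        rcases P with _ | ⟨x, y, h⟩
        · rfl
        · simp [Affine.Point.map_some, AlgEquiv.aut_inv]
      map_add' := map_add _
      map_smul' := fun n P => map_zsmul (galoisActTorsion C p σ) n P }
  map_one' := by
    ext ⟨P, hP⟩
    rcases P with _ | ⟨x, y, h⟩ <;> rfl
  map_mul' σ τ := by
    ext ⟨P, hP⟩
    rcases P with _ | ⟨x, y, h⟩ <;> rfl

/-- The projective representation attached to `ρ_{C,p}`, with values in
`Aut(C[p]) / center ≃ PGL₂(𝔽_p)`. -/
noncomputable def projectiveTorsionRep (C : WeierstrassCurve k) (p : ℕ) :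
    (ℚbar ≃ₐ[k] ℚbar) →*
      (torsionPoints C p ≃ₗ[ℤ] torsionPoints C p) ⧸
        Subgroup.center (torsionPoints C p ≃ₗ[ℤ] torsionPoints C p) :=
  (QuotientGroup.mk' _).comp (torsionRep C p)

/-- The fixed field, inside `ℚbar`, of the projective representation attached to `ρ_{C,p}`. -/
noncomputable def projectiveTorsionField (C : WeierstrassCurve k) (p : ℕ) :
    IntermediateField k ℚbar :=
  IntermediateField.fixedField (projectiveTorsionRep C p).ker

end Torsion

/-! ### Octahedral extensions and principal quartics -/

/-- `K/ℚ` is an octahedral extension: Galois with group isomorphic to the symmetric group `S₄`. -/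
def IsOctahedral (K : IntermediateField ℚ ℚbar) : Prop :=
  IsGalois ℚ K ∧ Nonempty ((K ≃ₐ[ℚ] K) ≃* Equiv.Perm (Fin 4))

/-- `K` is an octahedral extension of `ℚ` whose compositum with `k` is the fixed field of the
projective mod 3 representation of `C`.  For a `ℚ`-curve `C` over a quadratic field `k` with `ρ_{C,3}`
surjective, the field `K_C` is the only such `K`. -/
def IsOctahedralFieldOf {k : IntermediateField ℚ ℚbar} (C : WeierstrassCurve k)
    (K : IntermediateField ℚ ℚbar) : Prop :=
  IsOctahedral K ∧
    K ⊔ k = IntermediateField.restrictScalars ℚ (projectiveTorsionField C 3)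

/-- The Galois closure of `K₁/ℚ` inside `ℚbar`. -/
noncomputable abbrev galoisClosure (K₁ : IntermediateField ℚ ℚbar) : IntermediateField ℚ ℚbar :=
  IntermediateField.normalClosure ℚ K₁ ℚbar

/-- `K₁/ℚ` is a principal quartic: it has degree 4 and its Galois closure is the splitting field of
some polynomial `X⁴ + b X + c` with rational coefficients. -/
def IsPrincipalQuartic (K₁ : IntermediateField ℚ ℚbar) : Prop :=
  Module.finrank ℚ K₁ = 4 ∧
    ∃ b c : ℚ, galoisClosure K₁ =
      IntermediateField.adjoin ℚ ((X ^ 4 + C b * X + C c : ℚ[X]).rootSet ℚbar)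

/-- The subfield `ℚ(√d)` of `ℚbar`. -/
noncomputable def sqrtField (d : ℚ) : IntermediateField ℚ ℚbar :=
  IntermediateField.adjoin ℚ {x : ℚbar | x ^ 2 = algebraMap ℚ ℚbar d}

/-- Two elliptic curves over `k` are isomorphic over `ℚbar`. -/
def GeometricallyIsomorphic {k : IntermediateField ℚ ℚbar} (C C' : WeierstrassCurve k) : Prop :=
  ∃ v : VariableChange ℚbar, v • (C⁄ℚbar) = (C'⁄ℚbar)

/-! Everything rests on the family E_s : y² = x³ + 4x² + 2(1+s)x. Its quotient by (0,0) is
geometrically E_{-s}, and the cubic substitution `quarticCoord` carries its 3-division polynomial to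
z⁴ + tz + t with t = 256/(27(1 - s²)), which depends on s² only. So if δ = s² is rational, a curve
over k with the j-invariant of E_s (not 0 or 1728) has as projective 3-torsion field the compositum
of k with the splitting field of a rational principal quartic (`exists_rational_quartic_roots`),
whose discriminant is -3δ modulo squares (`discr_quartic`).

(i) Let T generate the kernel of the 2-isogeny from C to its conjugate. Since j ≠ 1728, the pair (C,
T) is geometrically y² = x³ + x² + rx with the point (0,0), and the conjugate has the j-invariant
belonging to 1/4 - r. Without complex multiplication, a 2-isogeny in the opposite direction composes
with the given one to an integer, which forces it to be the dual one (`eq_of_j_eq_of_nonCM`). Hence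
Galois fixes r or exchanges it with 1/4 - r, according to the action on k, so s = 8r - 1 lies in k
and s² = δ is rational. It is not a square, because j is not rational; this excludes the
discriminant class -3. The field K is unique because S₄ has trivial centre while the Galois group of
k is abelian (`FullQuartic.eq_of_sup_eq`).

(ii) The elements of trace zero in a principal quartic field whose square also has trace zero form a
conic with a rational point. Its points give quartics X⁴ + pX + q with the same splitting field K,
scaling makes p = q = t, and t takes infinitely many values
(`FullQuartic.infinite_setOf_parameter`). The discriminant shows that δ = 1 - 256/(27t) is -3d up to
squares, so E_s with s² = δ is defined over k = ℚ(√(-3d)). Since K contains √d but not √-3, it does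
not contain √(-3d), so Gal(ℚbar/k) still permutes the roots through S₄. This lifts from PGL₂(𝔽₃) to
GL₂(𝔽₃) because -1 is the square of every lift of a double transposition
(`torsionRep_surjective_iff`).

It remains to see that E_s has no complex multiplication, and this follows from surjectivity. An
isogeny is determined by its leading coefficients at infinity, which multiply under composition, so
endomorphisms commute (`IsIsogeny.commute`). In particular an endomorphism commutes with its Galois
conjugates. On the 3-torsion it therefore commutes with all its conjugates under GL₂(𝔽₃), so it is a
scalar there; an infinite descent by division by 3 then shows that it is an integer
(`nonCM_of_scalar`). As isogenies are homomorphisms given by rational functions away from finitely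
many points, their kernels, degrees and factorisations are developed from that definition. -/

open Filter

set_option linter.unusedSectionVars false

/-! ### Rational functions of one variable, up to finitely many values -/

namespace RatFunc

variable {F : Type*} [Field F]

/-- The value of a rational function at a point (zero at the poles). -/
noncomputable abbrev val (R : RatFunc F) (x : F) : F := R.eval (RingHom.id F) x

lemma val_eq (R : RatFunc F) (x : F) : R.val x = R.num.eval x / R.denom.eval x := rfl

lemma eventually_eval_ne_zero {p : F[X]} (hp : p ≠ 0) : ∀ᶠ x in cofinite, p.eval x ≠ 0 := by
  classical
  have : {x | p.eval x = 0}.Finite := by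
    refine (p.roots.toFinset.finite_toSet).subset fun x hx => ?_
    simpa [hp] using hx
  simpa [eventually_cofinite] using this

lemma eventually_denom_ne_zero (R : RatFunc F) : ∀ᶠ x in cofinite, R.denom.eval x ≠ 0 :=
  eventually_eval_ne_zero R.denom_ne_zero

/-- `g` agrees with the rational function `R` away from finitely many points. -/
def Rep (g : F → F) (R : RatFunc F) : Prop := ∀ᶠ x in cofinite, g x = R.val x

lemma Rep.val (R : RatFunc F) : Rep R.val R := Eventually.of_forall fun _ => rfl

lemma Rep.congr {g h : F → F} {R : RatFunc F} (hg : Rep g R) (e : ∀ᶠ x in cofinite, g x = h x) :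
    Rep h R := by
  filter_upwards [hg, e] with x h1 h2
  rw [← h2, h1]

lemma Rep.const (c : F) : Rep (fun _ => c) (C c) := Eventually.of_forall fun x => by simp

lemma Rep.id : Rep (fun x : F => x) X := Eventually.of_forall fun x => by simp

lemma Rep.add {g h : F → F} {R S : RatFunc F} (hg : Rep g R) (hh : Rep h S) :
    Rep (fun x => g x + h x) (R + S) := by
  filter_upwards [hg, hh, R.eventually_denom_ne_zero, S.eventually_denom_ne_zero] with x h1 h2 h3 h4
  rw [h1, h2, RatFunc.val, RatFunc.val, RatFunc.val, eval_add] <;> simpa [eval₂_id]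

lemma Rep.mul {g h : F → F} {R S : RatFunc F} (hg : Rep g R) (hh : Rep h S) :
    Rep (fun x => g x * h x) (R * S) := by
  filter_upwards [hg, hh, R.eventually_denom_ne_zero, S.eventually_denom_ne_zero] with x h1 h2 h3 h4
  rw [h1, h2, RatFunc.val, RatFunc.val, RatFunc.val, eval_mul] <;> simpa [eval₂_id]

lemma Rep.neg {g : F → F} {R : RatFunc F} (hg : Rep g R) : Rep (fun x => - g x) (-R) := by
  have := (Rep.const (-1 : F)).mul hg
  simpa using this

lemma Rep.sub {g h : F → F} {R S : RatFunc F} (hg : Rep g R) (hh : Rep h S) :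
    Rep (fun x => g x - h x) (R - S) := by
  simpa [sub_eq_add_neg] using hg.add hh.neg

lemma Rep.pow {g : F → F} {R : RatFunc F} (hg : Rep g R) (n : ℕ) :
    Rep (fun x => g x ^ n) (R ^ n) := by
  induction n with
  | zero => simpa using Rep.const (1 : F)
  | succ n ih => simpa [pow_succ] using ih.mul hg

lemma eventually_val_ne_zero {R : RatFunc F} (hR : R ≠ 0) : ∀ᶠ x in cofinite, R.val x ≠ 0 := by
  filter_upwards [eventually_eval_ne_zero (num_ne_zero hR), R.eventually_denom_ne_zero] with x h1 h2
  exact div_ne_zero h1 h2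

lemma Rep.eventually_ne_zero {g : F → F} {R : RatFunc F} (hg : Rep g R) (hR : R ≠ 0) :
    ∀ᶠ x in cofinite, g x ≠ 0 := by
  filter_upwards [hg, eventually_val_ne_zero hR] with x h1 h2
  rwa [h1]

lemma Rep.inv {g : F → F} {R : RatFunc F} (hg : Rep g R) : Rep (fun x => (g x)⁻¹) R⁻¹ := by
  by_cases hR : R = 0
  · subst hR
    filter_upwards [hg] with x h1
    simp [h1]
  · have h := (Rep.val R).mul (Rep.val R⁻¹)
    rw [mul_inv_cancel₀ hR] at h
    filter_upwards [h, hg, eventually_val_ne_zero hR] with x h1 h2 h3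
    rw [h2]
    simp only [RatFunc.val, eval_one] at h1
    exact inv_eq_of_mul_eq_one_right h1

lemma Rep.div {g h : F → F} {R S : RatFunc F} (hg : Rep g R) (hh : Rep h S) :
    Rep (fun x => g x / h x) (R / S) := by
  simpa [div_eq_mul_inv] using hg.mul hh.inv

lemma Rep.aeval {g : F → F} {R : RatFunc F} (hg : Rep g R) (p : F[X]) :
    Rep (fun x => p.eval (g x)) (aeval R p) := by
  induction p using Polynomial.induction_on' with
  | add p q hp hq => simpa using hp.add hq
  | monomial n a =>
    simpa [aeval_monomial, algebraMap_eq_C] using (Rep.const a).mul (hg.pow n)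

lemma Rep.poly (p : F[X]) : Rep (fun x => p.eval x) (algebraMap F[X] (RatFunc F) p) := by
  simpa [aeval_X_left_eq_algebraMap] using Rep.id.aeval p

variable [Infinite F]

lemma Rep.unique {g : F → F} {R S : RatFunc F} (hR : Rep g R) (hS : Rep g S) : R = S := by
  by_contra h
  have := (hR.sub hS).eventually_ne_zero (sub_ne_zero.mpr h)
  obtain ⟨x, hx⟩ := this.exists
  simp at hx

omit [Infinite F] in
lemma tendsto_val {S : RatFunc F} (hS : ∀ c, S ≠ C c) : Tendsto S.val cofinite cofinite := by
  refine Filter.Tendsto.cofinite_of_finite_preimage_singleton fun t => ?_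
  have := (((Rep.val S).sub (Rep.const t))).eventually_ne_zero (sub_ne_zero.mpr (hS t))
  have h := eventually_cofinite.mp this
  refine h.subset fun x hx => ?_
  simp [show S.val x = t from hx]

/-- Substitution of the rational function `S` into `R`. -/
noncomputable def subst (R S : RatFunc F) : RatFunc F :=
  Polynomial.aeval S R.num / Polynomial.aeval S R.denom

omit [Infinite F] in
-- A nonconstant `S` has finite fibres, so the finitely many bad points of `g` pull back to finitely
-- many.
lemma Rep.comp {g h : F → F} {R S : RatFunc F} (hg : Rep g R) (hh : Rep h S) (hS : ∀ c, S ≠ C c) :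
    Rep (fun x => g (h x)) (R.subst S) := by
  have ht := tendsto_val hS
  refine ((hh.aeval R.num).div (hh.aeval R.denom)).congr ?_
  filter_upwards [ht.eventually hg, hh] with x h1 h2
  rw [h2, h1]; rfl

/-- The degree of a rational function, as a map from the projective line to itself. -/
noncomputable def deg (R : RatFunc F) : ℕ := max R.num.natDegree R.denom.natDegree

omit [Infinite F] in
lemma deg_pos {S : RatFunc F} (hS : ∀ c, S ≠ C c) : 0 < S.deg := by
  rw [Nat.pos_iff_ne_zero]
  intro h
  have h1 : S.num.natDegree = 0 ∧ S.denom.natDegree = 0 := by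
    simpa [deg] using h
  obtain ⟨c, hc⟩ := (eq_C_iff S).mpr h1
  exact hS c hc

omit [Infinite F] in
-- The polynomial cuts out the fibre over `t`. The two excluded values are those at which the
-- leading terms could vanish or cancel.
lemma natDegree_sub_C_mul (S : RatFunc F) (t : F) (ht : t ≠ 0)
    (ht' : t ≠ S.num.leadingCoeff / S.denom.leadingCoeff) :
    (S.num - Polynomial.C t * S.denom).natDegree = S.deg := by
  have hd := S.denom_ne_zero
  have hn : (Polynomial.C t * S.denom).natDegree = S.denom.natDegree := natDegree_C_mul ht
  rcases lt_trichotomy S.num.natDegree S.denom.natDegree with h | h | h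
  · rw [natDegree_sub_eq_right_of_natDegree_lt (by rwa [hn]), hn, deg, max_eq_right h.le]
  · rw [deg, h, max_self]
    refine le_antisymm ((natDegree_sub_le _ _).trans (by rw [hn, h, max_self])) ?_
    refine le_natDegree_of_ne_zero ?_
    rw [coeff_sub, coeff_C_mul, coeff_natDegree]
    rw [← h, coeff_natDegree]
    intro h0
    apply ht'
    rw [eq_div_iff (leadingCoeff_ne_zero.mpr hd)]
    exact (sub_eq_zero.mp h0).symm
  · rw [natDegree_sub_eq_left_of_natDegree_lt (by rwa [hn]), deg, max_eq_left h.le]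

variable [CharZero F]

omit [Infinite F] in
-- By coprimality `p` divides its own derivative, which has smaller degree and therefore vanishes;
-- in characteristic zero `p` is constant.
lemma eq_C_of_wronskian {p q : F[X]} (h : IsCoprime p q)
    (hW : derivative p * q = p * derivative q) : p.natDegree = 0 ∧ q.natDegree = 0 := by
  have aux : ∀ {p q : F[X]}, IsCoprime p q → derivative p * q = p * derivative q →
      p.natDegree = 0 := by
    intro p q h hW
    have h1 : p ∣ derivative p := by
      refine h.dvd_of_dvd_mul_right ?_
      rw [hW]; exact dvd_mul_right _ _
    have h2 : derivative p = 0 := by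
      by_contra h0
      have h3 : p.degree ≤ (derivative p).degree := degree_le_of_dvd h1 h0
      have hp : p ≠ 0 := by rintro rfl; simp at h0
      exact absurd (degree_derivative_lt hp) (not_lt.mpr h3)
    exact Polynomial.derivative_eq_zero.mp h2
  exact ⟨aux h hW, aux h.symm (by rw [mul_comm, ← hW, mul_comm])⟩

variable [IsAlgClosed F]

omit [Infinite F] in
/-- A generic fibre of a nonconstant rational function has as many points as its degree. -/
lemma eventually_card_fiber {S : RatFunc F} (hS : ∀ c, S ≠ C c) :
    ∀ᶠ t in cofinite, ∃ s : Finset F, s.card = S.deg ∧ ∀ x, x ∈ s ↔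
      S.denom.eval x ≠ 0 ∧ S.val x = t := by
  classical
  -- The zeros of this Wronskian are the ramification points. Over values `t` outside their image
  -- the fibre polynomial has no multiple root.
  set W : F[X] := derivative S.num * S.denom - S.num * derivative S.denom with hWdef
  have hW : W ≠ 0 := by
    intro h
    have := eq_C_of_wronskian S.isCoprime_num_denom (sub_eq_zero.mp h)
    obtain ⟨c, hc⟩ := (eq_C_iff S).mpr this
    exact hS c hc
  have e1 : ∀ᶠ t in cofinite, t ∉ W.roots.toFinset.image S.val := by
    rw [eventually_cofinite]
    refine (W.roots.toFinset.image S.val).finite_toSet.subset fun x hx => ?_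
    simpa only [not_not, Set.mem_ofPred_eq, Finset.mem_coe] using hx
  have e2 : ∀ᶠ t : F in cofinite, t ≠ 0 := by simp [eventually_cofinite]
  have e3 : ∀ᶠ t : F in cofinite, t ≠ S.num.leadingCoeff / S.denom.leadingCoeff := by
    simp [eventually_cofinite]
  filter_upwards [e1, e2, e3] with t h1 h2 h3
  have hdeg := natDegree_sub_C_mul S t h2 h3
  set p := S.num - Polynomial.C t * S.denom with hp
  have hp0 : p ≠ 0 := by
    rintro h
    rw [h, natDegree_zero] at hdeg
    exact (deg_pos hS).ne hdeg
  have hroot : ∀ x, p.eval x = 0 ↔ S.denom.eval x ≠ 0 ∧ S.val x = t := by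
    intro x
    have hx : p.eval x = S.num.eval x - t * S.denom.eval x := by simp [hp]
    constructor
    · intro h
      have hd : S.denom.eval x ≠ 0 := by
        intro h0
        have hn : S.num.eval x = 0 := by rw [hx, h0] at h; simpa using h
        obtain ⟨a, b, hab⟩ := S.isCoprime_num_denom
        have := congrArg (Polynomial.eval x) hab
        simp [h0, hn] at this
      refine ⟨hd, ?_⟩
      rw [val_eq, div_eq_iff hd]
      rw [hx] at h; exact sub_eq_zero.mp h
    · rintro ⟨hd, h⟩
      rw [val_eq, div_eq_iff hd] at h
      rw [hx, h, sub_self]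
  refine ⟨p.roots.toFinset, ?_, fun x => ?_⟩
  · have hsep : p.roots.Nodup := by
      apply nodup_roots
      rw [Separable]
      by_contra hcop
      have hg : ¬ IsUnit (EuclideanDomain.gcd p (derivative p)) := by
        rwa [EuclideanDomain.gcd_isUnit_iff]
      have hg0 : EuclideanDomain.gcd p (derivative p) ≠ 0 := by
        intro h0
        exact hp0 (EuclideanDomain.gcd_eq_zero_iff.mp h0).1
      obtain ⟨x, hx⟩ := IsAlgClosed.exists_root (EuclideanDomain.gcd p (derivative p)) (by
        intro h0
        exact hg (isUnit_iff_degree_eq_zero.mpr h0))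
      have hx1 : p.eval x = 0 := by
        obtain ⟨q, hq⟩ := EuclideanDomain.gcd_dvd_left p (derivative p)
        rw [hq, Polynomial.eval_mul, hx, zero_mul]
      have hx2 : (derivative p).eval x = 0 := by
        obtain ⟨q, hq⟩ := EuclideanDomain.gcd_dvd_right p (derivative p)
        rw [hq, Polynomial.eval_mul, hx, zero_mul]
      apply h1
      rw [Finset.mem_image]
      refine ⟨x, ?_, ((hroot x).mp hx1).2⟩
      rw [Multiset.mem_toFinset, mem_roots hW, IsRoot, hWdef]
      have k1 : S.num.eval x = t * S.denom.eval x := by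
        simpa [hp, sub_eq_zero] using hx1
      have k2 : (derivative S.num).eval x = t * (derivative S.denom).eval x := by
        simpa [hp, sub_eq_zero] using hx2
      simp only [Polynomial.eval_sub, Polynomial.eval_mul, k1, k2]
      ring
    rw [Multiset.toFinset_card_of_nodup hsep, ← hdeg]
    exact (IsAlgClosed.card_roots_eq_natDegree (p := p))
  · rw [Multiset.mem_toFinset, mem_roots hp0, IsRoot, hroot]

/-- If `g ∘ M` is rational for a nonconstant rational function `M`, then `g` is rational. -/
lemma exists_rep_of_comp {M R : RatFunc F} (hM : ∀ c, M ≠ C c) {g : F → F}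
    (h : Rep (fun x => g (M.val x)) R) : ∃ S, Rep g S := by
  classical
  set n := max R.num.natDegree R.denom.natDegree with hn
  set A := R.num
  set D := R.denom
  have hbad : {x | ¬ (g (M.val x) = R.val x ∧ D.eval x ≠ 0)}.Finite := by
    have := h.and R.eventually_denom_ne_zero
    simpa only [eventually_cofinite] using this
  have hgood : ∀ᶠ t in cofinite, (∃ s : Finset F, s.card = M.deg ∧ ∀ x, x ∈ s ↔
      M.denom.eval x ≠ 0 ∧ M.val x = t) ∧
      ∀ x, M.val x = t → g t = R.val x ∧ D.eval x ≠ 0 := by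
    refine (eventually_card_fiber hM).and ?_
    rw [eventually_cofinite]
    refine (hbad.image M.val).subset ?_
    intro t ht
    simp only [Set.mem_ofPred_eq, not_forall] at ht
    obtain ⟨x, hx, hx'⟩ := ht
    refine ⟨x, ?_, hx⟩
    simpa [hx] using hx'
  have hinf : {t | (∃ s : Finset F, s.card = M.deg ∧ ∀ x, x ∈ s ↔
      M.denom.eval x ≠ 0 ∧ M.val x = t) ∧
      ∀ x, M.val x = t → g t = R.val x ∧ D.eval x ≠ 0}.Infinite := by
    intro hfin
    have h2 := eventually_cofinite.mp hgood
    refine Set.infinite_univ ((hfin.union h2).subset fun x _ => ?_)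
    exact em _
  -- Rational interpolation: `2n + 1` linear conditions on the `2n + 2` coefficients of `U` and `V`
  -- leave a nonzero pair with `U = g V` on `T`.
  obtain ⟨T, hT, hTcard⟩ := hinf.exists_subset_card_eq (2 * n + 1)
  let L : (degreeLT F (n + 1) × degreeLT F (n + 1)) →ₗ[F] (T → F) :=
    LinearMap.pi fun t => (leval (t : F)).comp ((degreeLT F (n + 1)).subtype.comp
      (LinearMap.fst F _ _)) - (g t) • (leval (t : F)).comp ((degreeLT F (n + 1)).subtype.comp
      (LinearMap.snd F _ _))
  have hfr : Module.finrank F (T → F) <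
      Module.finrank F (degreeLT F (n + 1) × degreeLT F (n + 1)) := by
    rw [Module.finrank_prod, (degreeLTEquiv F (n + 1)).finrank_eq]
    simp [hTcard]
    omega
  have hker := LinearMap.ker_ne_bot_of_finrank_lt (f := L) hfr
  obtain ⟨⟨⟨U, hU⟩, ⟨V, hV⟩⟩, hUV, hne⟩ := Submodule.exists_mem_ne_zero_of_ne_bot hker
  have hUn : U.natDegree ≤ n := by
    by_cases h0 : U = 0
    · simp [h0]
    · exact Nat.lt_succ_iff.mp ((natDegree_lt_iff_degree_lt h0).mpr (mem_degreeLT.mp hU))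
  have hVn : V.natDegree ≤ n := by
    by_cases h0 : V = 0
    · simp [h0]
    · exact Nat.lt_succ_iff.mp ((natDegree_lt_iff_degree_lt h0).mpr (mem_degreeLT.mp hV))
  have hUVt : ∀ t ∈ T, U.eval t = g t * V.eval t := by
    intro t ht
    have := congrFun (LinearMap.mem_ker.mp hUV) ⟨t, ht⟩
    simpa [L, sub_eq_zero, leval] using this
  -- Homogenisation: `hom P` is `P(M)` multiplied by the `n`-th power of the denominator of `M`.
  let hom : F[X] → F[X] := fun P => ∑ i ∈ Finset.range (n + 1),
    Polynomial.C (P.coeff i) * M.num ^ i * M.denom ^ (n - i)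
  have hom_deg : ∀ P, (hom P).natDegree ≤ n * M.deg := by
    intro P
    refine natDegree_sum_le_of_forall_le _ _ fun i hi => ?_
    have hi' : i ≤ n := Nat.lt_succ_iff.mp (Finset.mem_range.mp hi)
    have h1 : (M.num ^ i).natDegree ≤ i * M.deg :=
      natDegree_pow_le.trans (Nat.mul_le_mul_left _ (le_max_left _ _))
    have h2 : (M.denom ^ (n - i)).natDegree ≤ (n - i) * M.deg :=
      natDegree_pow_le.trans (Nat.mul_le_mul_left _ (le_max_right _ _))
    have h3 : (Polynomial.C (P.coeff i) * M.num ^ i).natDegree ≤ i * M.deg :=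
      (natDegree_C_mul_le _ _).trans h1
    refine natDegree_mul_le.trans ((add_le_add h3 h2).trans ?_)
    rw [← add_mul]
    exact Nat.mul_le_mul_right _ (by omega)
  have hom_eval : ∀ P : F[X], P.natDegree ≤ n → ∀ x, M.denom.eval x ≠ 0 →
      (hom P).eval x = M.denom.eval x ^ n * P.eval (M.val x) := by
    intro P hP x hx
    rw [Polynomial.eval_eq_sum_range' (Nat.lt_succ_iff.mpr hP), Finset.mul_sum]
    simp only [hom, eval_finsetSum, Polynomial.eval_mul, Polynomial.eval_pow, Polynomial.eval_C]
    refine Finset.sum_congr rfl fun i hi => ?_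
    have hi' : i ≤ n := Nat.lt_succ_iff.mp (Finset.mem_range.mp hi)
    rw [val_eq, div_pow]
    field_simp
    rw [mul_assoc, ← pow_add, Nat.sub_add_cancel hi']
  set H := hom U * D - A * hom V with hH
  have hHeval : ∀ t x, M.denom.eval x ≠ 0 → M.val x = t → (g t = R.val x ∧ D.eval x ≠ 0) →
      H.eval x = M.denom.eval x ^ n * D.eval x * (U.eval t - g t * V.eval t) := by
    intro t x hx hxt hgx
    rw [hH, Polynomial.eval_sub, Polynomial.eval_mul, Polynomial.eval_mul, hom_eval U hUn x hx,
      hom_eval V hVn x hx, hxt, hgx.1, val_eq]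
    have h1 := hgx.2
    rw [show R.num.eval x / R.denom.eval x = A.eval x / D.eval x from rfl]
    field_simp
  -- `H` vanishes on `2n + 1` disjoint fibres of `deg M` points each, but its degree is at most `n
  -- deg M + n`. Hence the relation found on `T` holds generically.
  have hH0 : H = 0 := by
    choose! s hs using fun t (ht : t ∈ T) => (hT ht).1
    refine eq_zero_of_natDegree_lt_card_of_eval_eq_zero' H (T.biUnion s) ?_ ?_
    · intro x hx
      obtain ⟨t, ht, hxt⟩ := Finset.mem_biUnion.mp hx
      obtain ⟨h1, h2⟩ := ((hs t ht).2 x).mp hxt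
      rw [hHeval t x h1 h2 ((hT ht).2 x h2), hUVt t ht, sub_self, mul_zero]
    · rw [Finset.card_biUnion]
      · rw [Finset.sum_congr rfl fun t ht => (hs t ht).1, Finset.sum_const, hTcard, smul_eq_mul]
        have h1 : H.natDegree ≤ n * M.deg + n := by
          refine (natDegree_sub_le _ _).trans (max_le ?_ ?_)
          · exact natDegree_mul_le.trans (add_le_add (hom_deg U) (le_max_right _ _))
          · rw [add_comm]
            exact natDegree_mul_le.trans (add_le_add (le_max_left _ _) (hom_deg V))
        have h2 := deg_pos hM
        nlinarith
      · intro t ht t' ht' htt'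
        rw [Function.onFun, Finset.disjoint_left]
        intro x hx hx'
        exact htt' ((((hs t ht).2 x).mp hx).2.symm.trans (((hs t' ht').2 x).mp hx').2)
  have key : ∀ᶠ t in cofinite, U.eval t = g t * V.eval t := by
    filter_upwards [hgood] with t ht
    obtain ⟨⟨s, hs1, hs2⟩, ht2⟩ := ht
    have : s.Nonempty := by
      rw [← Finset.card_pos, hs1]; exact deg_pos hM
    obtain ⟨x, hx⟩ := this
    obtain ⟨hx1, hx2⟩ := (hs2 x).mp hx
    have := hHeval t x hx1 hx2 (ht2 x hx2)
    rw [hH0, Polynomial.eval_zero, eq_comm] at this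
    have h3 := (mul_eq_zero.mp this).resolve_left (mul_ne_zero (pow_ne_zero _ hx1) (ht2 x hx2).2)
    exact sub_eq_zero.mp h3
  have hV0 : V ≠ 0 := by
    rintro rfl
    have hU0 : U ≠ 0 := by
      rintro rfl
      exact hne rfl
    obtain ⟨t, h1, h2⟩ := (key.and (eventually_eval_ne_zero hU0)).exists
    simp at h1
    exact h2 h1
  refine ⟨algebraMap F[X] _ U / algebraMap F[X] _ V, ((Rep.poly U).div (Rep.poly V)).congr ?_⟩
  filter_upwards [key, eventually_eval_ne_zero hV0] with t h1 h2
  rw [h1]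
  field_simp

end RatFunc

/-! ### Leading terms at infinity -/

namespace RatFunc

open WithZero

variable {F : Type*} [Field F]

open Classical in
/-- The valuation of `F(x)` at infinity. -/
noncomputable abbrev vInf : Valuation (RatFunc F) ℤᵐ⁰ := inftyValuation F

/-- `R ~ κ x ^ e` at infinity. -/
def Lead (R : RatFunc F) (κ : F) (e : ℤ) : Prop :=
  κ ≠ 0 ∧ vInf (R - C κ * X ^ e) < exp e

lemma vInf_C {κ : F} (h : κ ≠ 0) : vInf (C κ) = 1 := by
  classical exact inftyValuation.C F h

lemma vInf_C_le (κ : F) : vInf (C κ) ≤ 1 := by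
  by_cases h : κ = 0
  · simp [h]
  · exact (vInf_C h).le

lemma vInf_X_zpow (e : ℤ) : vInf ((X : RatFunc F) ^ e) = exp e := by
  classical exact inftyValuation.X_zpow F e

lemma vInf_C_mul_X_zpow {κ : F} (h : κ ≠ 0) (e : ℤ) : vInf (C κ * X ^ e) = exp e := by
  rw [map_mul, vInf_C h, vInf_X_zpow, one_mul]

variable {R S : RatFunc F} {κ l : F} {e e' : ℤ}

lemma Lead.vInf (h : Lead R κ e) : vInf R = exp e := by
  have h1 := vInf_C_mul_X_zpow h.1 e
  have h2 : R = (R - C κ * X ^ e) + C κ * X ^ e := by ring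
  rw [h2, Valuation.map_add_eq_of_lt_right, h1]
  rw [h1]; exact h.2

lemma Lead.ne_zero (h : Lead R κ e) : R ≠ 0 := by
  rintro rfl
  have := h.vInf
  rw [map_zero] at this
  exact exp_ne_zero this.symm

lemma Lead.C (h : κ ≠ 0) : Lead (C κ) κ 0 := ⟨h, by simp⟩

lemma Lead.X : Lead (X : RatFunc F) 1 1 := ⟨one_ne_zero, by simp⟩

lemma Lead.mul (hR : Lead R κ e) (hS : Lead S l e') : Lead (R * S) (κ * l) (e + e') := by
  refine ⟨mul_ne_zero hR.1 hS.1, ?_⟩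
  have h : R * S - RatFunc.C (κ * l) * RatFunc.X ^ (e + e') =
      (R - RatFunc.C κ * RatFunc.X ^ e) * S +
      RatFunc.C κ * RatFunc.X ^ e * (S - RatFunc.C l * RatFunc.X ^ e') := by
    rw [map_mul, zpow_add₀ X_ne_zero]; ring
  rw [h]
  refine Valuation.map_add_lt _ ?_ ?_
  · rw [map_mul, hS.vInf, exp_add]
    exact mul_lt_mul_of_pos_right hR.2 (by simp)
  · rw [map_mul, vInf_C_mul_X_zpow hR.1, exp_add]
    exact mul_lt_mul_of_pos_left hS.2 (by simp)

lemma Lead.inv (hR : Lead R κ e) : Lead R⁻¹ κ⁻¹ (-e) := by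
  refine ⟨inv_ne_zero hR.1, ?_⟩
  have hR0 := hR.ne_zero
  have hκ : RatFunc.C κ ≠ 0 := by simpa using hR.1
  have hX : (RatFunc.X : RatFunc F) ^ e ≠ 0 := zpow_ne_zero _ X_ne_zero
  have h : R⁻¹ - RatFunc.C κ⁻¹ * RatFunc.X ^ (-e) =
      -(R - RatFunc.C κ * RatFunc.X ^ e) * (R⁻¹ * (RatFunc.C κ * RatFunc.X ^ e)⁻¹) := by
    rw [map_inv₀, zpow_neg]
    field_simp
    ring
  rw [h, map_mul, map_mul, map_inv₀, map_inv₀, vInf_C_mul_X_zpow hR.1, hR.vInf, Valuation.map_neg]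
  calc _ < exp e * ((exp e)⁻¹ * (exp e)⁻¹) := mul_lt_mul_of_pos_right hR.2 (by simp)
    _ = exp (-e) := by
      rw [← exp_neg, ← exp_add, ← exp_add]; congr 1; ring

lemma Lead.div (hR : Lead R κ e) (hS : Lead S l e') : Lead (R / S) (κ / l) (e - e') := by
  simpa [div_eq_mul_inv, sub_eq_add_neg] using hR.mul hS.inv

lemma Lead.pow (hR : Lead R κ e) (n : ℕ) : Lead (R ^ n) (κ ^ n) (n * e) := by
  induction n with
  | zero => simpa using Lead.C (one_ne_zero (α := F))
  | succ n ih =>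
    have := ih.mul hR
    rw [pow_succ, pow_succ]
    convert this using 1
    push_cast; ring

lemma Lead.add_of_lt (hR : Lead R κ e) (hS : RatFunc.vInf S < exp e) : Lead (R + S) κ e := by
  refine ⟨hR.1, ?_⟩
  rw [add_sub_right_comm]
  exact Valuation.map_add_lt _ hR.2 hS

lemma Lead.add (hR : Lead R κ e) (hS : Lead S l e) (h : κ + l ≠ 0) : Lead (R + S) (κ + l) e := by
  refine ⟨h, ?_⟩
  rw [map_add, show R + S - (RatFunc.C κ + RatFunc.C l) * RatFunc.X ^ e =
    (R - RatFunc.C κ * RatFunc.X ^ e) + (S - RatFunc.C l * RatFunc.X ^ e) by ring]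
  exact Valuation.map_add_lt _ hR.2 hS.2

lemma Lead.neg (hR : Lead R κ e) : Lead (-R) (-κ) e := by
  simpa using (Lead.C (neg_ne_zero.mpr (one_ne_zero (α := F)))).mul hR

lemma Lead.vInf_sub_lt (hR : Lead R κ e) (hS : Lead S κ e) : RatFunc.vInf (R - S) < exp e := by
  rw [show R - S = (R - RatFunc.C κ * RatFunc.X ^ e) - (S - RatFunc.C κ * RatFunc.X ^ e) by ring]
  exact Valuation.map_sub_lt _ hR.2 hS.2

lemma Lead.unique (hR : Lead R κ e) (hR' : Lead R l e') : κ = l ∧ e = e' := by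
  have he : e = e' := by
    have := hR.vInf.symm.trans hR'.vInf
    exact exp_injective this
  subst he
  refine ⟨?_, rfl⟩
  by_contra h
  have h0 : l - κ ≠ 0 := sub_ne_zero.mpr (Ne.symm h)
  have h1 := Valuation.map_sub_lt _ hR.2 hR'.2
  rw [show R - RatFunc.C κ * RatFunc.X ^ e - (R - RatFunc.C l * RatFunc.X ^ e) =
    RatFunc.C (l - κ) * RatFunc.X ^ e by rw [map_sub]; ring, vInf_C_mul_X_zpow h0] at h1
  exact lt_irrefl _ h1

/-- As `R` has a pole at infinity (`0 < e`), the top term of `p(R)` dominates all others. -/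
lemma Lead.aeval (hR : Lead R κ e) (he : 0 < e) {p : F[X]} (hp : p ≠ 0) :
    Lead (aeval R p) (p.leadingCoeff * κ ^ p.natDegree) (p.natDegree * e) := by
  rw [aeval_eq_sum_range, Finset.sum_range_succ, add_comm]
  have h1 := (Lead.C (leadingCoeff_ne_zero.mpr hp)).mul (hR.pow p.natDegree)
  rw [zero_add] at h1
  rw [coeff_natDegree, Algebra.smul_def, algebraMap_eq_C]
  refine h1.add_of_lt (Valuation.map_sum_lt _ (by simp) fun i hi => ?_)
  rw [Algebra.smul_def, algebraMap_eq_C, map_mul, (hR.pow i).vInf]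
  refine lt_of_le_of_lt (mul_le_of_le_one_left' (vInf_C_le _)) ?_
  rw [exp_lt_exp]
  have : (i : ℤ) < p.natDegree := by exact_mod_cast Finset.mem_range.mp hi
  nlinarith

lemma Lead.poly {p : F[X]} (hp : p ≠ 0) :
    Lead (algebraMap F[X] (RatFunc F) p) p.leadingCoeff p.natDegree := by
  simpa [aeval_X_left_eq_algebraMap] using Lead.X.aeval one_pos hp

lemma lead_of_ne_zero (hR : R ≠ 0) : Lead R (R.num.leadingCoeff / R.denom.leadingCoeff)
    (R.num.natDegree - R.denom.natDegree) := by
  have := (Lead.poly (num_ne_zero hR)).div (Lead.poly R.denom_ne_zero)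
  rwa [num_div_denom] at this

lemma Lead.subst (hS : Lead S l e') (he' : 0 < e') (hR : Lead R κ e) :
    Lead (R.subst S) (κ * l ^ e) (e * e') := by
  have h0 := lead_of_ne_zero hR.ne_zero
  obtain ⟨h1, h2⟩ := hR.unique h0
  have := (hS.aeval he' (num_ne_zero hR.ne_zero)).div (hS.aeval he' R.denom_ne_zero)
  rw [RatFunc.subst, h1, h2, zpow_sub₀ hS.1]
  convert this using 1
  · simp only [zpow_natCast]; field_simp
  · ring

lemma vInf_aeval_le (hR : vInf R ≤ 1) (p : F[X]) : vInf (aeval R p) ≤ 1 := by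
  rw [aeval_eq_sum_range]
  refine Valuation.map_sum_le _ fun i _ => ?_
  rw [Algebra.smul_def, algebraMap_eq_C, map_mul, map_pow]
  exact mul_le_one' (vInf_C_le _) (pow_le_one' hR _)

/-- A rational function without pole at infinity has a value there. -/
lemma exists_value_at_infinity (hR : vInf R ≤ 1) : ∃ c : F, vInf (R - C c) < 1 := by
  by_cases h0 : R = 0
  · exact ⟨0, by simp [h0]⟩
  have h := lead_of_ne_zero h0
  rcases lt_or_eq_of_le hR with h1 | h1
  · exact ⟨0, by simpa using h1⟩
  · have h2 := h.vInf
    rw [h1, ← exp_zero] at h2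
    have h3 := exp_injective h2
    have h4 := h.2
    rw [← h3] at h4
    exact ⟨R.num.leadingCoeff / R.denom.leadingCoeff, by simpa using h4⟩

/-- `R - c` divides `p(R) - p(c)`, with a cofactor that has no pole at infinity. -/
lemma vInf_aeval_sub_lt {c : F} (hR : vInf (R - C c) < 1) (p : F[X]) :
    vInf (aeval R p - C (p.eval c)) < 1 := by
  have hR1 : vInf R ≤ 1 := by
    rw [show R = (R - C c) + C c by ring]
    exact Valuation.map_add_le _ hR.le (vInf_C_le c)
  obtain ⟨q, hq⟩ := X_sub_C_dvd_sub_C_eval (p := p) (a := c)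
  have := congrArg (Polynomial.aeval R) hq
  simp only [map_sub, map_mul, aeval_C, aeval_X, algebraMap_eq_C] at this
  rw [this, map_mul]
  exact lt_of_le_of_lt (mul_le_of_le_one_right' (vInf_aeval_le hR1 q)) hR

lemma vInf_aeval_lt {c : F} (hR : vInf (R - C c) < 1) {p : F[X]} (hp : p.eval c = 0) :
    vInf (aeval R p) < 1 := by
  simpa [hp] using vInf_aeval_sub_lt hR p

lemma vInf_aeval_eq {c : F} (hR : vInf (R - C c) < 1) {p : F[X]} (hp : p.eval c ≠ 0) :
    vInf (aeval R p) = 1 := by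
  have := vInf_aeval_sub_lt hR p
  rw [show aeval R p = (aeval R p - C (p.eval c)) + C (p.eval c) by ring,
    Valuation.map_add_eq_of_lt_right, vInf_C hp]
  rwa [vInf_C hp]

end RatFunc

/-! ### Subgroups and homomorphisms known up to finitely many elements -/

lemma AddSubgroup.eq_top_of_eventually {G : Type*} [AddGroup G] [Infinite G] (S : AddSubgroup G)
    (h : ∀ᶠ P in cofinite, P ∈ S) : S = ⊤ := by
  refine (AddSubgroup.eq_top_iff' S).mpr fun Q => ?_
  -- For almost every `P` both `P` and `Q + P` lie in `S`, hence so does their difference `Q`.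
  have h2 : ∀ᶠ P in cofinite, Q + P ∈ S :=
    (add_right_injective Q).tendsto_cofinite.eventually h
  obtain ⟨P, h1, h2⟩ := (h.and h2).exists
  simpa using S.sub_mem h2 h1

lemma AddMonoidHom.eq_of_eventually {G H : Type*} [AddGroup G] [Infinite G] [AddGroup H]
    {φ ψ : G →+ H} (h : ∀ᶠ P in cofinite, φ P = ψ P) : φ = ψ := by
  have := AddSubgroup.eq_top_of_eventually (φ.eqLocus ψ) h
  exact AddMonoidHom.eq_of_eqOn_top fun x _ => by
    have : x ∈ φ.eqLocus ψ := by rw [this]; trivial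
    exact this

lemma AddMonoidHom.tendsto_cofinite {G H : Type*} [AddGroup G] [AddGroup H] {φ : G →+ H}
    (h : (φ.ker : Set G).Finite) : Tendsto φ cofinite cofinite := by
  refine Tendsto.cofinite_of_finite_preimage_singleton fun b => ?_
  by_cases hb : ∃ a, φ a = b
  · obtain ⟨a, rfl⟩ := hb
    refine (h.image (fun k => a + k)).subset fun x hx => ⟨-a + x, ?_, by simp⟩
    have : φ x = φ a := hx
    simp [AddMonoidHom.mem_ker, this]
  · exact Set.finite_empty.subset fun x hx => hb ⟨x, hx⟩

/-! ### Points of a curve and rational functions on it -/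

namespace WeierstrassCurve

variable {F : Type*} [Field F]

/-- The `x`-coordinate of a point, with value `0` at the origin. -/
def xc {W : WeierstrassCurve F} : W.toAffine.Point → F
  | .zero => 0
  | .some x _ _ => x

/-- The `y`-coordinate of a point, with value `0` at the origin. -/
def yc {W : WeierstrassCurve F} : W.toAffine.Point → F
  | .zero => 0
  | .some _ y _ => y

variable {W W' W'' : WeierstrassCurve F}

@[simp] lemma xc_some {x y : F} (h : W.toAffine.Nonsingular x y) : xc (.some x y h) = x := rfl
@[simp] lemma yc_some {x y : F} (h : W.toAffine.Nonsingular x y) : yc (.some x y h) = y := rfl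

lemma exists_eq_some {P : W.toAffine.Point} (hP : P ≠ 0) :
    ∃ h : W.toAffine.Nonsingular (xc P) (yc P), P = .some _ _ h := by
  rcases P with _ | ⟨x, y, h⟩
  · exact absurd rfl hP
  · exact ⟨h, rfl⟩

lemma point_ext {P Q : W.toAffine.Point} (hP : P ≠ 0) (hQ : Q ≠ 0) (hx : xc P = xc Q)
    (hy : yc P = yc Q) : P = Q := by
  rcases P with _ | ⟨x, y, h⟩
  · exact absurd rfl hP
  rcases Q with _ | ⟨x', y', h'⟩
  · exact absurd rfl hQ
  simp only [xc_some, yc_some] at hx hy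
  subst hx hy
  rfl

lemma xc_neg (P : W.toAffine.Point) : xc (-P) = xc P := by
  rcases P with _ | ⟨x, y, h⟩ <;> rfl

lemma eq_or_eq_neg {P Q : W.toAffine.Point} (hP : P ≠ 0) (hQ : Q ≠ 0) (hx : xc P = xc Q) :
    P = Q ∨ P = -Q := by
  rcases P with _ | ⟨x, y, h⟩
  · exact absurd rfl hP
  rcases Q with _ | ⟨x', y', h'⟩
  · exact absurd rfl hQ
  exact Affine.Point.X_eq_iff.mp hx

lemma tendsto_xc : Tendsto (xc : W.toAffine.Point → F) cofinite cofinite := by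
  refine Tendsto.cofinite_of_finite_preimage_singleton fun x => ?_
  by_cases h : ∃ P : W.toAffine.Point, P ≠ 0 ∧ xc P = x
  · obtain ⟨P, hP, rfl⟩ := h
    refine (Set.toFinite {0, P, -P}).subset fun Q hQ => ?_
    by_cases hQ0 : Q = 0
    · simp [hQ0]
    · rcases eq_or_eq_neg hQ0 hP hQ with h | h <;> simp [h]
  · refine (Set.toFinite {0}).subset fun Q hQ => ?_
    by_contra h0
    exact h ⟨Q, h0, hQ⟩

lemma eventually_ne_zero : ∀ᶠ P : W.toAffine.Point in cofinite, P ≠ 0 := by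
  simp [eventually_cofinite]

section AlgClosed

variable [IsAlgClosed F]

lemma exists_xc_eq [W.IsElliptic] (x : F) : ∃ P : W.toAffine.Point, P ≠ 0 ∧ xc P = x := by
  let p : F[X] := X ^ 2 + C (W.a₁ * x + W.a₃) * X -
    C (x ^ 3 + W.a₂ * x ^ 2 + W.a₄ * x + W.a₆)
  have hp : p.degree ≠ 0 := by
    have : p.natDegree = 2 := by simp only [p]; compute_degree!
    intro h
    rw [natDegree_eq_of_degree_eq_some h] at this
    exact absurd this (by norm_num)
  obtain ⟨y, hy⟩ := IsAlgClosed.exists_root p hp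
  have he : W.toAffine.Equation x y := by
    rw [Affine.equation_iff]
    simp only [p, IsRoot, eval_sub, eval_add, eval_pow, eval_X, eval_mul, eval_C] at hy
    linear_combination hy
  have hn : W.toAffine.Nonsingular x y := Affine.equation_iff_nonsingular.mp he
  exact ⟨.some x y hn, by simp, rfl⟩

instance [W.IsElliptic] : Infinite W.toAffine.Point := by
  have : Infinite F := IsAlgClosed.instInfinite
  choose P hP using exists_xc_eq (W := W)
  exact Infinite.of_injective P fun x x' h => by rw [← (hP x).2, ← (hP x').2, h]

/-- Generic statements pass between the curve and the `x`-line because `xc` is onto with finite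
fibres. -/
lemma eventually_xc_iff [W.IsElliptic] {p : F → Prop} :
    (∀ᶠ P : W.toAffine.Point in cofinite, p (xc P)) ↔ ∀ᶠ x in cofinite, p x := by
  refine ⟨fun h => ?_, fun h => tendsto_xc.eventually h⟩
  rw [eventually_cofinite] at h ⊢
  refine (h.image xc).subset fun x hx => ?_
  obtain ⟨P, -, rfl⟩ := exists_xc_eq (W := W) x
  exact ⟨P, hx, rfl⟩

end AlgClosed

/-! ### Rational functions on a curve -/

/-- `g` is a rational function on `W`, away from finitely many points. -/
def RatPt (g : W.toAffine.Point → F) : Prop :=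
  ∃ p q : F[X][Y], ∀ᶠ P in cofinite, q.evalEval (xc P) (yc P) ≠ 0 ∧
    g P = p.evalEval (xc P) (yc P) / q.evalEval (xc P) (yc P)

namespace RatPt

variable {g h : W.toAffine.Point → F}

lemma congr (hg : RatPt g) (e : ∀ᶠ P in cofinite, g P = h P) : RatPt h := by
  obtain ⟨p, q, H⟩ := hg
  refine ⟨p, q, ?_⟩
  filter_upwards [H, e] with P h1 h2
  exact ⟨h1.1, h2 ▸ h1.2⟩

lemma poly (p : F[X][Y]) :
    RatPt (fun P : W.toAffine.Point => p.evalEval (xc P) (yc P)) :=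
  ⟨p, 1, Eventually.of_forall fun P => by simp [evalEval_one]⟩

lemma const (c : F) : RatPt (fun _ : W.toAffine.Point => c) := by
  simpa [evalEval_C] using poly (W := W) (C (C c))

lemma x : RatPt (fun P : W.toAffine.Point => xc P) := by
  simpa [evalEval_C] using poly (W := W) (C X)

lemma y : RatPt (fun P : W.toAffine.Point => yc P) := by
  simpa using poly (W := W) Y

lemma add (hg : RatPt g) (hh : RatPt h) : RatPt (fun P => g P + h P) := by
  obtain ⟨p, q, H⟩ := hg
  obtain ⟨r, s, H'⟩ := hh
  refine ⟨p * s + q * r, q * s, ?_⟩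
  filter_upwards [H, H'] with P h1 h2
  simp only [evalEval_add, evalEval_mul]
  refine ⟨mul_ne_zero h1.1 h2.1, ?_⟩
  rw [h1.2, h2.2, div_add_div _ _ h1.1 h2.1]

lemma mul (hg : RatPt g) (hh : RatPt h) : RatPt (fun P => g P * h P) := by
  obtain ⟨p, q, H⟩ := hg
  obtain ⟨r, s, H'⟩ := hh
  refine ⟨p * r, q * s, ?_⟩
  filter_upwards [H, H'] with P h1 h2
  simp only [evalEval_mul]
  refine ⟨mul_ne_zero h1.1 h2.1, ?_⟩
  rw [h1.2, h2.2, div_mul_div_comm]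

lemma pow (hg : RatPt g) (n : ℕ) : RatPt (fun P => g P ^ n) := by
  induction n with
  | zero => simpa using const (W := W) 1
  | succ n ih => simpa [pow_succ] using ih.mul hg

lemma inv (hg : RatPt g) (h0 : ∀ᶠ P in cofinite, g P ≠ 0) : RatPt (fun P => (g P)⁻¹) := by
  obtain ⟨p, q, H⟩ := hg
  refine ⟨q, p, ?_⟩
  filter_upwards [H, h0] with P h1 h2
  rw [h1.2] at h2 ⊢
  exact ⟨fun h => h2 (by rw [h, zero_div]), inv_div _ _⟩

lemma div (hg : RatPt g) (hh : RatPt h) (h0 : ∀ᶠ P in cofinite, h P ≠ 0) :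
    RatPt (fun P => g P / h P) := by
  simpa [div_eq_mul_inv] using hg.mul (hh.inv h0)

lemma evalEval (hg : RatPt g) (hh : RatPt h) (p : F[X][Y]) :
    RatPt (fun P => p.evalEval (g P) (h P)) := by
  induction p using Polynomial.induction_on' with
  | add p q hp hq => simpa [evalEval_add] using hp.add hq
  | monomial n a =>
    have h1 : RatPt (fun P => a.eval (g P)) := by
      induction a using Polynomial.induction_on' with
      | add p q hp hq => simpa using hp.add hq
      | monomial n a => simpa using (const a).mul (hg.pow n)
    have := h1.mul (hh.pow n)
    simpa [← C_mul_X_pow_eq_monomial, evalEval_mul, evalEval_pow, evalEval_C] using this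

end RatPt

variable [DecidableEq F]

/-- Separates the one finiteness condition of `IsIsogeny` into generic conditions that can be
composed and combined independently. -/
lemma isIsogeny_iff {φ : W.toAffine.Point →+ W'.toAffine.Point} :
    IsIsogeny φ ↔ (∀ᶠ P in cofinite, φ P ≠ 0) ∧ RatPt (fun P => xc (φ P)) ∧
      RatPt (fun P => yc (φ P)) := by
  constructor
  · rintro ⟨p, q, r, s, h⟩
    have h : ∀ᶠ P : W.toAffine.Point in cofinite, ∃ (x y : F) (h : W.toAffine.Nonsingular x y),
      P = .some x y h ∧ q.evalEval x y ≠ 0 ∧ s.evalEval x y ≠ 0 ∧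
      ∃ h' : W'.toAffine.Nonsingular (p.evalEval x y / q.evalEval x y)
          (r.evalEval x y / s.evalEval x y), φ P = .some _ _ h' := h
    refine ⟨?_, ⟨p, q, ?_⟩, ⟨r, s, ?_⟩⟩ <;> filter_upwards [h] with P hP <;>
      obtain ⟨x, y, h, rfl, hq, hs, h', he⟩ := hP <;> rw [he]
    · simp
    · exact ⟨hq, rfl⟩
    · exact ⟨hs, rfl⟩
  · rintro ⟨h0, ⟨p, q, h1⟩, ⟨r, s, h2⟩⟩
    refine ⟨p, q, r, s, ?_⟩
    change ∀ᶠ P : W.toAffine.Point in cofinite, ∃ (x y : F) (h : W.toAffine.Nonsingular x y),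
      P = .some x y h ∧ q.evalEval x y ≠ 0 ∧ s.evalEval x y ≠ 0 ∧
      ∃ h' : W'.toAffine.Nonsingular (p.evalEval x y / q.evalEval x y)
          (r.evalEval x y / s.evalEval x y), φ P = .some _ _ h'
    filter_upwards [h0, h1, h2, eventually_ne_zero] with P h0 h1 h2 h3
    obtain ⟨hP, hP'⟩ := exists_eq_some h3
    obtain ⟨hQ, hQ'⟩ := exists_eq_some h0
    refine ⟨_, _, hP, hP', h1.1, h2.1, ?_, ?_⟩
    · rw [← h1.2, ← h2.2]; exact hQ
    · exact point_ext h0 (Affine.Point.some_ne_zero _) h1.2 h2.2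

lemma _root_.IsIsogeny.finite_ker {φ : W.toAffine.Point →+ W'.toAffine.Point} (h : IsIsogeny φ) :
    (φ.ker : Set W.toAffine.Point).Finite := by
  have := eventually_cofinite.mp (isIsogeny_iff.mp h).1
  refine this.subset fun P hP => ?_
  simpa using (show φ P = 0 from hP)

lemma _root_.IsIsogeny.tendsto {φ : W.toAffine.Point →+ W'.toAffine.Point} (h : IsIsogeny φ) :
    Tendsto φ cofinite cofinite := AddMonoidHom.tendsto_cofinite h.finite_ker

lemma RatPt.comp {g : W'.toAffine.Point → F} (hg : RatPt g)
    {φ : W.toAffine.Point →+ W'.toAffine.Point} (hφ : IsIsogeny φ) : RatPt (fun P => g (φ P)) := by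
  obtain ⟨p, q, H⟩ := hg
  obtain ⟨-, h1, h2⟩ := isIsogeny_iff.mp hφ
  have H' := hφ.tendsto.eventually H
  refine ((h1.evalEval h2 p).div (h1.evalEval h2 q) ?_).congr ?_
  · filter_upwards [H'] with P hP using hP.1
  · filter_upwards [H'] with P hP using hP.2.symm

lemma _root_.IsIsogeny.comp {ψ : W'.toAffine.Point →+ W''.toAffine.Point} (hψ : IsIsogeny ψ)
    {φ : W.toAffine.Point →+ W'.toAffine.Point} (hφ : IsIsogeny φ) : IsIsogeny (ψ.comp φ) := by
  obtain ⟨h0, h1, h2⟩ := isIsogeny_iff.mp hψ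
  exact isIsogeny_iff.mpr ⟨hφ.tendsto.eventually h0, h1.comp hφ, h2.comp hφ⟩

end WeierstrassCurve

/-! ### Curves y² = f(x) and the shape of their isogenies -/

namespace WeierstrassCurve

variable {F : Type*} [Field F] {W W' W'' : WeierstrassCurve F}

variable (W) in
/-- The cubic polynomial `f` of a curve `y² = f(x)`. -/
noncomputable def cubic : F[X] := X ^ 3 + C W.a₂ * X ^ 2 + C W.a₄ * X + C W.a₆

@[simp] lemma eval_cubic (x : F) : W.cubic.eval x = x ^ 3 + W.a₂ * x ^ 2 + W.a₄ * x + W.a₆ := by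
  simp [cubic]

@[simp] lemma eval_derivative_cubic (x : F) :
    (derivative W.cubic).eval x = 3 * x ^ 2 + 2 * W.a₂ * x + W.a₄ := by
  simp [cubic]; ring

lemma natDegree_cubic : W.cubic.natDegree = 3 := by
  unfold cubic; compute_degree!

lemma monic_cubic : W.cubic.Monic := by
  unfold cubic; monicity!

lemma cubic_ne_zero : W.cubic ≠ 0 := monic_cubic.ne_zero

section NF

variable [W.IsCharNeTwoNF] [W'.IsCharNeTwoNF] [W''.IsCharNeTwoNF]

lemma nonsingular_iff_NF [NeZero (2 : F)] {x y : F} : W.toAffine.Nonsingular x y ↔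
    y ^ 2 = x ^ 3 + W.a₂ * x ^ 2 + W.a₄ * x + W.a₆ ∧
      (3 * x ^ 2 + 2 * W.a₂ * x + W.a₄ ≠ 0 ∨ y ≠ 0) := by
  have h1 := W.a₁_of_isCharNeTwoNF
  have h3 := W.a₃_of_isCharNeTwoNF
  rw [Affine.nonsingular_iff, Affine.equation_iff]
  simp only [h1, h3, zero_mul, add_zero, sub_zero]
  have : y ≠ -y ↔ y ≠ 0 := by
    rw [not_iff_not, eq_neg_iff_add_eq_zero, ← two_mul, mul_eq_zero]
    simp [NeZero.ne (2 : F)]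
  rw [this, ne_comm]

lemma yc_sq {P : W.toAffine.Point} (hP : P ≠ 0) : yc P ^ 2 = W.cubic.eval (xc P) := by
  obtain ⟨h, -⟩ := exists_eq_some hP
  have h2 := (Affine.equation_iff ..).mp h.1
  rw [W.a₁_of_isCharNeTwoNF, W.a₃_of_isCharNeTwoNF] at h2
  rw [eval_cubic]
  linear_combination h2

lemma yc_neg (P : W.toAffine.Point) : yc (-P) = - yc P := by
  rcases P with _ | ⟨x, y, h⟩
  · change (0 : F) = -0
    simp
  · rw [Affine.Point.neg_some, yc_some, yc_some, Affine.negY, W.a₁_of_isCharNeTwoNF,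
      W.a₃_of_isCharNeTwoNF]
    ring

variable [DecidableEq F]

lemma add_coords {P Q : W.toAffine.Point} (hP : P ≠ 0) (hQ : Q ≠ 0) (hx : xc P ≠ xc Q) :
    P + Q ≠ 0 ∧ xc (P + Q) = ((yc P - yc Q) / (xc P - xc Q)) ^ 2 - W.a₂ - xc P - xc Q ∧
      yc (P + Q) = -((yc P - yc Q) / (xc P - xc Q) * (xc (P + Q) - xc P) + yc P) := by
  obtain ⟨h, hP'⟩ := exists_eq_some hP
  obtain ⟨h', hQ'⟩ := exists_eq_some hQ
  have h1 := W.a₁_of_isCharNeTwoNF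
  have h3 := W.a₃_of_isCharNeTwoNF
  rw [hP', hQ', Affine.Point.add_of_X_ne hx]
  simp only [xc_some, yc_some, Affine.addX, Affine.addY, Affine.negAddY, Affine.negY,
    Affine.slope_of_X_ne hx, h1, h3]
  refine ⟨Affine.Point.some_ne_zero _, by ring, by ring⟩

lemma double_coords [NeZero (2 : F)] {P : W.toAffine.Point} (hP : P ≠ 0) (hy : yc P ≠ 0) :
    P + P ≠ 0 ∧
    xc (P + P) = ((derivative W.cubic).eval (xc P) / (2 * yc P)) ^ 2 - W.a₂ - 2 * xc P ∧
    yc (P + P) = -((derivative W.cubic).eval (xc P) / (2 * yc P) * (xc (P + P) - xc P) + yc P) := by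
  obtain ⟨h, hP'⟩ := exists_eq_some hP
  have h1 := W.a₁_of_isCharNeTwoNF
  have h3 := W.a₃_of_isCharNeTwoNF
  have hne : yc P ≠ W.toAffine.negY (xc P) (yc P) := by
    rw [Affine.negY, h1, h3, zero_mul, sub_zero, sub_zero, Ne, eq_neg_iff_add_eq_zero, ← two_mul]
    exact mul_ne_zero two_ne_zero hy
  rw [hP', Affine.Point.add_self_of_Y_ne hne]
  simp only [xc_some, yc_some, Affine.addX, Affine.addY, Affine.negAddY, Affine.negY,
    Affine.slope_of_Y_ne rfl hne, h1, h3, eval_derivative_cubic]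
  have e : yc P - (-yc P - 0 * xc P - 0) = 2 * yc P := by ring
  refine ⟨Affine.Point.some_ne_zero _, ?_, ?_⟩
  · rw [e]; ring
  · rw [e]; ring

lemma cubic_separable [NeZero (2 : F)] [W.IsElliptic] {x : F} (h : W.cubic.eval x = 0) :
    (derivative W.cubic).eval x ≠ 0 := by
  have he : W.toAffine.Equation x 0 := by
    rw [Affine.equation_iff, W.a₁_of_isCharNeTwoNF, W.a₃_of_isCharNeTwoNF]
    rw [eval_cubic] at h
    linear_combination -h
  have hn := Affine.equation_iff_nonsingular.mp he
  have := (nonsingular_iff_NF.mp hn).2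
  simpa using this

end NF

/-! ### Normal form of isogenies -/

variable [IsAlgClosed F] [CharZero F] [DecidableEq F]

/-- `φ(x, y) = (X(x), y H(x))` away from finitely many points. -/
def HasNF (φ : W.toAffine.Point →+ W'.toAffine.Point) (X H : RatFunc F) : Prop :=
  ∀ᶠ P in cofinite, φ P ≠ 0 ∧ xc (φ P) = X.val (xc P) ∧ yc (φ P) = yc P * H.val (xc P)

variable [W.IsElliptic]

lemma eventually_yc_ne_zero [W.IsCharNeTwoNF] : ∀ᶠ P : W.toAffine.Point in cofinite, yc P ≠ 0 := by
  filter_upwards [eventually_ne_zero, tendsto_xc.eventually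
    (RatFunc.eventually_eval_ne_zero W.cubic_ne_zero)] with P h1 h2 h3
  rw [← yc_sq h1, h3] at h2
  simp at h2

omit [IsAlgClosed F] [CharZero F] [DecidableEq F] [W.IsElliptic] in
lemma _root_.RatFunc.Rep.xc {g : F → F} {R : RatFunc F} (h : RatFunc.Rep g R) :
    ∀ᶠ P : W.toAffine.Point in cofinite, g (xc P) = R.val (xc P) := tendsto_xc.eventually h

/-- `g = R + y S` on the curve `y² = f(x)`. -/
def LinRep (g : W.toAffine.Point → F) (R S : RatFunc F) : Prop :=
  ∀ᶠ P in cofinite, g P = R.val (xc P) + yc P * S.val (xc P)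

section

variable [W.IsCharNeTwoNF]

omit [IsAlgClosed F] [CharZero F] [DecidableEq F] [W.IsElliptic] [W.IsCharNeTwoNF] in
lemma LinRep.add {g h : W.toAffine.Point → F} {R S R' S' : RatFunc F} (hg : LinRep g R S)
    (hh : LinRep h R' S') : LinRep (fun P => g P + h P) (R + R') (S + S') := by
  filter_upwards [hg, hh, ((RatFunc.Rep.val R).add (.val R')).xc,
    ((RatFunc.Rep.val S).add (.val S')).xc] with P h1 h2 h3 h4
  rw [h1, h2, ← h3, ← h4]; ring

omit [IsAlgClosed F] [CharZero F] [DecidableEq F] [W.IsElliptic] in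
lemma LinRep.mul {g h : W.toAffine.Point → F} {R S R' S' : RatFunc F} (hg : LinRep g R S)
    (hh : LinRep h R' S') : LinRep (fun P => g P * h P)
      (R * R' + algebraMap F[X] _ W.cubic * (S * S')) (R * S' + S * R') := by
  filter_upwards [hg, hh, (((RatFunc.Rep.val R).mul (.val R')).add
    ((RatFunc.Rep.poly W.cubic).mul ((RatFunc.Rep.val S).mul (.val S')))).xc,
    (((RatFunc.Rep.val R).mul (.val S')).add ((RatFunc.Rep.val S).mul (.val R'))).xc,
    eventually_ne_zero] with P h1 h2 h3 h4 h5
  rw [h1, h2, ← h3, ← h4, ← yc_sq h5]; ring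

omit [CharZero F] [DecidableEq F] in
-- Rationalisation by the norm: `g(P) g(-P) = R² - f S²` is a function of `x` alone.
lemma LinRep.inv {g : W.toAffine.Point → F} {R S : RatFunc F} (hg : LinRep g R S)
    (h0 : ∀ᶠ P in cofinite, g P ≠ 0) : ∃ R' S', LinRep (fun P => (g P)⁻¹) R' S' := by
  set N := R * R - algebraMap F[X] _ W.cubic * (S * S) with hN
  have hrep := ((((RatFunc.Rep.val R).mul (.val R)).sub
    ((RatFunc.Rep.poly W.cubic).mul ((RatFunc.Rep.val S).mul (.val S)))))
  have hneg : Tendsto (fun P : W.toAffine.Point => -P) cofinite cofinite :=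
    neg_injective.tendsto_cofinite
  have hprod : ∀ᶠ P : W.toAffine.Point in cofinite, N.val (xc P) = g P * g (-P) := by
    filter_upwards [hg, hneg.eventually hg, hrep.xc, eventually_ne_zero] with P h1 h2 h3 h4
    rw [h1, h2, ← h3, yc_neg, xc_neg, ← yc_sq h4]; ring
  refine ⟨R / N, -S / N, ?_⟩
  filter_upwards [hg, h0, hneg.eventually hg, hneg.eventually h0, hprod,
    ((RatFunc.Rep.val R).div (.val N)).xc, ((RatFunc.Rep.val S).neg.div (.val N)).xc]
    with P h1 h2 h3 h4 h5 h6 h7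
  rw [← h6, ← h7, h5]
  have : g (-P) = R.val (xc P) - yc P * S.val (xc P) := by
    rw [h3, yc_neg, xc_neg]; ring
  have h8 : R.val (xc P) + yc P * (-S.val (xc P)) = g (-P) := by rw [this]; ring
  field_simp
  rw [← h8]; ring

omit [CharZero F] [DecidableEq F] in
lemma RatPt.linRep {g : W.toAffine.Point → F} (h : RatPt g) : ∃ R S, LinRep g R S := by
  have hpoly : ∀ p : F[X][Y], ∃ R S,
      LinRep (W := W) (fun P => p.evalEval (xc P) (yc P)) R S := by
    intro p
    induction p using Polynomial.induction_on' with
    | add p q hp hq =>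
      obtain ⟨R, S, h1⟩ := hp
      obtain ⟨R', S', h2⟩ := hq
      exact ⟨_, _, by simpa [evalEval_add] using h1.add h2⟩
    | monomial n a =>
      have ha : LinRep (W := W) (fun P => a.eval (xc P)) (algebraMap F[X] _ a) 0 := by
        filter_upwards [(RatFunc.Rep.poly a).xc (W := W)] with P hP
        rw [hP]; simp
      have hy : LinRep (W := W) (fun P => yc P) 0 1 :=
        Eventually.of_forall fun P => by simp
      have hyn : ∃ R S, LinRep (W := W) (fun P => yc P ^ n) R S := by
        induction n with
        | zero => exact ⟨1, 0, Eventually.of_forall fun P => by simp⟩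
        | succ n ih =>
          obtain ⟨R, S, h⟩ := ih
          exact ⟨_, _, by simpa [pow_succ] using h.mul hy⟩
      obtain ⟨R, S, h⟩ := hyn
      have h2 := ha.mul h
      simp only [← C_mul_X_pow_eq_monomial, evalEval_mul, evalEval_pow, evalEval_C, evalEval_X]
      exact ⟨_, _, h2⟩
  obtain ⟨p, q, H⟩ := h
  obtain ⟨R, S, h1⟩ := hpoly p
  obtain ⟨R', S', h2⟩ := hpoly q
  obtain ⟨R'', S'', h3⟩ := h2.inv (by filter_upwards [H] with P hP using hP.1)
  have h6 := h1.mul h3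
  refine ⟨R * R'' + algebraMap F[X] _ W.cubic * (S * S''), R * S'' + S * R'', ?_⟩
  filter_upwards [h6, H] with P h4 h5
  rw [h5.2, div_eq_mul_inv, h4]

end

variable [W'.IsElliptic] [W''.IsElliptic]
variable [W.IsCharNeTwoNF] [W'.IsCharNeTwoNF] [W''.IsCharNeTwoNF]

omit [W'.IsElliptic] in
-- A homomorphism commutes with `-1`, so `x ∘ φ` is even and `y ∘ φ` is odd under `y ↦ -y`.
-- Comparing the values at `P` and `-P` removes the other component.
lemma _root_.IsIsogeny.exists_hasNF {φ : W.toAffine.Point →+ W'.toAffine.Point}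
    (h : IsIsogeny φ) : ∃ X H, HasNF φ X H := by
  obtain ⟨h0, h1, h2⟩ := isIsogeny_iff.mp h
  obtain ⟨R, S, h1⟩ := h1.linRep
  obtain ⟨R', S', h2⟩ := h2.linRep
  have hneg : Tendsto (fun P : W.toAffine.Point => -P) cofinite cofinite :=
    neg_injective.tendsto_cofinite
  refine ⟨R, S', ?_⟩
  filter_upwards [h0, h1, h2, hneg.eventually h1, hneg.eventually h2] with P h0 h1 h2 h3 h4
  simp only [map_neg, xc_neg, yc_neg] at h3 h4
  refine ⟨h0, ?_, ?_⟩
  · linear_combination (h1 + h3) / 2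
  · linear_combination (h2 - h4) / 2

omit [IsAlgClosed F] [CharZero F] [W.IsElliptic] [W'.IsElliptic] [W.IsCharNeTwoNF]
  [W'.IsCharNeTwoNF] in
lemma HasNF.isIsogeny {φ : W.toAffine.Point →+ W'.toAffine.Point} {X H : RatFunc F}
    (h : HasNF φ X H) : IsIsogeny φ := by
  have hv : ∀ R : RatFunc F, RatPt (fun P : W.toAffine.Point => R.val (xc P)) := by
    intro R
    refine ⟨C R.num, C R.denom, ?_⟩
    filter_upwards [tendsto_xc.eventually R.eventually_denom_ne_zero] with P hP
    simp only [evalEval_C]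
    exact ⟨hP, rfl⟩
  refine isIsogeny_iff.mpr ⟨?_, ?_, ?_⟩
  · filter_upwards [h] with P hP using hP.1
  · refine (hv X).congr ?_
    filter_upwards [h] with P hP using hP.2.1.symm
  · refine (RatPt.y.mul (hv H)).congr ?_
    filter_upwards [h] with P hP using hP.2.2.symm

section Basic

variable {φ : W.toAffine.Point →+ W'.toAffine.Point} {X H : RatFunc F}

omit [CharZero F] [W'.IsElliptic] [W.IsCharNeTwoNF] [W'.IsCharNeTwoNF] in
lemma HasNF.ne_C (h : HasNF φ X H) (c : F) : X ≠ RatFunc.C c := by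
  rintro rfl
  have h1 : Tendsto (fun P => xc (φ P)) cofinite cofinite := tendsto_xc.comp h.isIsogeny.tendsto
  have h2 : ∀ᶠ t in cofinite, t ≠ c := by simp [eventually_cofinite]
  obtain ⟨P, h3, h4⟩ := ((h1.eventually h2).and h).exists
  simp [h4.2.1] at h3

omit [W'.IsElliptic] in
lemma HasNF.relation (h : HasNF φ X H) :
    aeval X W'.cubic = H ^ 2 * algebraMap F[X] (RatFunc F) W.cubic := by
  have : Infinite F := IsAlgClosed.instInfinite
  refine RatFunc.Rep.unique (g := fun x => W'.cubic.eval (X.val x)) ((RatFunc.Rep.val X).aeval _) ?_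
  refine ((RatFunc.Rep.val H).pow 2 |>.mul (RatFunc.Rep.poly W.cubic)).congr ?_
  refine (eventually_xc_iff (W := W)).mp ?_
  filter_upwards [h, eventually_ne_zero] with P h1 h2
  rw [← h1.2.1, ← yc_sq h1.1, h1.2.2, ← yc_sq h2]; ring

omit [W.IsCharNeTwoNF] [W'.IsCharNeTwoNF] in
-- A nonconstant rational function attains almost every value, so the image contains almost every
-- point, a sign being absorbed by `-P`. A cofinite subgroup of an infinite group is the whole
-- group.
lemma HasNF.surjective (h : HasNF φ X H) : Function.Surjective φ := by
  have h1 : ∀ᶠ t in cofinite, ∃ x, X.val x = t ∧ ∀ P : W.toAffine.Point, xc P = x →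
      φ P ≠ 0 ∧ xc (φ P) = X.val (xc P) := by
    have hb : {P | ¬ (φ P ≠ 0 ∧ xc (φ P) = X.val (xc P))}.Finite :=
      eventually_cofinite.mp (h.mono fun P hP => ⟨hP.1, hP.2.1⟩)
    have hb' : ∀ᶠ t in cofinite, ∀ x, X.val x = t → ∀ P : W.toAffine.Point, xc P = x →
      φ P ≠ 0 ∧ xc (φ P) = X.val (xc P) := by
      rw [eventually_cofinite]
      refine (hb.image fun P => X.val (xc P)).subset fun t ht => ?_
      simp only [Set.mem_ofPred_eq, not_forall] at ht
      obtain ⟨x, hx, P, hP, h⟩ := ht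
      exact ⟨P, h, by simp [hP, hx]⟩
    filter_upwards [hb', RatFunc.eventually_card_fiber h.ne_C] with t ht ht'
    obtain ⟨s, hs, hs'⟩ := ht'
    have : s.Nonempty := by
      rw [← Finset.card_pos, hs]; exact RatFunc.deg_pos h.ne_C
    obtain ⟨x, hx⟩ := this
    have hx := ((hs' x).mp hx).2
    exact ⟨x, hx, ht x hx⟩
  have h2 : ∀ᶠ Q : W'.toAffine.Point in cofinite, Q ∈ φ.range := by
    filter_upwards [tendsto_xc.eventually h1, eventually_ne_zero] with Q hQ hQ0
    obtain ⟨x, hx, hP⟩ := hQ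
    obtain ⟨P, hP0, rfl⟩ := exists_xc_eq (W := W) x
    obtain ⟨h3, h4⟩ := hP P rfl
    rcases eq_or_eq_neg hQ0 h3 (by rw [h4, hx]) with h | h
    · exact ⟨P, h.symm⟩
    · exact ⟨-P, by rw [map_neg, h]⟩
  exact AddMonoidHom.range_eq_top.mp (AddSubgroup.eq_top_of_eventually _ h2)

/-- Over a generic `t = x(Q)`, the `x`-coordinates of the coset `φ⁻¹(Q)` are exactly the `deg X`
points of the fibre of `X`. They are distinct because `y(Q) ≠ 0` separates `Q` from `-Q`. -/
lemma HasNF.card_ker (h : HasNF φ X H) : Nat.card φ.ker = X.deg := by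
  have hb : {P | ¬ (φ P ≠ 0 ∧ xc (φ P) = X.val (xc P))}.Finite :=
    eventually_cofinite.mp (h.mono fun P hP => ⟨hP.1, hP.2.1⟩)
  have : Infinite F := IsAlgClosed.instInfinite
  have hb' : ∀ᶠ t in cofinite, ∀ x, X.val x = t → ∀ P : W.toAffine.Point, xc P = x →
      φ P ≠ 0 ∧ xc (φ P) = X.val (xc P) := by
    rw [eventually_cofinite]
    refine (hb.image fun P => X.val (xc P)).subset fun t ht => ?_
    simp only [Set.mem_ofPred_eq, not_forall] at ht
    obtain ⟨x, hx, P, hP, h⟩ := ht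
    exact ⟨P, h, by simp [hP, hx]⟩
  have hb'' : ∀ᶠ t in cofinite, ∀ P : W.toAffine.Point, xc (φ P) = t →
      φ P ≠ 0 ∧ xc (φ P) = X.val (xc P) := by
    rw [eventually_cofinite]
    refine (hb.image fun P => xc (φ P)).subset fun t ht => ?_
    simp only [Set.mem_ofPred_eq, not_forall] at ht
    obtain ⟨P, hP, h⟩ := ht
    exact ⟨P, h, hP⟩
  obtain ⟨t, h1, h2, ⟨s, hs, hs'⟩, h4, h5⟩ := (hb'.and (hb''.and
    ((RatFunc.eventually_card_fiber h.ne_C).and ((RatFunc.eventually_eval_ne_zero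
      W'.cubic_ne_zero).and (show ∀ᶠ t : F in cofinite, t ≠ 0 by simp [eventually_cofinite]))))).exists
  obtain ⟨Q, hQ, rfl⟩ := exists_xc_eq (W := W') t
  obtain ⟨P₀, hP₀⟩ := h.surjective Q
  have hyQ : yc Q ≠ 0 := by
    intro h0; rw [← yc_sq hQ, h0] at h4; simp at h4
  have hfib : ∀ P, φ P = Q → xc P ∈ s := by
    intro P hP
    have h6 := (h2 P (by rw [hP])).2
    rw [hP] at h6
    rw [hs']
    -- At a pole `X.val` has the default value 0, so `t ≠ 0` is needed to rule poles out.
    refine ⟨fun h0 => h5 ?_, h6.symm⟩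
    rw [h6, RatFunc.val_eq, h0, div_zero]
  have hne : ∀ P, φ P = Q → P ≠ 0 := by
    rintro P hP rfl
    exact hQ (by rw [← hP, map_zero])
  let e : φ.ker → s := fun k => ⟨xc (P₀ + (k : W.toAffine.Point)), hfib _ (by
    rw [map_add, hP₀, (AddMonoidHom.mem_ker).mp k.2, add_zero])⟩
  have he : Function.Bijective e := by
    constructor
    · rintro ⟨k, hk⟩ ⟨k', hk'⟩ hkk
      have hk1 : φ (P₀ + k) = Q := by rw [map_add, hP₀, (AddMonoidHom.mem_ker).mp hk, add_zero]
      have hk2 : φ (P₀ + k') = Q := by rw [map_add, hP₀, (AddMonoidHom.mem_ker).mp hk', add_zero]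
      have hkk' : xc (P₀ + k) = xc (P₀ + k') := Subtype.ext_iff.mp hkk
      rcases eq_or_eq_neg (hne _ hk1) (hne _ hk2) hkk' with h6 | h6
      · exact Subtype.ext (add_left_cancel h6)
      · exfalso
        rw [h6, map_neg, hk2] at hk1
        have := congrArg yc hk1
        rw [yc_neg] at this
        apply hyQ
        linear_combination (-1 / 2 : F) * this
    · rintro ⟨x, hx⟩
      have hx2 := ((hs' x).mp hx).2
      obtain ⟨P, hP, rfl⟩ := exists_xc_eq (W := W) x
      obtain ⟨h6, h7⟩ := h1 _ hx2 P rfl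
      have key : ∀ P', φ P' = Q → xc P' = xc P → ∃ k, e k = ⟨xc P, hx⟩ := by
        intro P' hP' hx'
        refine ⟨⟨P' - P₀, ?_⟩, ?_⟩
        · rw [AddMonoidHom.mem_ker, map_sub, hP', hP₀, sub_self]
        · apply Subtype.ext
          simp [e, hx']
      rcases eq_or_eq_neg h6 hQ (h7.trans hx2) with h8 | h8
      · exact key P h8 rfl
      · exact key (-P) (by rw [map_neg, h8, neg_neg]) (xc_neg P)
  rw [Nat.card_congr (Equiv.ofBijective e he), ← hs]
  simp

end Basic

end WeierstrassCurve

/-! ### Leading coefficients of isogenies; commutativity of endomorphisms -/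

namespace WeierstrassCurve

variable {F : Type*} [Field F] {W W' W'' : WeierstrassCurve F}
variable [IsAlgClosed F] [CharZero F] [DecidableEq F]
variable [W.IsElliptic] [W'.IsElliptic] [W''.IsElliptic]
variable [W.IsCharNeTwoNF] [W'.IsCharNeTwoNF] [W''.IsCharNeTwoNF]

variable {φ ψ : W.toAffine.Point →+ W'.toAffine.Point} {X H X' H' : RatFunc F}

lemma HasNF.unique (h : HasNF φ X H) (h' : HasNF φ X' H') : X = X' ∧ H = H' := by
  have : Infinite F := IsAlgClosed.instInfinite
  constructor
  · refine RatFunc.Rep.unique (.val X) (RatFunc.Rep.congr (.val X') ?_)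
    refine (eventually_xc_iff (W := W)).mp ?_
    filter_upwards [h, h'] with P h1 h2
    rw [← h1.2.1, ← h2.2.1]
  · refine RatFunc.Rep.unique (.val H) (RatFunc.Rep.congr (.val H') ?_)
    refine (eventually_xc_iff (W := W)).mp ?_
    filter_upwards [h, h', eventually_yc_ne_zero] with P h1 h2 h3
    have := h1.2.2.symm.trans h2.2.2
    exact (mul_left_cancel₀ h3 this).symm

lemma HasNF.comp {ψ : W'.toAffine.Point →+ W''.toAffine.Point} (hψ : HasNF ψ X' H')
    (hφ : HasNF φ X H) : HasNF (ψ.comp φ) (X'.subst X) (H'.subst X * H) := by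
  have h1 := ((RatFunc.Rep.val X').comp (.val X) hφ.ne_C).xc (W := W)
  have h2 := (((RatFunc.Rep.val H').comp (.val X) hφ.ne_C).mul (.val H)).xc (W := W)
  filter_upwards [hφ, hφ.isIsogeny.tendsto.eventually hψ, h1, h2] with P a b c d
  rw [← c, ← d]
  refine ⟨b.1, ?_, ?_⟩
  · rw [AddMonoidHom.comp_apply, b.2.1, a.2.1]
  · rw [AddMonoidHom.comp_apply, b.2.2, a.2.2, a.2.1]; ring

lemma HasNF.neg (h : HasNF φ X H) : HasNF (-φ) X (-H) := by
  filter_upwards [h, (RatFunc.Rep.val H).neg.xc] with P h1 h2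
  rw [← h2, AddMonoidHom.neg_apply, xc_neg, yc_neg, h1.2.2]
  exact ⟨neg_ne_zero.mpr h1.1, h1.2.1, by ring⟩

lemma HasNF.id : HasNF (AddMonoidHom.id W.toAffine.Point) RatFunc.X 1 := by
  filter_upwards [eventually_ne_zero] with P hP
  simpa using hP

variable (W) in
/-- The `x`-coordinate of `P + Q` when `Q` has coordinates `(X', y H')` and `P` has coordinates
`(X, y H)`, with `y² = W.cubic`. -/
noncomputable def addRat (a₂ : F) (X H X' H' : RatFunc F) : RatFunc F :=
  algebraMap F[X] (RatFunc F) W.cubic * ((H - H') / (X - X')) ^ 2 - RatFunc.C a₂ - X - X'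

lemma HasNF.add (h : HasNF φ X H) (h' : HasNF ψ X' H') (hne : X ≠ X') :
    ∃ H'', HasNF (φ + ψ) (addRat W W'.a₂ X H X' H') H'' := by
  set L := (H - H') / (X - X') with hL
  set X3 := addRat W W'.a₂ X H X' H' with hX3
  refine ⟨-(L * (X3 - X) + H), ?_⟩
  have e1 := (((RatFunc.Rep.val H).sub (.val H')).div ((RatFunc.Rep.val X).sub (.val X'))).xc (W := W)
  have e2 := (((((RatFunc.Rep.poly W.cubic).mul ((RatFunc.Rep.val L).pow 2)).sub
    (.const W'.a₂)).sub (.val X)).sub (.val X')).xc (W := W)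
  have e3 := (((RatFunc.Rep.val L).mul ((RatFunc.Rep.val X3).sub (.val X))).add
    (.val H)).neg.xc (W := W)
  have e4 := ((RatFunc.Rep.val X).sub (.val X')).eventually_ne_zero (sub_ne_zero.mpr hne)
  filter_upwards [h, h', e1, e2, e3, tendsto_xc.eventually e4, eventually_ne_zero]
    with P h1 h2 e1 e2 e3 e4 h0
  have hx : xc (φ P) ≠ xc (ψ P) := by rw [h1.2.1, h2.2.1]; exact sub_ne_zero.mp e4
  obtain ⟨a, b, c⟩ := add_coords h1.1 h2.1 hx
  have hsl : (yc (φ P) - yc (ψ P)) / (xc (φ P) - xc (ψ P)) = yc P * L.val (xc P) := by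
    rw [hL, ← e1, h1.2.1, h2.2.1, h1.2.2, h2.2.2]; ring
  have hxx : xc (φ P + ψ P) = X3.val (xc P) := by
    rw [b, hsl, hX3, addRat, ← hL, ← e2, mul_pow, yc_sq h0, h1.2.1, h2.2.1]
  refine ⟨a, hxx, ?_⟩
  rw [AddMonoidHom.add_apply, c, hsl, hxx, ← e3, h1.2.1, h1.2.2]; ring

lemma HasNF.eq_of_eq (h : HasNF φ X H) (h' : HasNF ψ X H) : φ = ψ := by
  refine AddMonoidHom.eq_of_eventually ?_
  filter_upwards [h, h'] with P h1 h2
  exact point_ext h1.1 h2.1 (h1.2.1.trans h2.2.1.symm) (h1.2.2.trans h2.2.2.symm)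

omit [IsAlgClosed F] [CharZero F] [DecidableEq F] [W.IsElliptic] [W.IsCharNeTwoNF] in
lemma cubicRat_ne_zero : algebraMap F[X] (RatFunc F) W.cubic ≠ 0 :=
  RatFunc.algebraMap_ne_zero W.cubic_ne_zero

lemma HasNF.H_ne_zero (h : HasNF φ X H) : H ≠ 0 := by
  rintro rfl
  have := h.isIsogeny.tendsto.eventually eventually_yc_ne_zero
  obtain ⟨P, h1, h2⟩ := (h.and this).exists
  rw [h1.2.2] at h2
  simp at h2

/-- The relation `f'(X) = H² f` determines `H` from `X` up to sign. -/
lemma HasNF.eq_or_eq_neg (h : HasNF φ X H) (h' : HasNF ψ X H') : φ = ψ ∨ φ = -ψ := by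
  have h1 := h.relation.symm.trans h'.relation
  have h2 : H ^ 2 = H' ^ 2 := mul_right_cancel₀ cubicRat_ne_zero h1
  rcases sq_eq_sq_iff_eq_or_eq_neg.mp h2 with h3 | h3
  · subst h3; exact Or.inl (h.eq_of_eq h')
  · subst h3; exact Or.inr (h.eq_of_eq h'.neg)

variable (W) in
/-- The duplication map on `x`-coordinates. -/
noncomputable def dupRat : RatFunc F :=
  algebraMap F[X] (RatFunc F) (derivative W.cubic) ^ 2 /
    (RatFunc.C 4 * algebraMap F[X] (RatFunc F) W.cubic) - RatFunc.C W.a₂ -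
    RatFunc.C 2 * RatFunc.X

lemma HasNF.double : ∃ H, HasNF (AddMonoidHom.id W.toAffine.Point + AddMonoidHom.id _)
    W.dupRat H := by
  set f := algebraMap F[X] (RatFunc F) W.cubic with hf
  set f' := algebraMap F[X] (RatFunc F) (derivative W.cubic) with hf'
  refine ⟨-(f' / (RatFunc.C 2 * f) * (W.dupRat - RatFunc.X) + RatFunc.C 1), ?_⟩
  have e2 := ((((RatFunc.Rep.poly (derivative W.cubic)).pow 2).div ((RatFunc.Rep.const 4).mul
    (.poly W.cubic))).sub (.const W.a₂)).sub ((RatFunc.Rep.const (2 : F)).mul .id) |>.xc (W := W)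
  have e3 := ((((RatFunc.Rep.poly (derivative W.cubic)).div ((RatFunc.Rep.const 2).mul
    (.poly W.cubic))).mul ((RatFunc.Rep.val W.dupRat).sub .id)).add (.const 1)).neg.xc (W := W)
  filter_upwards [eventually_ne_zero, eventually_yc_ne_zero, e2, e3] with P h0 hy e2 e3
  obtain ⟨a, b, c⟩ := double_coords h0 hy
  have hxx : xc (P + P) = W.dupRat.val (xc P) := by
    rw [b, dupRat, ← e2, ← yc_sq h0]; ring
  refine ⟨a, hxx, ?_⟩
  rw [AddMonoidHom.add_apply, AddMonoidHom.id_apply, c, hxx, ← e3, ← yc_sq h0]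
  field_simp

/-- At infinity (3x²)²/(4x³) - 2x = x/4. -/
lemma lead_dupRat : W.dupRat.Lead (1 / 4) 1 := by
  have h1 : (algebraMap F[X] (RatFunc F) W.cubic).Lead 1 3 := by
    have := RatFunc.Lead.poly W.cubic_ne_zero
    rwa [monic_cubic.leadingCoeff, natDegree_cubic] at this
  have h2 : (algebraMap F[X] (RatFunc F) (derivative W.cubic)).Lead 3 2 := by
    have hd : (derivative W.cubic).natDegree = 2 := by
      rw [natDegree_derivative, natDegree_cubic]
    have h0 : derivative W.cubic ≠ 0 := by
      intro h; rw [h] at hd; simp at hd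
    have := RatFunc.Lead.poly h0
    rw [leadingCoeff_derivative, monic_cubic.leadingCoeff, natDegree_cubic, hd] at this
    simpa using this
  have h3 := (h2.pow 2).div ((RatFunc.Lead.C ((by norm_num : (4 : F) ≠ 0))).mul h1)
  have h4 := h3.add_of_lt (S := -RatFunc.C W.a₂) (by
    rw [Valuation.map_neg]
    exact lt_of_le_of_lt (RatFunc.vInf_C_le _) (by
      rw [← WithZero.exp_zero, WithZero.exp_lt_exp]; norm_num))
  have h5 := ((RatFunc.Lead.C (two_ne_zero (α := F))).mul RatFunc.Lead.X).neg
  norm_num at h4 h5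
  have h6 := h4.add h5 (by norm_num)
  norm_num at h6
  rw [dupRat]
  convert h6 using 1
  rw [map_ofNat, map_ofNat]; ring

/-- This is `φ ∘ [2] = [2] ∘ φ` read on `x`-coordinates. -/
lemma HasNF.subst_dupRat (h : HasNF φ X H) : X.subst W.dupRat =
    aeval X (derivative W'.cubic) ^ 2 / (RatFunc.C 4 * aeval X W'.cubic) - RatFunc.C W'.a₂ -
      RatFunc.C 2 * X := by
  have : Infinite F := IsAlgClosed.instInfinite
  obtain ⟨H2, h2⟩ := HasNF.double (W := W)
  obtain ⟨H2', h2'⟩ := HasNF.double (W := W')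
  have e := h.comp h2
  have e' := h2'.comp h
  have : φ.comp (AddMonoidHom.id W.toAffine.Point + AddMonoidHom.id _) =
      (AddMonoidHom.id W'.toAffine.Point + AddMonoidHom.id _).comp φ := by
    ext P; simp
  rw [this] at e
  rw [(e.unique e').1]
  refine RatFunc.Rep.unique ((RatFunc.Rep.val W'.dupRat).comp (.val X) h.ne_C) ?_
  have h3 := (((RatFunc.Rep.val X).aeval (derivative W'.cubic)).pow 2).div
    ((RatFunc.Rep.const 4).mul ((RatFunc.Rep.val X).aeval W'.cubic)) |>.sub
    (.const W'.a₂) |>.sub ((RatFunc.Rep.const 2).mul (.val X))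
  refine h3.congr ?_
  have h4 := ((((RatFunc.Rep.poly (derivative W'.cubic)).pow 2).div ((RatFunc.Rep.const 4).mul
    (.poly W'.cubic))).sub (.const W'.a₂)).sub ((RatFunc.Rep.const (2 : F)).mul .id)
  filter_upwards [(RatFunc.tendsto_val h.ne_C).eventually h4] with x hx
  rw [dupRat, ← hx]

open WithZero RatFunc in
-- An isogeny fixes the origin and is unramified there; this is extracted from `φ ∘ [2] = [2] ∘ φ`.
-- If `X` had a finite value `c` at infinity, then parity in `f'(X) = H² f` would make `c` a root of
-- the target cubic, and duplication would create a pole on one side only. So `X` has a pole of some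
-- order `e`, and comparison of leading coefficients gives `4 ^ e = 4`. The relation then gives
-- order 0 for `H`.
lemma HasNF.lead (h : HasNF φ X H) : ∃ κ l, X.Lead κ 1 ∧ H.Lead l 0 := by
  have hX0 : X ≠ 0 := by
    have := h.ne_C 0
    rwa [map_zero] at this
  have hf : (algebraMap F[X] (RatFunc F) W.cubic).Lead 1 3 := by
    have := RatFunc.Lead.poly W.cubic_ne_zero
    rwa [monic_cubic.leadingCoeff, natDegree_cubic] at this
  have hrel := h.relation
  have hs := h.subst_dupRat
  have hXl := lead_of_ne_zero hX0
  have hHl := lead_of_ne_zero h.H_ne_zero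
  set κ := X.num.leadingCoeff / X.denom.leadingCoeff
  set e : ℤ := X.num.natDegree - X.denom.natDegree
  set l := H.num.leadingCoeff / H.denom.leadingCoeff
  set m : ℤ := H.num.natDegree - H.denom.natDegree
  have hR := (hHl.pow 2).mul hf
  rw [← hrel] at hR
  have hD := lead_dupRat (W := W)
  have hL := hD.subst one_pos hXl
  have hepos : 0 < e := by
    by_contra hle
    have hv : vInf X ≤ 1 := by
      rw [hXl.vInf, ← exp_zero, exp_le_exp]; omega
    obtain ⟨c, hc⟩ := exists_value_at_infinity hv
    have hc0 : W'.cubic.eval c = 0 := by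
      by_contra h0
      have h1 := vInf_aeval_eq hc h0
      rw [hR.vInf, ← exp_zero] at h1
      have := exp_injective h1
      push_cast at this
      omega
    have hd := vInf_aeval_eq hc (cubic_separable hc0)
    have hcv := vInf_aeval_lt hc hc0
    have hcne : aeval X W'.cubic ≠ 0 := hR.ne_zero
    have h1 : 1 < vInf (aeval X (derivative W'.cubic) ^ 2 / (RatFunc.C 4 * aeval X W'.cubic)) := by
      rw [map_div₀, map_pow, hd, map_mul, vInf_C ((by norm_num : (4 : F) ≠ 0)), one_mul, one_pow]
      rw [one_div]
      exact (one_lt_inv₀ (by simpa [zero_lt_iff] using hcne)).mpr hcv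
    have h2 : vInf (-RatFunc.C W'.a₂ - RatFunc.C 2 * X) ≤ 1 := by
      refine Valuation.map_sub_le _ ?_ ?_
      · rw [Valuation.map_neg]; exact vInf_C_le _
      · rw [map_mul]; exact mul_le_one' (vInf_C_le _) hv
    have h3 : vInf (X.subst W.dupRat) ≤ 1 := by
      rw [hL.vInf, ← exp_zero, exp_le_exp]; omega
    rw [hs, sub_sub, sub_eq_add_neg, neg_add', Valuation.map_add_eq_of_lt_left] at h3
    · exact absurd h1 (not_lt.mpr h3)
    · exact lt_of_le_of_lt h2 h1
  have hder : (derivative W'.cubic).natDegree = 2 := by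
    rw [natDegree_derivative, natDegree_cubic]
  have hder0 : derivative W'.cubic ≠ 0 := by
    intro h; rw [h] at hder; simp at hder
  have hlc : (derivative W'.cubic).leadingCoeff = 3 := by
    rw [leadingCoeff_derivative, monic_cubic.leadingCoeff, natDegree_cubic]; norm_num
  have h1 := hXl.aeval hepos hder0
  have h2 := hXl.aeval hepos W'.cubic_ne_zero
  rw [hder, hlc] at h1
  rw [natDegree_cubic, monic_cubic.leadingCoeff] at h2
  have h3 := (h1.pow 2).div ((Lead.C ((by norm_num : (4 : F) ≠ 0))).mul h2)
  have h3e : (((2 : ℕ) : ℤ) * (((2 : ℕ) : ℤ) * e) - (0 + ((3 : ℕ) : ℤ) * e)) = e := by push_cast; ring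
  rw [h3e] at h3
  have h4 := h3.add_of_lt (S := -RatFunc.C W'.a₂) (by
    rw [Valuation.map_neg]
    exact lt_of_le_of_lt (vInf_C_le _) (by
      rw [← exp_zero, exp_lt_exp]; exact hepos))
  have h5 := ((Lead.C (two_ne_zero (α := F))).mul hXl).neg
  rw [zero_add] at h5
  have hκ := hXl.1
  have hval : (3 * κ ^ 2) ^ 2 / (4 * (1 * κ ^ 3)) + -(2 * κ) = κ / 4 := by
    field_simp; ring
  have h6 := h4.add h5 (by rw [hval]; exact div_ne_zero hκ (by norm_num))
  rw [hval] at h6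
  rw [hs, sub_sub, sub_eq_add_neg, neg_add, ← add_assoc] at hL
  obtain ⟨h7, -⟩ := hL.unique h6
  have he1 : e = 1 := by
    have h8 : (1 / 4 : F) ^ e = 1 / 4 := by
      have : κ * (1 / 4 : F) ^ e = κ * (1 / 4) := by rw [h7]; ring
      exact mul_left_cancel₀ hκ this
    obtain ⟨n, hn⟩ := Int.eq_ofNat_of_zero_le hepos.le
    rw [hn, zpow_natCast, one_div, inv_pow, inv_inj] at h8
    have h9 : (4 : ℕ) ^ n = 4 := by exact_mod_cast h8
    have h10 : n = 1 := Nat.pow_right_injective (le_refl 4 |>.trans' (by norm_num)) (by simpa using h9)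
    rw [hn, h10]; rfl
  have hm0 : m = 0 := by
    have := (h2.unique hR).2
    rw [he1] at this
    push_cast at this
    omega
  exact ⟨κ, l, he1 ▸ hXl, hm0 ▸ hHl⟩

open WithZero RatFunc in
/-- An isogeny is determined by its leading coefficients at infinity. -/
lemma HasNF.eq_of_lead {κ l : F} (h : HasNF φ X H) (h' : HasNF ψ X' H') (hX : X.Lead κ 1)
    (hX' : X'.Lead κ 1) (hH : H.Lead l 0) (hH' : H'.Lead l 0) : φ = ψ := by
  have hf : (algebraMap F[X] (RatFunc F) W.cubic).Lead 1 3 := by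
    have := RatFunc.Lead.poly W.cubic_ne_zero
    rwa [monic_cubic.leadingCoeff, natDegree_cubic] at this
  by_cases hne : X = X'
  · subst hne
    rcases h.eq_or_eq_neg h' with h1 | h1
    · exact h1
    · exfalso
      subst h1
      have h2 := (h.unique h'.neg).2
      subst h2
      have := hH.unique hH'.neg
      have h3 := hH.1
      apply h3
      linear_combination this.1 / 2
  -- Otherwise `φ - ψ` is an isogeny whose `x`-coordinate contains `f ((H + H') / (X - X'))²`. Since
  -- `X - X'` has no pole at infinity, this term has a pole of order at least 3, against order 1 for
  -- an isogeny.
  · exfalso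
    obtain ⟨H'', h1⟩ := h.add h'.neg hne
    obtain ⟨κ', -, h2, -⟩ := h1.lead
    have h3 := lead_of_ne_zero (sub_ne_zero.mpr hne)
    have h4 := hX.vInf_sub_lt hX'
    rw [h3.vInf, exp_lt_exp] at h4
    have h5 := hf.mul (((hH.add hH' (by
      have := hH.1
      rw [← two_mul]; exact mul_ne_zero two_ne_zero this)).div h3).pow 2)
    have h6 := h5.vInf
    have h7 : RatFunc.vInf (-RatFunc.C W'.a₂ - X - X') ≤ exp 1 := by
      refine Valuation.map_sub_le _ (Valuation.map_sub_le _ ?_ hX.vInf.le) hX'.vInf.le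
      rw [Valuation.map_neg]
      refine (vInf_C_le _).trans ?_
      rw [← exp_zero, exp_le_exp]; norm_num
    have h8 := h2.vInf
    rw [addRat, sub_neg_eq_add, show ∀ a b c d : RatFunc F, a - b - c - d = a + (-b - c - d) by
      intros; ring, Valuation.map_add_eq_of_lt_left, h6] at h8
    · have := exp_injective h8
      push_cast at this
      omega
    · rw [h6]
      refine lt_of_le_of_lt h7 ?_
      rw [exp_lt_exp]
      push_cast
      omega

/-- Isogenies from a curve to itself commute with each other (in characteristic zero). -/
theorem IsIsogeny.commute {φ ψ : W.toAffine.Point →+ W.toAffine.Point} (hφ : IsIsogeny φ)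
    (hψ : IsIsogeny ψ) : φ.comp ψ = ψ.comp φ := by
  obtain ⟨X, H, h⟩ := hφ.exists_hasNF
  obtain ⟨X', H', h'⟩ := hψ.exists_hasNF
  obtain ⟨κ, l, h1, h2⟩ := h.lead
  obtain ⟨κ', l', h1', h2'⟩ := h'.lead
  -- Leading coefficients multiply under composition, and the field is commutative.
  refine (h.comp h').eq_of_lead (h'.comp h) (κ := κ * κ') (l := l * l') ?_ ?_ ?_ ?_
  · simpa using h1'.subst one_pos h1
  · simpa [mul_comm] using h1.subst one_pos h1'
  · simpa using (h1'.subst one_pos h2).mul h2'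
  · simpa [mul_comm] using (h1.subst one_pos h2').mul h2

end WeierstrassCurve

/-! ### Factorisation, degree bounds and absence of complex multiplication -/

/-- The kernel of a composite of surjective maps. -/
lemma AddMonoidHom.card_ker_comp {A B C : Type*} [AddCommGroup A] [AddCommGroup B] [AddCommGroup C]
    (g : B →+ C) (f : A →+ B) (hf : Function.Surjective f) :
    Nat.card (g.comp f).ker = Nat.card g.ker * Nat.card f.ker := by
  let r : (g.comp f).ker →+ g.ker :=
    (f.comp (g.comp f).ker.subtype).codRestrict g.ker fun x => x.2
  have hr : Function.Surjective r := by
    rintro ⟨y, hy⟩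
    obtain ⟨x, rfl⟩ := hf y
    exact ⟨⟨x, hy⟩, rfl⟩
  rw [AddSubgroup.card_eq_card_quotient_mul_card_addSubgroup r.ker,
    Nat.card_congr (QuotientAddGroup.quotientKerEquivOfSurjective r hr).toEquiv]
  congr 1
  refine Nat.card_congr ⟨fun x => ⟨x.1.1, ?_⟩, fun x => ⟨⟨x.1, ?_⟩, ?_⟩, fun x => rfl, fun x => rfl⟩
  · exact congrArg Subtype.val (show r x.1 = 0 from x.2)
  · change g (f x.1) = 0
    rw [show f x.1 = 0 from x.2, map_zero]
  · exact Subtype.ext x.2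

namespace WeierstrassCurve

variable {F : Type*} [Field F] {W W' W'' : WeierstrassCurve F}
variable [IsAlgClosed F] [CharZero F] [DecidableEq F]
variable [W.IsElliptic] [W'.IsElliptic] [W''.IsElliptic]
variable [W.IsCharNeTwoNF] [W'.IsCharNeTwoNF] [W''.IsCharNeTwoNF]

variable {φ ψ : W.toAffine.Point →+ W'.toAffine.Point} {X H X' H' : RatFunc F}

lemma IsIsogeny.id : IsIsogeny (AddMonoidHom.id W.toAffine.Point) := HasNF.id.isIsogeny

lemma IsIsogeny.neg (h : IsIsogeny φ) : IsIsogeny (-φ) := by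
  obtain ⟨X, H, h⟩ := h.exists_hasNF
  exact h.neg.isIsogeny

lemma IsIsogeny.surjective (h : IsIsogeny φ) : Function.Surjective φ := by
  obtain ⟨X, H, h⟩ := h.exists_hasNF
  exact h.surjective

lemma IsIsogeny.card_ker_pos (h : IsIsogeny φ) : 0 < Nat.card φ.ker := by
  have := h.finite_ker.to_subtype
  exact Nat.card_pos

lemma IsIsogeny.add (h : IsIsogeny φ) (h' : IsIsogeny ψ) (h0 : φ + ψ ≠ 0) : IsIsogeny (φ + ψ) := by
  obtain ⟨X, H, h1⟩ := h.exists_hasNF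
  obtain ⟨X', H', h2⟩ := h'.exists_hasNF
  by_cases hX : X = X'
  · subst hX
    rcases h1.eq_or_eq_neg h2 with rfl | rfl
    · obtain ⟨K, hK⟩ := HasNF.double (W := W')
      have := hK.isIsogeny.comp h
      convert this using 1
      ext P; simp
    · simp at h0
  · obtain ⟨K, hK⟩ := h1.add h2 hX
    exact hK.isIsogeny

/-- Tripling is not zero: `[2] = -1` would give duplication the leading coefficient 1 instead of
1/4. -/
lemma IsIsogeny.three : IsIsogeny (AddMonoidHom.id W.toAffine.Point + AddMonoidHom.id _ +
    AddMonoidHom.id _) := by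
  obtain ⟨K, hK⟩ := HasNF.double (W := W)
  refine hK.isIsogeny.add .id fun h => ?_
  rw [eq_neg_of_add_eq_zero_left h] at hK
  have h1 := (hK.unique HasNF.id.neg).1
  have h2 := lead_dupRat (W := W)
  rw [h1] at h2
  have h3 := (h2.unique RatFunc.Lead.X).1
  norm_num at h3

/-- An isogeny factors through any isogeny with smaller kernel. -/
lemma IsIsogeny.exists_factor {π : W.toAffine.Point →+ W'.toAffine.Point} (hπ : IsIsogeny π)
    {φ : W.toAffine.Point →+ W''.toAffine.Point} (hφ : IsIsogeny φ) (hle : π.ker ≤ φ.ker) :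
    ∃ β : W'.toAffine.Point →+ W''.toAffine.Point, IsIsogeny β ∧ φ = β.comp π := by
  have : Infinite F := IsAlgClosed.instInfinite
  have hsurj := hπ.surjective
  let β := π.liftOfSurjective hsurj ⟨φ, hle⟩
  have hβ : φ = β.comp π := (AddMonoidHom.liftOfRightInverse_comp π _ _ ⟨φ, hle⟩).symm
  refine ⟨β, ?_, hβ⟩
  obtain ⟨M, N, hM⟩ := hπ.exists_hasNF
  obtain ⟨X, H, hX⟩ := hφ.exists_hasNF
  -- `Q` is a section of `xc`. The functions `x(β(Q t))` and `y(β(Q t)) / y(Q t)` do not see the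
  -- choice of sign; they become rational after composition with `M`, hence are rational themselves.
  choose Q hQ0 hQ using exists_xc_eq (W := W')
  have hQ' : ∀ P : W'.toAffine.Point, P ≠ 0 → Q (xc P) = P ∨ Q (xc P) = -P := fun P hP =>
    WeierstrassCurve.eq_or_eq_neg (hQ0 _) hP (hQ _)
  have hg : ∀ P : W'.toAffine.Point, P ≠ 0 → xc (β (Q (xc P))) = xc (β P) := by
    intro P hP
    rcases hQ' P hP with h | h <;> rw [h]
    rw [map_neg, xc_neg]
  have hh : ∀ P : W'.toAffine.Point, P ≠ 0 → yc (β (Q (xc P))) / yc (Q (xc P)) =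
      yc (β P) / yc P := by
    intro P hP
    rcases hQ' P hP with h | h <;> rw [h]
    rw [map_neg, yc_neg, yc_neg, neg_div_neg_eq]
  have hgr : RatFunc.Rep (fun x => xc (β (Q (M.val x)))) X := by
    refine (eventually_xc_iff (W := W)).mp ?_
    filter_upwards [hM, hX] with P h1 h2
    rw [← h1.2.1, hg _ h1.1, ← h2.2.1, hβ]; rfl
  have hhr : RatFunc.Rep (fun x => yc (β (Q (M.val x))) / yc (Q (M.val x))) (H / N) := by
    have h3 := ((RatFunc.Rep.val H).div (.val N)).xc (W := W)
    refine (eventually_xc_iff (W := W)).mp ?_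
    filter_upwards [hM, hX, h3, eventually_yc_ne_zero] with P h1 h2 h3 h4
    rw [← h1.2.1, hh _ h1.1, ← h3, h1.2.2, ← AddMonoidHom.comp_apply, ← hβ, h2.2.2,
      mul_div_mul_left _ _ h4]
  obtain ⟨S, hS⟩ := RatFunc.exists_rep_of_comp hM.ne_C (g := fun t => xc (β (Q t))) hgr
  obtain ⟨S', hS'⟩ := RatFunc.exists_rep_of_comp hM.ne_C (g := fun t => yc (β (Q t)) / yc (Q t)) hhr
  have hker : (β.ker : Set W'.toAffine.Point).Finite := by
    refine (hφ.finite_ker.image π).subset fun P hP => ?_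
    obtain ⟨R, rfl⟩ := hsurj P
    exact ⟨R, by rw [hβ]; exact hP, rfl⟩
  refine HasNF.isIsogeny (X := S) (H := S') ?_
  filter_upwards [hS.xc, hS'.xc, eventually_ne_zero, eventually_yc_ne_zero,
    (AddMonoidHom.tendsto_cofinite hker).eventually eventually_ne_zero] with P h1 h2 h3 h4 h5
  refine ⟨h5, by rw [← h1, hg P h3], ?_⟩
  rw [← h2, hh P h3]; field_simp

/-- The degree of `φ + n` for `n = ±1`. -/
lemma HasNF.deg_add_le {φ ε : W.toAffine.Point →+ W.toAffine.Point} {s : F} (hs : s ^ 2 = 1)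
    (h : HasNF φ X H) (hε : HasNF ε RatFunc.X (RatFunc.C s)) (hne : X ≠ RatFunc.X) :
    Nat.card (φ + ε).ker ≤ 2 * Nat.card φ.ker + 2 := by
  obtain ⟨H₁, h₁⟩ := h.add hε hne
  obtain ⟨H₂, h₂⟩ := h.add hε.neg hne
  rw [h₁.card_ker, h.card_ker]
  set Z := addRat W W.a₂ X H RatFunc.X (RatFunc.C s) with hZ
  set Z' := addRat W W.a₂ X H RatFunc.X (-RatFunc.C s) with hZ'
  set A := X.num with hA
  set B := X.denom with hB
  -- `α Z² + β Z + γ` has the roots `x(φ + ε)` and `x(φ - ε)`. By symmetry `H` enters the sum and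
  -- product of these roots only through `H² f`, so the coefficients are polynomials of controlled
  -- degree in `x` and the numerator and denominator of `X`.
  let α : F[X] := (A - Polynomial.X * B) ^ 2
  let β : F[X] := -(2 * (Polynomial.X * B + A) * (Polynomial.X * A + C W.a₄ * B) +
    4 * C W.a₂ * Polynomial.X * A * B + 4 * C W.a₆ * B ^ 2)
  let γ : F[X] := (Polynomial.X * A - C W.a₄ * B) ^ 2 -
    4 * C W.a₆ * B * (A + Polynomial.X * B + C W.a₂ * B)
  let ι := algebraMap F[X] (RatFunc F)
  have hB0 : ι B ≠ 0 := RatFunc.algebraMap_ne_zero X.denom_ne_zero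
  have hX : X = ι A / ι B := (RatFunc.num_div_denom X).symm
  have hd : X - RatFunc.X ≠ 0 := sub_ne_zero.mpr hne
  have hAX : ι A = X * ι B := by rw [hX]; field_simp
  have hrel := h.relation
  have hc : algebraMap F[X] (RatFunc F) W.cubic = RatFunc.X ^ 3 + RatFunc.C W.a₂ * RatFunc.X ^ 2 +
      RatFunc.C W.a₄ * RatFunc.X + RatFunc.C W.a₆ := by simp [cubic]
  have hc' : aeval X W.cubic = X ^ 3 + RatFunc.C W.a₂ * X ^ 2 +
      RatFunc.C W.a₄ * X + RatFunc.C W.a₆ := by simp [cubic]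
  rw [hc, hc'] at hrel
  have hs' : RatFunc.C s ^ 2 = 1 := by rw [← map_pow, hs, map_one]
  have h2 : ι 2 = 2 := map_ofNat ι 2
  have h4 : ι 4 = 4 := map_ofNat ι 4
  have hιX : ι Polynomial.X = RatFunc.X := RatFunc.algebraMap_X
  have hιC (c : F) : ι (C c) = RatFunc.C c := RatFunc.algebraMap_C c
  have hα : ι α = (X - RatFunc.X) ^ 2 * ι B ^ 2 := by
    simp only [α, map_pow, map_sub, map_mul, hιX]
    rw [hAX]; ring
  have hα0 : ι α ≠ 0 := by rw [hα]; positivity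
  have hsum : ι β = -(Z + Z') * ι α := by
    rw [hα, hZ, hZ', addRat, addRat, hc]
    simp only [β, map_neg, map_add, map_mul, map_pow, hιX, hιC, h2, h4, hAX]
    field_simp
    linear_combination (-2 : RatFunc F) * hrel + 2 * (RatFunc.X ^ 3 + RatFunc.C W.a₂ * RatFunc.X ^ 2 +
      RatFunc.C W.a₄ * RatFunc.X + RatFunc.C W.a₆) * hs'
  have hprod : ι γ = Z * Z' * ι α := by
    rw [hα, hZ, hZ', addRat, addRat, hc]
    simp only [γ, map_sub, map_add, map_mul, map_pow, hιX, hιC, h4, hAX]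
    set f := RatFunc.X ^ 3 + RatFunc.C W.a₂ * RatFunc.X ^ 2 +
      RatFunc.C W.a₄ * RatFunc.X + RatFunc.C W.a₆ with hf
    set g := X ^ 3 + RatFunc.C W.a₂ * X ^ 2 + RatFunc.C W.a₄ * X + RatFunc.C W.a₆ with hg
    set S := RatFunc.C W.a₂ + X + RatFunc.X with hS
    set t := RatFunc.C s with ht
    have e1 : (f * (H - t) ^ 2) * (f * (H + t) ^ 2) = (g - f) ^ 2 := by
      rw [hrel]; linear_combination f ^ 2 * (t ^ 2 + 1 - 2 * H ^ 2) * hs'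
    have e2 : f * (H - t) ^ 2 + f * (H + t) ^ 2 = 2 * (g + f) := by
      rw [hrel]; linear_combination 2 * f * hs'
    have e3 : (f * ((H - t) / (X - RatFunc.X)) ^ 2 - RatFunc.C W.a₂ - X - RatFunc.X) *
        (f * ((H - -t) / (X - RatFunc.X)) ^ 2 - RatFunc.C W.a₂ - X - RatFunc.X) *
        (X - RatFunc.X) ^ 4 = (f * (H - t) ^ 2) * (f * (H + t) ^ 2) -
        S * (X - RatFunc.X) ^ 2 * (f * (H - t) ^ 2 + f * (H + t) ^ 2) + S ^ 2 * (X - RatFunc.X) ^ 4 := by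
      rw [hS]; field_simp; ring
    rw [e1, e2] at e3
    refine mul_right_cancel₀ (pow_ne_zero 2 hd) ?_
    rw [hf, hg, hS] at e3
    rw [hf]
    linear_combination (-(ι B ^ 2)) * e3
  have hZ0 : Z ≠ 0 := by simpa using h₁.ne_C 0
  have hZ0' : Z' ≠ 0 := by simpa using h₂.ne_C 0
  have hα1 : α ≠ 0 := fun h => hα0 (by rw [h, map_zero])
  have hγ1 : γ ≠ 0 := fun h => by
    rw [h, map_zero] at hprod
    exact mul_ne_zero (mul_ne_zero hZ0 hZ0') hα0 hprod.symm
  have hm0 : ι Z.denom ≠ 0 := RatFunc.algebraMap_ne_zero Z.denom_ne_zero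
  have hn : ι Z.num = Z * ι Z.denom := by
    have : Z = ι Z.num / ι Z.denom := (RatFunc.num_div_denom Z).symm
    exact (div_eq_iff hm0).mp this.symm
  have hquad : α * Z.num ^ 2 + β * Z.num * Z.denom + γ * Z.denom ^ 2 = 0 := by
    refine RatFunc.algebraMap_injective F ?_
    change ι _ = ι 0
    simp only [map_add, map_mul, map_pow, map_zero, hsum, hprod, hn]
    ring
  have hco := RatFunc.isCoprime_num_denom Z
  -- The rational root theorem: the denominator of a root divides the leading coefficient, its
  -- numerator the constant one.
  have hdvd : Z.denom ∣ α := by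
    refine (hco.symm.pow_right (n := 2)).dvd_of_dvd_mul_right ⟨-(β * Z.num + γ * Z.denom), ?_⟩
    linear_combination hquad
  have hdvd' : Z.num ∣ γ := by
    refine (hco.pow_right (n := 2)).dvd_of_dvd_mul_right ⟨-(α * Z.num + β * Z.denom), ?_⟩
    linear_combination hquad
  have hAd : A.natDegree ≤ X.deg := le_max_left _ _
  have hBd : B.natDegree ≤ X.deg := le_max_right _ _
  have hCd (c : F) : (C c).natDegree ≤ 0 := (natDegree_C c).le
  have h4d : (4 : F[X]).natDegree ≤ 0 := (natDegree_ofNat 4).le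
  have hXd : (Polynomial.X : F[X]).natDegree ≤ 1 := natDegree_X_le
  have hαd : α.natDegree ≤ 2 * X.deg + 2 := by
    refine (natDegree_pow_le_of_le 2 (natDegree_sub_le_of_le hAd
      (natDegree_mul_le_of_le hXd hBd))).trans ?_
    omega
  have hγd : γ.natDegree ≤ 2 * X.deg + 2 := by
    refine (natDegree_sub_le_of_le (natDegree_pow_le_of_le 2 (natDegree_sub_le_of_le
      (natDegree_mul_le_of_le hXd hAd) (natDegree_mul_le_of_le (hCd _) hBd)))
      (natDegree_mul_le_of_le (natDegree_mul_le_of_le (natDegree_mul_le_of_le h4d (hCd _)) hBd)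
        (natDegree_add_le_of_le (natDegree_add_le_of_le hAd (natDegree_mul_le_of_le hXd hBd))
          (natDegree_mul_le_of_le (hCd _) hBd)))).trans ?_
    omega
  exact max_le ((natDegree_le_of_dvd hdvd' hγ1).trans hγd) ((natDegree_le_of_dvd hdvd hα1).trans hαd)

/-- If the 3-torsion has 9 elements and each endomorphism acts on it as an integer, then there is no
complex multiplication. -/
theorem nonCM_of_scalar (h9 : Nat.card (AddMonoidHom.id W.toAffine.Point + AddMonoidHom.id _ +
      AddMonoidHom.id W.toAffine.Point).ker = 9)
    (hs : ∀ φ : W.toAffine.Point →+ W.toAffine.Point, IsIsogeny φ →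
      ∃ n : ℤ, ∀ P, P + P + P = 0 → φ P = n • P) : NonCM W := by
  suffices ∀ d : ℕ, ∀ φ : W.toAffine.Point →+ W.toAffine.Point, IsIsogeny φ → Nat.card φ.ker = d →
      ∃ n : ℤ, ∀ P, φ P = n • P from fun φ hφ => this _ φ hφ rfl
  intro d
  -- Descent: one of `φ`, `φ + 1`, `φ - 1` kills the 3-torsion and so equals `β ∘ [3]`. Then `9 deg
  -- β ≤ 2d + 2`, hence `deg β < d`.
  induction d using Nat.strong_induction_on with
  | _ d ih =>
  intro φ hφ hd
  have hdpos : 0 < d := hd ▸ hφ.card_ker_pos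
  obtain ⟨n, hn⟩ := hs φ hφ
  have key : ∀ (ε : W.toAffine.Point →+ W.toAffine.Point) (m : ℤ), (∀ P, ε P = m • P) →
      (3 : ℤ) ∣ n + m → Nat.card (φ + ε).ker ≤ 2 * d + 2 → (φ + ε = 0 ∨ IsIsogeny (φ + ε)) →
      ∃ n : ℤ, ∀ P, φ P = n • P := by
    rintro ε m hε ⟨k, hk⟩ hcard (h0 | hiso)
    · refine ⟨-m, fun P => ?_⟩
      have := DFunLike.congr_fun h0 P
      rw [AddMonoidHom.add_apply, hε, AddMonoidHom.zero_apply] at this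
      rw [neg_smul, ← eq_neg_iff_add_eq_zero.mpr this]
    · obtain ⟨β, hβ, hβ'⟩ := IsIsogeny.three.exists_factor hiso (fun P hP => by
        have hP3 : P + P + P = 0 := hP
        change φ P + ε P = 0
        rw [hn P hP3, hε, ← add_smul, hk, mul_comm, mul_smul]
        have : (3 : ℤ) • P = 0 := by
          rw [← hP3, show (3 : ℤ) = 1 + 1 + 1 by norm_num, add_smul, add_smul, one_smul]
        rw [this, smul_zero])
      have hc := AddMonoidHom.card_ker_comp β _ (IsIsogeny.three (W := W)).surjective
      rw [← hβ', h9] at hc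
      have hpos := hβ.card_ker_pos
      obtain ⟨j, hj⟩ := ih _ (by omega) β hβ rfl
      refine ⟨3 * j - m, fun P => ?_⟩
      have := DFunLike.congr_fun hβ' P
      rw [AddMonoidHom.add_apply, hε, AddMonoidHom.comp_apply, hj] at this
      rw [sub_smul, eq_sub_iff_add_eq, this]
      simp only [AddMonoidHom.add_apply, AddMonoidHom.id_apply]
      module
  obtain ⟨X, H, hX⟩ := hφ.exists_hasNF
  have hid := HasNF.id (W := W)
  have hid' : HasNF (AddMonoidHom.id W.toAffine.Point) RatFunc.X (RatFunc.C 1) := by simpa using hid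
  have hneg : HasNF (-AddMonoidHom.id W.toAffine.Point) RatFunc.X (RatFunc.C (-1)) := by
    simpa using hid.neg
  by_cases hXX : X = RatFunc.X
  · subst hXX
    rcases hX.eq_or_eq_neg hid with rfl | rfl
    · exact ⟨1, fun P => by simp⟩
    · exact ⟨-1, fun P => by simp⟩
  have hor : ∀ {ε}, IsIsogeny ε → (φ + ε = 0 ∨ IsIsogeny (φ + ε)) := fun hε =>
    or_iff_not_imp_left.mpr (hφ.add hε)
  have hmod : (3 : ℤ) ∣ n ∨ (3 : ℤ) ∣ n + 1 ∨ (3 : ℤ) ∣ n + -1 := by omega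
  rcases hmod with h | h | h
  · refine key 0 0 (by simp) (by simpa using h) ?_ (Or.inr (by simpa using hφ))
    rw [add_zero, hd]; omega
  · refine key _ 1 (by simp) h ?_ (hor .id)
    rw [← hd]; exact hX.deg_add_le (by norm_num) hid' hXX
  · refine key _ (-1) (by simp) h ?_ (hor (IsIsogeny.neg .id))
    rw [← hd]; exact hX.deg_add_le (by norm_num) hneg hXX

end WeierstrassCurve

/-! ### Changes of variables as isomorphisms of groups of points -/

/-- A map between infinite groups which is generically additive is additive. -/
lemma AddMonoidHom.exists_of_eventually {A B : Type*} [AddCommGroup A] [Infinite A] [AddCommGroup B]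
    (f : A → B) (h : ∀ P, ∀ᶠ Q in cofinite, f (P + Q) = f P + f Q) :
    ∃ g : A →+ B, ∀ P, g P = f P := by
  refine ⟨AddMonoidHom.mk' f fun P Q => ?_, fun P => rfl⟩
  have h1 := (add_right_injective Q).tendsto_cofinite.eventually (h P)
  -- For generic `R`, expanding `f(P + Q + R)` in two ways and cancelling `f(R)` gives additivity at
  -- `P`, `Q`.
  obtain ⟨R, h1, h2, h3⟩ := (h1.and ((h Q).and (h (P + Q)))).exists
  rw [← add_assoc, h3, h2, ← add_assoc] at h1
  exact add_right_cancel h1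

namespace WeierstrassCurve

variable {F : Type*} [Field F] {W W' W'' : WeierstrassCurve F}

lemma add_coords' [DecidableEq F] {P Q : W.toAffine.Point} (hP : P ≠ 0) (hQ : Q ≠ 0) (hx : xc P ≠ xc Q) :
    P + Q ≠ 0 ∧ xc (P + Q) = ((yc P - yc Q) / (xc P - xc Q)) ^ 2 +
        W.a₁ * ((yc P - yc Q) / (xc P - xc Q)) - W.a₂ - xc P - xc Q ∧
      yc (P + Q) = -((yc P - yc Q) / (xc P - xc Q) * (xc (P + Q) - xc P) + yc P) -
        W.a₁ * xc (P + Q) - W.a₃ := by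
  obtain ⟨h, hP'⟩ := exists_eq_some hP
  obtain ⟨h', hQ'⟩ := exists_eq_some hQ
  rw [hP', hQ', Affine.Point.add_of_X_ne hx]
  simp only [xc_some, yc_some, Affine.addX, Affine.addY, Affine.negAddY, Affine.negY,
    Affine.slope_of_X_ne hx]
  exact ⟨Affine.Point.some_ne_zero _, trivial, trivial⟩

lemma eventually_xc_ne [IsAlgClosed F] (c : F) :
    ∀ᶠ P : W.toAffine.Point in cofinite, xc P ≠ c :=
  tendsto_xc.eventually (p := fun x => x ≠ c) (by simp [eventually_cofinite])

section VariableChange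

variable [IsAlgClosed F] [DecidableEq F] [W.IsElliptic] [W'.IsElliptic]

/-- The substitution carries lines to lines, a slope `L` becoming `(L - s) / u`. It suffices to
check the chord formula for generic pairs. -/
lemma exists_variableChange_hom (v : VariableChange F) (h : v • W = W') :
    ∃ ι : W.toAffine.Point →+ W'.toAffine.Point, ∀ P, P ≠ 0 → ι P ≠ 0 ∧
      xc (ι P) = (xc P - v.r) / v.u ^ 2 ∧ yc (ι P) = (yc P - v.s * (xc P - v.r) - v.t) / v.u ^ 3 := by
  subst h
  have hu : (v.u : F) ≠ 0 := v.u.ne_zero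
  have hns : ∀ P : W.toAffine.Point, P ≠ 0 → (v • W).toAffine.Nonsingular ((xc P - v.r) / v.u ^ 2)
      ((yc P - v.s * (xc P - v.r) - v.t) / v.u ^ 3) := by
    intro P hP
    obtain ⟨h, -⟩ := exists_eq_some hP
    rw [← Affine.equation_iff_nonsingular]
    have h1 := (Affine.equation_iff ..).mp h.1
    rw [Affine.equation_iff]
    simp only [variableChange_a₁, variableChange_a₂, variableChange_a₃, variableChange_a₄,
      variableChange_a₆, Units.val_inv_eq_inv_val]
    field_simp
    linear_combination h1
  classical
  let f : W.toAffine.Point → (v • W).toAffine.Point := fun P =>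
    if h : P = 0 then 0 else .some _ _ (hns P h)
  have hf0 : f 0 = 0 := dif_pos rfl
  have hf : ∀ P, P ≠ 0 → f P ≠ 0 ∧ xc (f P) = (xc P - v.r) / v.u ^ 2 ∧
      yc (f P) = (yc P - v.s * (xc P - v.r) - v.t) / v.u ^ 3 := by
    intro P hP
    have : f P = .some _ _ (hns P hP) := dif_neg hP
    rw [this]
    exact ⟨by rintro ⟨⟩, rfl, rfl⟩
  obtain ⟨g, hg⟩ := AddMonoidHom.exists_of_eventually f (fun P => by
    by_cases hP : P = 0
    · subst hP; simp [hf0]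
    filter_upwards [eventually_ne_zero, eventually_xc_ne (xc P)] with Q hQ hx
    obtain ⟨p1, p2, p3⟩ := hf P hP
    obtain ⟨q1, q2, q3⟩ := hf Q hQ
    obtain ⟨a1, a2, a3⟩ := add_coords' hP hQ hx.symm
    obtain ⟨r1, r2, r3⟩ := hf _ a1
    have hd : xc P - xc Q ≠ 0 := sub_ne_zero.mpr hx.symm
    have hx' : xc (f P) ≠ xc (f Q) := by
      rw [p2, q2, ← sub_ne_zero, ← sub_div]
      refine div_ne_zero ?_ (pow_ne_zero 2 hu)
      convert hd using 1; ring
    obtain ⟨b1, b2, b3⟩ := add_coords' p1 q1 hx'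
    have hsl : (yc (f P) - yc (f Q)) / (xc (f P) - xc (f Q)) =
        ((yc P - yc Q) / (xc P - xc Q) - v.s) / v.u := by
      have : xc (f P) - xc (f Q) = (xc P - xc Q) / v.u ^ 2 := by rw [p2, q2]; ring
      rw [this, p3, q3]
      field_simp
      ring
    have hxx : xc (f (P + Q)) = xc (f P + f Q) := by
      rw [r2, b2, a2, hsl, p2, q2]
      simp only [variableChange_a₁, variableChange_a₂, Units.val_inv_eq_inv_val]
      generalize (yc P - yc Q) / (xc P - xc Q) = L
      field_simp
      ring
    refine point_ext r1 b1 hxx ?_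
    rw [r3, b3, ← hxx, r2, a3, a2, hsl, p2, p3]
    simp only [variableChange_a₁, variableChange_a₃, Units.val_inv_eq_inv_val]
    generalize (yc P - yc Q) / (xc P - xc Q) = L
    field_simp
    ring)
  exact ⟨g, fun P hP => by rw [hg]; exact hf P hP⟩

/-- Isomorphic curves have isomorphic groups of points, by isogenies. -/
theorem exists_variableChange_equiv (v : VariableChange F) (h : v • W = W') :
    ∃ ι : W.toAffine.Point ≃+ W'.toAffine.Point, IsIsogeny ι.toAddMonoidHom ∧
      IsIsogeny ι.symm.toAddMonoidHom ∧ ∀ P, P ≠ 0 → xc (ι P) = (xc P - v.r) / v.u ^ 2 ∧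
        yc (ι P) = (yc P - v.s * (xc P - v.r) - v.t) / v.u ^ 3 := by
  have hu : (v.u : F) ≠ 0 := v.u.ne_zero
  have hiso : ∀ {W W' : WeierstrassCurve F} (v : VariableChange F) (ι : W.toAffine.Point →+ W'.toAffine.Point), (∀ P, P ≠ 0 → ι P ≠ 0 ∧
      xc (ι P) = (xc P - v.r) / v.u ^ 2 ∧ yc (ι P) = (yc P - v.s * (xc P - v.r) - v.t) / v.u ^ 3) →
      IsIsogeny ι := by
    intro W W' v ι hι
    rw [isIsogeny_iff]
    refine ⟨eventually_ne_zero.mono fun P hP => (hι P hP).1, ?_, ?_⟩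
    · refine ((RatPt.x.add (.const (-v.r))).mul (.const ((v.u : F) ^ 2)⁻¹)).congr ?_
      filter_upwards [eventually_ne_zero] with P hP
      rw [(hι P hP).2.1]; ring
    · refine ((RatPt.y.add (((RatPt.x.add (.const (-v.r))).mul (.const (-v.s))).add
        (.const (-v.t)))).mul (.const ((v.u : F) ^ 3)⁻¹)).congr ?_
      filter_upwards [eventually_ne_zero] with P hP
      rw [(hι P hP).2.2]; ring
  obtain ⟨ι, hι⟩ := exists_variableChange_hom v h
  obtain ⟨κ, hκ⟩ := exists_variableChange_hom v⁻¹ (show v⁻¹ • W' = W by rw [← h, inv_smul_smul])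
  refine ⟨AddMonoidHom.toAddEquiv ι κ ?_ ?_, hiso _ _ hι, hiso _ _ hκ, fun P hP => (hι P hP).2⟩
  · ext P
    by_cases hP : P = 0
    · simp [hP]
    obtain ⟨h1, h2, h3⟩ := hι P hP
    obtain ⟨k1, k2, k3⟩ := hκ _ h1
    refine point_ext k1 hP ?_ ?_
    · change xc (κ (ι P)) = xc P
      rw [k2, h2, VariableChange.inv_def]
      simp
      field_simp
      ring
    · change yc (κ (ι P)) = yc P
      rw [k3, h3, h2, VariableChange.inv_def]
      simp
      field_simp
      ring
  · ext P
    by_cases hP : P = 0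
    · simp [hP]
    obtain ⟨k1, k2, k3⟩ := hκ P hP
    obtain ⟨h1, h2, h3⟩ := hι _ k1
    refine point_ext h1 hP ?_ ?_
    · change xc (ι (κ P)) = xc P
      rw [h2, k2, VariableChange.inv_def]
      simp
      field_simp
      ring
    · change yc (ι (κ P)) = yc P
      rw [h3, k3, k2, VariableChange.inv_def]
      simp
      field_simp
      ring

end VariableChange

end WeierstrassCurve

/-! ### The curves y² = x³ + ax² + bx and the quotient by (0,0) -/

namespace WeierstrassCurve

variable {F : Type*} [Field F]

/-- The curve `y² = x³ + a x² + b x`, with the point `(0, 0)` of order two. -/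
def twoCurve (a b : F) : WeierstrassCurve F := ⟨0, a, 0, b, 0⟩

instance (a b : F) : (twoCurve a b).IsCharNeTwoNF := ⟨rfl, rfl⟩

lemma twoCurve_Δ (a b : F) : (twoCurve a b).Δ = 16 * b ^ 2 * (a ^ 2 - 4 * b) := by
  simp [twoCurve, Δ, b₂, b₄, b₆, b₈]; ring

lemma twoCurve_c₄ (a b : F) : (twoCurve a b).c₄ = 16 * (a ^ 2 - 3 * b) := by
  simp [twoCurve, c₄, b₂, b₄]; ring

lemma twoCurve_c₆ (a b : F) : (twoCurve a b).c₆ = 32 * a * (9 * b - 2 * a ^ 2) := by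
  simp [twoCurve, c₆, b₂, b₄, b₆]; ring

lemma isElliptic_twoCurve [CharZero F] {a b : F} (hb : b ≠ 0) (h : a ^ 2 - 4 * b ≠ 0) :
    (twoCurve a b).IsElliptic := by
  rw [isElliptic_iff, twoCurve_Δ, isUnit_iff_ne_zero]
  exact mul_ne_zero (mul_ne_zero (by norm_num) (pow_ne_zero 2 hb)) h

lemma b_ne_zero_of_twoCurve {a b : F} [h : (twoCurve a b).IsElliptic] :
    b ≠ 0 ∧ a ^ 2 - 4 * b ≠ 0 := by
  have := h.isUnit.ne_zero
  rw [twoCurve_Δ] at this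
  constructor <;> intro h <;> simp [h] at this

/-- The point `(0, 0)`. -/
def twoPoint (a b : F) [(twoCurve a b).IsElliptic] : (twoCurve a b).toAffine.Point :=
  .some 0 0 (Affine.equation_iff_nonsingular.mp (by simp [Affine.equation_iff, twoCurve]))

section

variable {a b : F} [(twoCurve a b).IsElliptic]

lemma twoPoint_ne_zero : twoPoint a b ≠ 0 := by rintro ⟨⟩

lemma eq_twoPoint [CharZero F] {P : (twoCurve a b).toAffine.Point} (h0 : P ≠ 0) (hx : xc P = 0) :
    P = twoPoint a b := by
  refine point_ext h0 twoPoint_ne_zero hx ?_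
  have := yc_sq h0
  rw [hx] at this
  have : yc P = 0 := by simpa [twoCurve] using this
  rw [this]; rfl

variable [DecidableEq F]

lemma twoPoint_add_self [CharZero F] : twoPoint a b + twoPoint a b = 0 := by
  rw [← eq_neg_iff_add_eq_zero]
  refine point_ext twoPoint_ne_zero (neg_ne_zero.mpr twoPoint_ne_zero) (xc_neg _).symm ?_
  rw [yc_neg]; simp [twoPoint]

end

variable [IsAlgClosed F] [CharZero F] [DecidableEq F]

omit [IsAlgClosed F] [CharZero F] [DecidableEq F] in
-- Coordinates adapted to the line `y = L x + n` through `P`, `Q`, `-(P + Q)`: Vieta expresses `a`,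
-- `b` and the third abscissa by `L`, `n`, `x₁`, `x₂`. The chord through the images of `P` and `Q`
-- has slope `b / n - L`.
lemma twoIsogeny_add_formula {x₁ x₂ x₃ L n a b : F} (h₁ : x₁ ≠ 0) (h₂ : x₂ ≠ 0) (hn : n ≠ 0)
    (h₃ : x₃ = n ^ 2 / (x₁ * x₂)) (ha : a = L ^ 2 - x₁ - x₂ - x₃)
    (hb : b = 2 * L * n + x₁ * x₂ + (x₁ + x₂) * x₃) :
    (L * x₁ + n) * ((b - x₁ ^ 2) / x₁ ^ 2) - (L * x₂ + n) * ((b - x₂ ^ 2) / x₂ ^ 2) =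
      (b / n - L) * (((L * x₁ + n) / x₁) ^ 2 - ((L * x₂ + n) / x₂) ^ 2) ∧
    (-(L * x₃ + n) / x₃) ^ 2 = (b / n - L) ^ 2 + 2 * a - ((L * x₁ + n) / x₁) ^ 2 -
      ((L * x₂ + n) / x₂) ^ 2 ∧
    -(L * x₃ + n) * ((b - x₃ ^ 2) / x₃ ^ 2) = -((b / n - L) * ((-(L * x₃ + n) / x₃) ^ 2 -
      ((L * x₁ + n) / x₁) ^ 2) + (L * x₁ + n) * ((b - x₁ ^ 2) / x₁ ^ 2)) := by
  subst hb ha h₃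
  refine ⟨?_, ?_, ?_⟩ <;> field_simp <;> ring

/-- The classical quotient map. The formula breaks down at `T = (0, 0)`, which is sent to 0;
additivity there means invariance under translation by `T` and is checked separately. Elsewhere
generic additivity is `twoIsogeny_add_formula`. -/
theorem exists_twoIsogeny (a b : F) [(twoCurve a b).IsElliptic]
    [(twoCurve (-2 * a) (a ^ 2 - 4 * b)).IsElliptic] :
    ∃ π : (twoCurve a b).toAffine.Point →+ (twoCurve (-2 * a) (a ^ 2 - 4 * b)).toAffine.Point,
      IsIsogeny π ∧ π (twoPoint a b) = 0 ∧ ∀ P, P ≠ 0 → P ≠ twoPoint a b → π P ≠ 0 ∧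
        xc (π P) = (yc P / xc P) ^ 2 ∧ yc (π P) = yc P * ((b - xc P ^ 2) / xc P ^ 2) := by
  set W := twoCurve a b with hW
  set W' := twoCurve (-2 * a) (a ^ 2 - 4 * b) with hW'
  have heq : ∀ P : W.toAffine.Point, P ≠ 0 → yc P ^ 2 = xc P ^ 3 + a * xc P ^ 2 + b * xc P := by
    intro P hP
    have := yc_sq hP
    rw [this]; simp [hW, twoCurve]
  have hns : ∀ P : W.toAffine.Point, (P ≠ 0 ∧ xc P ≠ 0) → W'.toAffine.Nonsingular
      ((yc P / xc P) ^ 2) (yc P * ((b - xc P ^ 2) / xc P ^ 2)) := by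
    rintro P ⟨hP, hx⟩
    have h1 := heq P hP
    rw [← Affine.equation_iff_nonsingular, Affine.equation_iff]
    simp only [hW', twoCurve]
    field_simp
    have h2 : b = (yc P ^ 2 - xc P ^ 3 - a * xc P ^ 2) / xc P := by
      field_simp; linear_combination -h1
    rw [h2]
    field_simp
    ring
  classical
  let f : W.toAffine.Point → W'.toAffine.Point := fun P =>
    if h : P ≠ 0 ∧ xc P ≠ 0 then .some _ _ (hns P h) else 0
  have hf0 : f 0 = 0 := dif_neg (by simp)
  have hfT : f (twoPoint a b) = 0 := dif_neg (by simp [twoPoint])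
  have hf : ∀ P, P ≠ 0 → xc P ≠ 0 → f P ≠ 0 ∧ xc (f P) = (yc P / xc P) ^ 2 ∧
      yc (f P) = yc P * ((b - xc P ^ 2) / xc P ^ 2) := by
    intro P hP hx
    have : f P = .some _ _ (hns P ⟨hP, hx⟩) := dif_pos ⟨hP, hx⟩
    rw [this]
    exact ⟨by rintro ⟨⟩, rfl, rfl⟩
  have hTadd : ∀ Q : W.toAffine.Point, Q ≠ 0 → xc Q ≠ 0 →
      f (twoPoint a b + Q) = f Q := by
    intro Q hQ hx
    obtain ⟨a1, a2, a3⟩ := add_coords (W := W) (P := twoPoint a b) twoPoint_ne_zero hQ (Ne.symm hx)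
    have hb : b ≠ 0 := (b_ne_zero_of_twoCurve (a := a)).1
    have h1 := heq Q hQ
    have e2 : xc (twoPoint a b + Q) = b / xc Q := by
      rw [a2, show xc (twoPoint a b) = 0 from rfl, show yc (twoPoint a b) = 0 from rfl,
        show W.a₂ = a from rfl]
      field_simp; linear_combination xc Q * h1
    have e3 : yc (twoPoint a b + Q) = - b * yc Q / xc Q ^ 2 := by
      rw [a3, e2, show xc (twoPoint a b) = 0 from rfl, show yc (twoPoint a b) = 0 from rfl]
      field_simp; ring
    have hx' : xc (twoPoint a b + Q) ≠ 0 := by rw [e2]; positivity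
    obtain ⟨r1, r2, r3⟩ := hf _ a1 hx'
    obtain ⟨q1, q2, q3⟩ := hf _ hQ hx
    refine point_ext r1 q1 ?_ ?_
    · rw [r2, q2, e3, e2]; field_simp
    · rw [r3, q3, e3, e2]; field_simp; ring
  let X : RatFunc F := algebraMap F[X] _ (Polynomial.X ^ 2 + C a * Polynomial.X + C b) / RatFunc.X
  have hXl : X.Lead 1 1 := by
    have hm : (Polynomial.X ^ 2 + C a * Polynomial.X + C b).natDegree = 2 := by compute_degree!
    have hm' : (Polynomial.X ^ 2 + C a * Polynomial.X + C b).Monic := by monicity!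
    have := (RatFunc.Lead.poly hm'.ne_zero).div RatFunc.Lead.X
    rw [hm, hm'.leadingCoeff] at this
    norm_num at this
    have hXe : X = (RatFunc.X ^ 2 + RatFunc.C a * RatFunc.X + RatFunc.C b) / RatFunc.X := by
      change algebraMap F[X] _ _ / _ = _
      simp
    rwa [hXe]
  have hXC : ∀ c, X ≠ RatFunc.C c := by
    intro c hc
    have h := hXl.vInf
    rw [hc] at h
    have := RatFunc.vInf_C_le c
    rw [h, ← WithZero.exp_zero, WithZero.exp_le_exp] at this
    omega
  have hXrep : ∀ᶠ P : W.toAffine.Point in cofinite, (yc P / xc P) ^ 2 = X.val (xc P) := by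
    have h1 := ((RatFunc.Rep.poly (Polynomial.X ^ 2 + C a * Polynomial.X + C b)).div
      (RatFunc.Rep.id (F := F))).xc (W := W)
    filter_upwards [h1, eventually_ne_zero, eventually_xc_ne 0] with P h1 h2 h3
    rw [← h1, div_pow, heq P h2]
    simp
    field_simp
  obtain ⟨g, hg⟩ := AddMonoidHom.exists_of_eventually f (fun P => by
    by_cases hP : P = 0
    · subst hP; simp [hf0]
    by_cases hPx : xc P = 0
    · rw [eq_twoPoint hP hPx, hfT]
      filter_upwards [eventually_ne_zero, eventually_xc_ne 0] with Q hQ hx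
      rw [hTadd Q hQ hx, zero_add]
    have hgen : ∀ᶠ Q : W.toAffine.Point in cofinite, (yc Q / xc Q) ^ 2 ≠ (yc P / xc P) ^ 2 := by
      have h2 := (tendsto_xc (W := W)).eventually ((RatFunc.tendsto_val hXC).eventually
        (p := fun x => x ≠ (yc P / xc P) ^ 2) (by simp [eventually_cofinite]))
      filter_upwards [hXrep, h2] with Q h1 h2
      rwa [h1]
    filter_upwards [eventually_ne_zero, eventually_xc_ne (xc P), eventually_xc_ne 0, hgen,
      (add_right_injective P).tendsto_cofinite.eventually (eventually_xc_ne 0)]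
      with Q hQ hx hx0 hgen hxpq
    obtain ⟨p1, p2, p3⟩ := hf P hP hPx
    obtain ⟨q1, q2, q3⟩ := hf Q hQ hx0
    obtain ⟨a1, a2, a3⟩ := add_coords hP hQ hx.symm
    obtain ⟨r1, r2, r3⟩ := hf _ a1 hxpq
    have hd : xc P - xc Q ≠ 0 := sub_ne_zero.mpr hx.symm
    have hx' : xc (f P) ≠ xc (f Q) := by rw [p2, q2]; exact hgen.symm
    have hd' : (yc P / xc P) ^ 2 - (yc Q / xc Q) ^ 2 ≠ 0 := sub_ne_zero.mpr hgen.symm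
    obtain ⟨b1, b2, b3⟩ := add_coords p1 q1 hx'
    have h1 := heq P hP
    have h2 := heq Q hQ
    have hWa : W.a₂ = a := rfl
    have hWa' : W'.a₂ = -2 * a := rfl
    set L := (yc P - yc Q) / (xc P - xc Q) with hL
    set n := yc P - L * xc P with hn
    have hy1 : yc P = L * xc P + n := by rw [hn]; ring
    have hy2 : yc Q = L * xc Q + n := by
      rw [hn, hL]; field_simp; ring
    have ha : a = L ^ 2 - xc P - xc Q - xc (P + Q) := by rw [a2, hWa]; ring
    have hb : b = 2 * L * n + xc P * xc Q + (xc P + xc Q) * xc (P + Q) := by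
      refine mul_left_cancel₀ hd ?_
      rw [hy1, ha] at h1
      rw [hy2, ha] at h2
      linear_combination h2 - h1
    have h3 : n ^ 2 = xc P * xc Q * xc (P + Q) := by
      rw [hy1, ha, hb] at h1
      linear_combination h1
    have hn0 : n ≠ 0 := by
      intro h
      rw [h] at h3
      exact mul_ne_zero (mul_ne_zero hPx hx0) hxpq (by rw [← h3]; ring)
    have hy3 : yc (P + Q) = -(L * xc (P + Q) + n) := by rw [a3, hn]; ring
    obtain ⟨f1, f2, f3⟩ := twoIsogeny_add_formula hPx hx0 hn0
      (by rw [h3]; field_simp) ha hb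
    rw [← hy1] at f1 f2 f3
    rw [← hy2] at f1 f2
    rw [← hy3] at f2 f3
    have hsl : (yc (f P) - yc (f Q)) / (xc (f P) - xc (f Q)) = b / n - L := by
      rw [p2, p3, q2, q3, f1, mul_div_assoc, div_self hd', mul_one]
    have hxx : xc (f (P + Q)) = xc (f P + f Q) := by
      rw [b2, hsl, r2, f2, p2, q2, hWa']; ring
    refine point_ext r1 b1 hxx ?_
    rw [r3, f3, b3, ← hxx, hsl, r2, p2, p3])
  have hg' : ∀ P : W.toAffine.Point, P ≠ 0 → P ≠ twoPoint a b → g P ≠ 0 ∧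
        xc (g P) = (yc P / xc P) ^ 2 ∧ yc (g P) = yc P * ((b - xc P ^ 2) / xc P ^ 2) := by
    intro P h0 hT
    rw [hg]
    exact hf P h0 fun hx => hT (eq_twoPoint h0 hx)
  refine ⟨g, HasNF.isIsogeny (X := X) (H := algebraMap F[X] _ (C b - Polynomial.X ^ 2) / RatFunc.X ^ 2)
    ?_, by rw [hg, hfT], hg'⟩
  have h1 := ((RatFunc.Rep.poly (C b - Polynomial.X ^ 2)).div
      ((RatFunc.Rep.id (F := F)).pow 2)).xc (W := W)
  filter_upwards [eventually_ne_zero, eventually_xc_ne 0, hXrep, h1] with P h0 hx h2 h3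
  obtain ⟨g1, g2, g3⟩ := hg' P h0 (by rintro rfl; exact hx rfl)
  refine ⟨g1, by rw [g2, h2], ?_⟩
  rw [g3, ← h3]
  simp

/-- An isogeny of degree one is an isomorphism. -/
theorem IsIsogeny.exists_variableChange {W W' : WeierstrassCurve F} [W.IsElliptic] [W'.IsElliptic]
    [W.IsCharNeTwoNF] [W'.IsCharNeTwoNF] {φ : W.toAffine.Point →+ W'.toAffine.Point}
    (h : IsIsogeny φ) (h1 : Nat.card φ.ker = 1) : ∃ v : VariableChange F, v • W' = W := by
  obtain ⟨X, H, hX⟩ := h.exists_hasNF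
  rw [hX.card_ker] at h1
  obtain ⟨κ, l, hκ, hl⟩ := hX.lead
  have hrel := hX.relation
  -- `X` has degree one and a pole at infinity, so it is a linear polynomial.
  obtain ⟨μ, hXe⟩ : ∃ μ, X = RatFunc.C κ * RatFunc.X + RatFunc.C μ := by
    have e := (hκ.unique (RatFunc.lead_of_ne_zero hκ.ne_zero)).2
    have hn : X.num.natDegree ≤ 1 := h1 ▸ le_max_left _ _
    have hd0 : X.denom.natDegree = 0 := by omega
    have hd : X.denom = 1 := (RatFunc.monic_denom X).natDegree_eq_zero.mp hd0
    have hk : X.num.leadingCoeff = κ := by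
      rw [(hκ.unique (RatFunc.lead_of_ne_zero hκ.ne_zero)).1, hd]; simp
    have hn1 : X.num.natDegree = 1 := by omega
    refine ⟨X.num.coeff 0, ?_⟩
    rw [← RatFunc.num_div_denom X, hd]
    conv_lhs => rw [eq_X_add_C_of_natDegree_le_one hn]
    rw [leadingCoeff, hn1] at hk
    simp [hk]
  -- `H² f` is a polynomial and `f` is squarefree, so `H` has no denominator; its order at infinity
  -- is 0.
  have hH : H = RatFunc.C l := by
    set ι := algebraMap F[X] (RatFunc F)
    have hx : X = ι (C κ * Polynomial.X + C μ) := by simp [hXe, ι]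
    have hm0 : ι H.denom ≠ 0 := RatFunc.algebraMap_ne_zero H.denom_ne_zero
    have hn : ι H.num = H * ι H.denom := by
      have : H = ι H.num / ι H.denom := (RatFunc.num_div_denom H).symm
      exact (div_eq_iff hm0).mp this.symm
    have hpoly : (W'.cubic.comp (C κ * Polynomial.X + C μ)) * H.denom ^ 2 = H.num ^ 2 * W.cubic := by
      refine RatFunc.algebraMap_injective F ?_
      change ι _ = ι _
      have h2 : ι (W'.cubic.comp (C κ * Polynomial.X + C μ)) = aeval X W'.cubic := by
        rw [hx, comp_eq_aeval]
        exact (aeval_algebraMap_apply (RatFunc F) (C κ * Polynomial.X + C μ) W'.cubic).symm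
      rw [map_mul, map_mul, map_pow, map_pow, hn, h2, hrel]
      ring
    have hco := (RatFunc.isCoprime_num_denom H)
    have hdvd : H.denom ^ 2 ∣ W.cubic :=
      (hco.symm.pow (m := 2) (n := 2)).dvd_of_dvd_mul_left ⟨_, by rw [← hpoly]; ring⟩
    have hd0 : H.denom.natDegree = 0 := by
      by_contra hne
      obtain ⟨r, hr⟩ := IsAlgClosed.exists_root H.denom
        (fun h => hne (natDegree_eq_zero_iff_degree_le_zero.mpr h.le))
      obtain ⟨q, hq⟩ := hdvd
      have hr' : H.denom.eval r = 0 := hr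
      refine cubic_separable (W := W) (x := r) ?_ ?_
      · rw [hq]; simp [hr']
      · rw [hq]; simp [derivative_pow, hr']
    have hd : H.denom = 1 := (RatFunc.monic_denom H).natDegree_eq_zero.mp hd0
    have e := hl.unique (RatFunc.lead_of_ne_zero hl.ne_zero)
    have hn0 : H.num.natDegree = 0 := by omega
    have hk : H.num.leadingCoeff = l := by rw [e.1, hd]; simp
    rw [← RatFunc.num_div_denom H, hd, eq_C_of_natDegree_eq_zero hn0]
    rw [leadingCoeff, hn0] at hk
    simp [hk]
  have hκ0 := hκ.1
  have hl0 := hl.1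
  have hev : ∀ x, W'.cubic.eval (κ * x + μ) = l ^ 2 * W.cubic.eval x := by
    have h2 : W'.cubic.comp (C κ * Polynomial.X + C μ) = C (l ^ 2) * W.cubic := by
      refine RatFunc.algebraMap_injective F ?_
      have h2 : algebraMap F[X] (RatFunc F) (W'.cubic.comp (C κ * Polynomial.X + C μ)) =
          aeval X W'.cubic := by
        rw [hXe, comp_eq_aeval, ← aeval_algebraMap_apply]
        simp
      rw [h2, hrel, hH]
      simp
    intro x
    have := congrArg (eval x) h2
    simpa using this
  simp only [eval_cubic] at hev
  have e0 := hev 0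
  have e1 := hev 1
  have e2 := hev (-1)
  have e3 := hev 2
  -- The coefficients are recovered by finite differences of the values at -1, 0, 1, 2.
  have k3 : κ ^ 3 = l ^ 2 := by linear_combination (e3 - 3 * e1 + 3 * e0 - e2) / 6
  have k2 : κ ^ 2 * (3 * μ + W'.a₂) = κ ^ 3 * W.a₂ := by
    rw [k3]; linear_combination (e1 + e2 - 2 * e0) / 2
  have k1 : κ * (3 * μ ^ 2 + 2 * W'.a₂ * μ + W'.a₄) = κ ^ 3 * W.a₄ := by
    rw [k3]; linear_combination (e1 - e2) / 2 - k3
  have k0 : μ ^ 3 + W'.a₂ * μ ^ 2 + W'.a₄ * μ + W'.a₆ = κ ^ 3 * W.a₆ := by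
    rw [k3]; linear_combination e0
  have hu2 : (l / κ) ^ 2 = κ := by
    rw [div_pow, ← k3]; field_simp
  refine ⟨⟨Units.mk0 (l / κ) (div_ne_zero hl0 hκ0), μ, 0, 0⟩, ?_⟩
  have hi2 : (l / κ)⁻¹ ^ 2 = κ⁻¹ := by rw [inv_pow, hu2]
  have hi4 : (l / κ)⁻¹ ^ 4 = (κ ^ 2)⁻¹ := by
    rw [show 4 = 2 * 2 from rfl, pow_mul, hi2, inv_pow]
  have hi6 : (l / κ)⁻¹ ^ 6 = (κ ^ 3)⁻¹ := by
    rw [show 6 = 2 * 3 from rfl, pow_mul, hi2, inv_pow]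
  ext
  · simp [variableChange_a₁]
  · simp only [variableChange_a₂, Units.val_inv_eq_inv_val, Units.val_mk0, hi2]
    field_simp
    refine mul_left_cancel₀ (pow_ne_zero 2 hκ0) ?_
    linear_combination k2
  · simp [variableChange_a₃]
  · simp only [variableChange_a₄, Units.val_inv_eq_inv_val, Units.val_mk0, hi4]
    field_simp
    refine mul_left_cancel₀ hκ0 ?_
    linear_combination k1
  · simp only [variableChange_a₆, Units.val_inv_eq_inv_val, Units.val_mk0, hi6]
    field_simp
    linear_combination k0

end WeierstrassCurve

/-! ### The parameter r of a curve with a point of order two -/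

namespace WeierstrassCurve

variable {F : Type*} [Field F] [IsAlgClosed F] [CharZero F] [DecidableEq F]

omit [IsAlgClosed F] [CharZero F] [DecidableEq F] in
lemma j_eq_of_smul_eq {W W' : WeierstrassCurve F} [W.IsElliptic] [W'.IsElliptic]
    {v : VariableChange F} (h : v • W = W') : W'.j = W.j := by
  subst h
  exact variableChange_j W v

lemma nonCM_of_equiv {W W' : WeierstrassCurve F} (ι : W.toAffine.Point ≃+ W'.toAffine.Point)
    (h1 : IsIsogeny ι.toAddMonoidHom) (h2 : IsIsogeny ι.symm.toAddMonoidHom) (h : NonCM W) :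
    NonCM W' := by
  intro φ hφ
  obtain ⟨n, hn⟩ := h _ (h2.comp (hφ.comp h1))
  refine ⟨n, fun P => ι.symm.injective ?_⟩
  have := hn (ι.symm P)
  simpa using this

/-- Move `T` to the origin and scale the coefficient of `x²` to 1. This is possible since a zero
coefficient would give `j = 1728`. -/
lemma exists_equiv_twoCurve {W : WeierstrassCurve F} [W.IsElliptic] (hj : W.j ≠ 1728)
    {T : W.toAffine.Point} (hT : T ≠ 0) (hT2 : T + T = 0) :
    ∃ (r : F) (_ : (twoCurve 1 r).IsElliptic), (twoCurve 1 r).j = W.j ∧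
      ∃ ι : W.toAffine.Point ≃+ (twoCurve 1 r).toAffine.Point, IsIsogeny ι.toAddMonoidHom ∧
        IsIsogeny ι.symm.toAddMonoidHom ∧ ι T = twoPoint 1 r := by
  have : Invertible (2 : F) := invertibleOfNonzero two_ne_zero
  obtain ⟨v₁, hv₁⟩ := W.exists_variableChange_isCharNeTwoNF
  set W₁ := v₁ • W with hW₁
  obtain ⟨ι₁, i₁, i₁', -⟩ := exists_variableChange_equiv v₁ hW₁.symm
  have hT₁ : ι₁ T ≠ 0 := by simpa using hT
  set e := xc (ι₁ T) with he
  have hy : yc (ι₁ T) = 0 := by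
    have h : ι₁ T = - ι₁ T := by rw [eq_neg_iff_add_eq_zero, ← map_add, hT2, map_zero]
    have := congrArg yc h
    rw [yc_neg, eq_neg_iff_add_eq_zero, ← two_mul] at this
    simpa using this
  have heq := yc_sq hT₁
  rw [hy, ← he, eval_cubic] at heq
  set a := W₁.a₂ + 3 * e with ha
  set b := W₁.a₄ + 2 * e * W₁.a₂ + 3 * e ^ 2 with hb
  have hv₂ : (⟨1, e, 0, 0⟩ : VariableChange F) • W₁ = twoCurve a b := by
    ext
    · simp [variableChange_a₁, twoCurve]
    · simp [variableChange_a₂, twoCurve, ha]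
    · simp [variableChange_a₃, twoCurve]
    · simp [variableChange_a₄, twoCurve, hb]
    · simp [variableChange_a₆, twoCurve]; linear_combination -heq
  have hell : (twoCurve a b).IsElliptic := hv₂ ▸ inferInstance
  obtain ⟨ι₂, i₂, i₂', h₂⟩ := exists_variableChange_equiv _ hv₂
  have hT₂ : ι₂ (ι₁ T) = twoPoint a b := by
    refine eq_twoPoint (by simpa using hT) ?_
    rw [(h₂ _ hT₁).1]; simp [he]
  have hjab : (twoCurve a b).j = W.j := (j_eq_of_smul_eq hv₂).trans (j_eq_of_smul_eq rfl)
  have ha0 : a ≠ 0 := by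
    intro h0
    apply hj
    rw [← hjab, j, Units.inv_mul_eq_iff_eq_mul, coe_Δ', mul_comm, twoCurve_c₄, twoCurve_Δ, h0]
    ring
  obtain ⟨u, hu⟩ := IsAlgClosed.exists_pow_nat_eq a (n := 2) two_pos
  have hu0 : u ≠ 0 := by rintro rfl; apply ha0; rw [← hu]; ring
  have hv₃ : (⟨Units.mk0 u hu0, 0, 0, 0⟩ : VariableChange F) • twoCurve a b =
      twoCurve 1 (b / a ^ 2) := by
    ext
    · simp [variableChange_a₁, twoCurve]
    · simp [variableChange_a₂, twoCurve, ← hu]; field_simp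
    · simp [variableChange_a₃, twoCurve]
    · simp [variableChange_a₄, twoCurve, ← hu]; field_simp
    · simp [variableChange_a₆, twoCurve]
  have hell' : (twoCurve 1 (b / a ^ 2)).IsElliptic := hv₃ ▸ inferInstance
  obtain ⟨ι₃, i₃, i₃', h₃⟩ := exists_variableChange_equiv _ hv₃
  refine ⟨b / a ^ 2, hell', (j_eq_of_smul_eq hv₃).trans hjab, (ι₁.trans ι₂).trans ι₃, ?_, ?_, ?_⟩
  · exact i₃.comp (i₂.comp i₁)
  · exact i₁'.comp (i₂'.comp i₃')
  · change ι₃ (ι₂ (ι₁ T)) = _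
    rw [hT₂]
    refine eq_twoPoint (by simpa using twoPoint_ne_zero) ?_
    rw [(h₃ _ twoPoint_ne_zero).1]; simp [twoPoint]

omit [IsAlgClosed F] [DecidableEq F] in
lemma isElliptic_twoCurve_dual (r : F) [(twoCurve 1 r).IsElliptic] :
    (twoCurve 1 (1 / 4 - r)).IsElliptic := by
  obtain ⟨h1, h2⟩ := b_ne_zero_of_twoCurve (a := 1) (b := r)
  refine isElliptic_twoCurve (fun h => h2 ?_) (fun h => h1 ?_)
  · linear_combination 4 * h
  · linear_combination h / 4

/-- The isogeny with kernel generated by `(0, 0)`, with normalized target. -/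
theorem exists_twoIsogeny_one (r : F) [(twoCurve 1 r).IsElliptic]
    [(twoCurve 1 (1 / 4 - r)).IsElliptic] :
    ∃ π : (twoCurve 1 r).toAffine.Point →+ (twoCurve 1 (1 / 4 - r)).toAffine.Point,
      IsIsogeny π ∧ π (twoPoint 1 r) = 0 ∧ ∀ P, P ≠ 0 → P ≠ twoPoint 1 r → π P ≠ 0 ∧
        (yc P = 0 → π P = twoPoint _ _) := by
  obtain ⟨h1, h2⟩ := b_ne_zero_of_twoCurve (a := 1) (b := r)
  have hell : (twoCurve (-2 * 1) (1 ^ 2 - 4 * r)).IsElliptic := by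
    refine isElliptic_twoCurve h2 ?_
    intro h; apply h1; linear_combination h / 16
  obtain ⟨π, hπ, hT, hP⟩ := exists_twoIsogeny 1 r
  obtain ⟨u, hu⟩ := IsAlgClosed.exists_pow_nat_eq (-2 : F) (n := 2) two_pos
  have hu0 : u ≠ 0 := by rintro rfl; norm_num at hu
  have hv : (⟨Units.mk0 u hu0, 0, 0, 0⟩ : VariableChange F) • twoCurve (-2 * 1) (1 ^ 2 - 4 * r) =
      twoCurve 1 (1 / 4 - r) := by
    have h4 : (u ^ 4) = 4 := by rw [show 4 = 2 * 2 from rfl, pow_mul, hu]; norm_num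
    ext
    · simp [variableChange_a₁, twoCurve]
    · simp [variableChange_a₂, twoCurve, hu]
    · simp [variableChange_a₃, twoCurve]
    · simp [variableChange_a₄, twoCurve, h4]; ring
    · simp [variableChange_a₆, twoCurve]
  obtain ⟨ι, i, -, hι⟩ := exists_variableChange_equiv _ hv
  refine ⟨ι.toAddMonoidHom.comp π, i.comp hπ, ?_, fun P h0 hPT => ?_⟩
  · change ι (π _) = 0
    rw [hT, map_zero]
  · obtain ⟨p1, p2, p3⟩ := hP P h0 hPT
    refine ⟨by simpa using p1, fun hy => eq_twoPoint (by simpa using p1) ?_⟩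
    change xc (ι (π P)) = 0
    rw [(hι _ p1).1, p2, hy]; simp

/-- The target of an isogeny with kernel generated by `(0, 0)`. -/
theorem j_eq_of_ker_eq {r : F} [(twoCurve 1 r).IsElliptic] [(twoCurve 1 (1 / 4 - r)).IsElliptic]
    {W : WeierstrassCurve F} [W.IsElliptic] {φ : (twoCurve 1 r).toAffine.Point →+ W.toAffine.Point}
    (h : IsIsogeny φ) (h2 : Nat.card φ.ker = 2) (hT : φ (twoPoint 1 r) = 0) :
    W.j = (twoCurve 1 (1 / 4 - r)).j := by
  have : Invertible (2 : F) := invertibleOfNonzero two_ne_zero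
  obtain ⟨v₁, hv₁⟩ := W.exists_variableChange_isCharNeTwoNF
  obtain ⟨ι₁, i₁, i₁', -⟩ := exists_variableChange_equiv v₁ (rfl : v₁ • W = v₁ • W)
  obtain ⟨π, hπ, hπT, hP⟩ := exists_twoIsogeny_one r
  have hψ := i₁.comp h
  set ψ := ι₁.toAddMonoidHom.comp φ with hψe
  have hk : ψ.ker = φ.ker := by
    ext P
    change ι₁ (φ P) = 0 ↔ φ P = 0
    simp
  obtain ⟨β, hβ, hβ'⟩ := hπ.exists_factor hψ (fun P hPk => by
    rw [hk]
    by_cases h0 : P = 0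
    · rw [h0]; exact zero_mem _
    by_cases hPT : P = twoPoint 1 r
    · rw [hPT]; exact hT
    · exact absurd hPk (hP P h0 hPT).1)
  have hc := AddMonoidHom.card_ker_comp β π hπ.surjective
  rw [← hβ', hk, h2] at hc
  have : Finite π.ker := hπ.finite_ker.to_subtype
  have hnt : Nontrivial π.ker := ⟨⟨⟨twoPoint 1 r, hπT⟩, 0, fun h => twoPoint_ne_zero
    (congrArg Subtype.val h)⟩⟩
  have h1 : 1 < Nat.card π.ker := Finite.one_lt_card
  have hβ1 : Nat.card β.ker = 1 := by
    have := hβ.card_ker_pos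
    nlinarith
  obtain ⟨v, hv⟩ := hβ.exists_variableChange hβ1
  exact ((j_eq_of_smul_eq (rfl : v₁ • W = v₁ • W)).symm).trans (j_eq_of_smul_eq hv).symm

/-- Going from the curve `r` to `1/4 - r`, identified with `s`, then to `1/4 - s`, identified with
`r`, gives an endomorphism, hence an integer. It kills (0,0), so it is even and kills all 2-torsion.
The image of another point of order two is the (0,0) of the middle curve, which must therefore match
the (0,0) of the curve `s`. An isomorphism respecting these points has `u² = 1` and no translation.
-/
theorem eq_of_j_eq_of_nonCM {r s : F} [(twoCurve 1 r).IsElliptic] [(twoCurve 1 (1 / 4 - r)).IsElliptic]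
    [(twoCurve 1 s).IsElliptic] [(twoCurve 1 (1 / 4 - s)).IsElliptic] (h : NonCM (twoCurve 1 r))
    (h1 : (twoCurve 1 s).j = (twoCurve 1 (1 / 4 - r)).j)
    (h2 : (twoCurve 1 (1 / 4 - s)).j = (twoCurve 1 r).j) : s = 1 / 4 - r := by
  obtain ⟨π, hπ, hπT, hP⟩ := exists_twoIsogeny_one r
  obtain ⟨π', hπ', hπT', hP'⟩ := exists_twoIsogeny_one s
  obtain ⟨v, hv⟩ := exists_variableChange_of_j_eq _ _ h1.symm
  obtain ⟨w, hw⟩ := exists_variableChange_of_j_eq _ _ h2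
  obtain ⟨ι, i, -, hι⟩ := exists_variableChange_equiv _ hv
  obtain ⟨κ, k, -, -⟩ := exists_variableChange_equiv _ hw
  obtain ⟨n, hn⟩ := h _ (k.comp (hπ'.comp (i.comp hπ)))
  have hn' : ∀ P, κ (π' (ι (π P))) = n • P := hn
  obtain ⟨hr0, hd⟩ := b_ne_zero_of_twoCurve (a := 1) (b := r)
  have heven : Even n := by
    by_contra hodd
    obtain ⟨m, rfl⟩ := Int.not_even_iff_odd.mp hodd
    have := hn' (twoPoint 1 r)
    rw [hπT, map_zero, map_zero, map_zero, add_smul, mul_comm, mul_smul, two_smul,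
      twoPoint_add_self, smul_zero, zero_add, one_smul] at this
    exact twoPoint_ne_zero this.symm
  -- A root `x` of x² + x + r gives a point of order two other than (0,0).
  obtain ⟨d, hd2⟩ := IsAlgClosed.exists_pow_nat_eq (1 - 4 * r) (n := 2) two_pos
  set x := (-1 + d) / 2 with hx
  have hxr : x ^ 2 + x + r = 0 := by rw [hx]; linear_combination hd2 / 4
  have hx0 : x ≠ 0 := by intro h; rw [h] at hxr; apply hr0; linear_combination hxr
  let P : (twoCurve 1 r).toAffine.Point := .some x 0 (Affine.equation_iff_nonsingular.mp (by
    rw [Affine.equation_iff]; simp only [twoCurve]; linear_combination (-x) * hxr))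
  have hP0 : P ≠ 0 := Affine.Point.some_ne_zero _
  have hPT : P ≠ twoPoint 1 r := fun h => hx0 (congrArg xc h)
  have hPP : P + P = 0 := by
    rw [← eq_neg_iff_add_eq_zero]
    refine point_ext hP0 (neg_ne_zero.mpr hP0) (xc_neg _).symm ?_
    rw [yc_neg]; simp [P]
  have hπP := (hP P hP0 hPT).2 rfl
  have h0 : π' (ι (twoPoint _ _)) = 0 := by
    obtain ⟨m, rfl⟩ := heven
    have := hn' P
    rw [hπP, add_smul, ← smul_add, hPP, smul_zero] at this
    simpa using this
  have hιT : ι (twoPoint _ _) = twoPoint 1 s := by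
    by_contra hne
    exact (hP' _ (by simpa using twoPoint_ne_zero) hne).1 h0
  have hvr : v.r = 0 := by
    have := (hι _ twoPoint_ne_zero).1
    rw [hιT] at this
    simpa [twoPoint, eq_comm (a := (0 : F))] using this
  have e1 := congrArg a₁ hv
  have e3 := congrArg a₃ hv
  have e2 := congrArg a₂ hv
  have e4 := congrArg a₄ hv
  simp only [variableChange_a₁, variableChange_a₂, variableChange_a₃, variableChange_a₄,
    twoCurve, hvr] at e1 e2 e3 e4
  have hs : v.s = 0 := by simpa using e1
  have ht : v.t = 0 := by simpa using e3
  rw [hs] at e2 e4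
  rw [ht] at e4
  have e2' : (v.u⁻¹ : F) ^ 2 = 1 := by simpa using e2
  have : (v.u⁻¹ : F) ^ 4 = 1 := by rw [show 4 = 2 * 2 from rfl, pow_mul, e2', one_pow]
  rw [← e4]
  simp only [Units.val_inv_eq_inv_val] at this ⊢
  rw [this]; ring

end WeierstrassCurve

/-! ### The four lines of a plane over 𝔽₃, and PGL₂(𝔽₃) ≅ S₄ -/

/-- A group of type `(3, 3)`, with generators of its four subgroups of order 3. -/
structure LineSystem {A : Type*} [AddCommGroup A] (P : Fin 4 → A) : Prop where
  three : ∀ a : A, a + a + a = 0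
  ne_zero : ∀ i, P i ≠ 0
  inj : ∀ {i j}, (P i = P j ∨ P i = -P j) → i = j
  cover : ∀ a : A, a ≠ 0 → ∃ i, a = P i ∨ a = -P i

namespace LineSystem

variable {A : Type*} [AddCommGroup A] {P : Fin 4 → A}

lemma ne_neg (h : LineSystem P) {a : A} (ha : a ≠ 0) : a ≠ -a := by
  intro h1
  have h2 := h.three a
  rw [eq_neg_iff_add_eq_zero.mp h1, zero_add] at h2
  exact ha h2

lemma card_eq (h : LineSystem P) : Nat.card A = 9 := by
  let f : Option (Fin 4 × Bool) → A := fun o => match o with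
    | none => 0
    | some (i, true) => P i
    | some (i, false) => -P i
  have hf : Function.Bijective f := by
    constructor
    · rintro (_ | ⟨i, _ | _⟩) (_ | ⟨j, _ | _⟩) hij
      · rfl
      · exact absurd hij.symm (neg_ne_zero.mpr (h.ne_zero j))
      · exact absurd hij.symm (h.ne_zero j)
      · exact absurd hij (neg_ne_zero.mpr (h.ne_zero i))
      · have h1 : -P i = -P j := hij
        rw [h.inj (Or.inl (neg_injective h1))]
      · have h1 : -P i = P j := hij
        have := h.inj (Or.inr (by rw [← h1]; simp) : P i = P j ∨ P i = -P j)
        subst this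
        exact absurd h1.symm (h.ne_neg (h.ne_zero i))
      · exact absurd hij (h.ne_zero i)
      · have h1 : P i = -P j := hij
        have := h.inj (Or.inr h1)
        subst this
        exact absurd h1 (h.ne_neg (h.ne_zero i))
      · have h1 : P i = P j := hij
        rw [h.inj (Or.inl h1)]
    · intro a
      by_cases ha : a = 0
      · exact ⟨none, ha.symm⟩
      · obtain ⟨i, hi | hi⟩ := h.cover a ha
        · exact ⟨some (i, true), hi.symm⟩
        · exact ⟨some (i, false), hi.symm⟩
  rw [← Nat.card_congr (Equiv.ofBijective f hf)]
  simp

lemma exists_swap (h : LineSystem P) {i j : Fin 4} (hij : i ≠ j) :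
    (∃ α : A ≃+ A, α (P i) = P j ∧ α (P j) = P i) ∧
    ∀ a : A, a = 0 ∨ (a = P i ∨ a = -P i) ∨ (a = P j ∨ a = -P j) ∨
      (a = P i + P j ∨ a = -(P i + P j)) ∨ (a = P i - P j ∨ a = -(P i - P j)) := by
  let _ : Module (ZMod 3) A := AddCommGroup.zmodModule (n := 3) fun x => by
    rw [← h.three x, show 3 = 1 + 1 + 1 from rfl, add_smul, add_smul, one_smul]
  have hz : ∀ s : ZMod 3, s = 0 ∨ s = 1 ∨ s = -1 := by decide
  have h1 : P i ≠ P j := fun e => hij (h.inj (Or.inl e))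
  have h2 : P i ≠ -P j := fun e => hij (h.inj (Or.inr e))
  have hli : LinearIndependent (ZMod 3) ![P i, P j] := by
    rw [LinearIndependent.pair_iff]
    intro s t hst
    rcases hz s with rfl | rfl | rfl <;> rcases hz t with rfl | rfl | rfl
    · simp
    · simp [h.ne_zero] at hst
    · simp [h.ne_zero] at hst
    · simp [h.ne_zero] at hst
    · simp only [one_smul] at hst
      exact absurd (eq_neg_of_add_eq_zero_left hst) h2
    · simp only [one_smul, neg_smul] at hst
      exact absurd (by simpa using eq_neg_of_add_eq_zero_left hst) h1
    · simp [h.ne_zero] at hst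
    · simp only [one_smul, neg_smul] at hst
      exact absurd (by simpa using eq_neg_of_add_eq_zero_left hst) h1
    · simp only [one_smul, neg_smul] at hst
      exact absurd (by simpa [neg_eq_iff_eq_neg] using eq_neg_of_add_eq_zero_left hst) h2
  have : Finite A := Nat.finite_of_card_ne_zero (by rw [h.card_eq]; norm_num)
  have : Fintype A := Fintype.ofFinite A
  have hfin : Module.finrank (ZMod 3) A = 2 := by
    have h3 := Module.card_eq_pow_finrank (K := ZMod 3) (V := A)
    rw [← Nat.card_eq_fintype_card, h.card_eq, ZMod.card] at h3
    exact (Nat.pow_right_injective (le_refl 3 |>.trans' (by norm_num)) (by simpa using h3.symm))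
  let b := basisOfLinearIndependentOfCardEqFinrank hli (by rw [hfin]; simp)
  have hb : ⇑b = ![P i, P j] := coe_basisOfLinearIndependentOfCardEqFinrank hli _
  have hb0 : b 0 = P i := by rw [hb]; rfl
  have hb1 : b 1 = P j := by rw [hb]; rfl
  constructor
  · refine ⟨(b.equiv b (Equiv.swap 0 1)).toAddEquiv, ?_, ?_⟩
    · change b.equiv b (Equiv.swap 0 1) (P i) = _
      rw [← hb0, Module.Basis.equiv_apply, Equiv.swap_apply_left, hb1]
    · change b.equiv b (Equiv.swap 0 1) (P j) = _
      rw [← hb1, Module.Basis.equiv_apply, Equiv.swap_apply_right, hb0]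
  · intro a
    have ha := b.sum_repr a
    rw [Fin.sum_univ_two, hb0, hb1] at ha
    rw [← ha]
    rcases hz (b.repr a 0) with e | e | e <;> rcases hz (b.repr a 1) with e' | e' | e' <;>
      simp only [e, e', zero_smul, one_smul, neg_smul, zero_add, add_zero, true_or, or_true,
        ← sub_eq_add_neg, neg_add, neg_sub, neg_add_eq_sub, zero_sub]

/-- The swap of the basis vectors `P i`, `P j` preserves the two remaining lines, which are spanned
by their sum and their difference. -/
lemma exists_transposition (h : LineSystem P) {i j : Fin 4} (hij : i ≠ j) :
    ∃ α : A ≃+ A, ∀ m, α (P m) = P (Equiv.swap i j m) ∨ α (P m) = -P (Equiv.swap i j m) := by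
  obtain ⟨⟨α, h1, h2⟩, h3⟩ := h.exists_swap hij
  refine ⟨α, fun m => ?_⟩
  by_cases hi : m = i
  · subst hi; left; rw [Equiv.swap_apply_left, h1]
  by_cases hj : m = j
  · subst hj; left; rw [Equiv.swap_apply_right, h2]
  rw [Equiv.swap_apply_of_ne_of_ne hi hj]
  rcases h3 (P m) with e | e | e | e | e
  · exact absurd e (h.ne_zero m)
  · exact absurd (h.inj e) hi
  · exact absurd (h.inj e) hj
  · left
    rcases e with e | e <;> rw [e] <;> simp [h1, h2, add_comm]
  · right
    rcases e with e | e <;> rw [e] <;> simp [h1, h2]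

lemma exists_equiv (h : LineSystem P) (σ : Equiv.Perm (Fin 4)) :
    ∃ α : A ≃+ A, ∀ m, α (P m) = P (σ m) ∨ α (P m) = -P (σ m) := by
  induction σ using Equiv.Perm.swap_induction_on with
  | one => exact ⟨AddEquiv.refl A, fun m => Or.inl rfl⟩
  | swap_mul f x y hxy ih =>
    obtain ⟨α, hα⟩ := ih
    obtain ⟨β, hβ⟩ := h.exists_transposition hxy
    refine ⟨α.trans β, fun m => ?_⟩
    change β (α (P m)) = P (Equiv.swap x y (f m)) ∨ β (α (P m)) = -P (Equiv.swap x y (f m))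
    rcases hα m with e | e <;> rcases hβ (f m) with e' | e' <;> rw [e] <;> simp [e']

/-- The kernel of GL₂(𝔽₃) → S₄ is ±1: with opposite signs on `P 0` and `P 1`, the line of `P 0 + P
1` would move. -/
lemma eq_one_or_neg (h : LineSystem P) (α : A →+ A) (hα : ∀ m, α (P m) = P m ∨ α (P m) = -P m) :
    (∀ a, α a = a) ∨ (∀ a, α a = -a) := by
  have hcov := (h.exists_swap (show (0 : Fin 4) ≠ 1 by decide)).2
  have key : ∀ a : A, a ≠ 0 → α a = a ∨ α a = -a := by
    intro a ha
    obtain ⟨i, rfl | rfl⟩ := h.cover a ha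
    · exact hα i
    · rcases hα i with e | e <;> simp [e]
  have hsum : P 0 + P 1 ≠ 0 := fun e => absurd (h.inj (Or.inr (eq_neg_of_add_eq_zero_left e)))
    (by decide)
  have n0 := h.ne_neg (h.ne_zero 0)
  have n1 := h.ne_neg (h.ne_zero 1)
  have hk := key _ hsum
  rw [map_add] at hk
  rcases hα 0 with e0 | e0 <;> rcases hα 1 with e1 | e1
  · left
    intro a
    rcases hcov a with rfl | (rfl | rfl) | (rfl | rfl) | (rfl | rfl) | (rfl | rfl) <;> simp [e0, e1]
  · exfalso
    rw [e0, e1] at hk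
    rcases hk with e | e
    · exact n1 (add_left_cancel e).symm
    · rw [neg_add] at e
      exact n0 (add_right_cancel e)
  · exfalso
    rw [e0, e1] at hk
    rcases hk with e | e
    · exact n0 (add_right_cancel e).symm
    · rw [neg_add] at e
      exact n1 (add_left_cancel e)
  · right
    intro a
    rcases hcov a with rfl | (rfl | rfl) | (rfl | rfl) | (rfl | rfl) | (rfl | rfl) <;>
      simp [e0, e1] <;> abel

lemma exists_perm (h : LineSystem P) (α : A ≃+ A) :
    ∃ σ : Equiv.Perm (Fin 4), ∀ m, α (P m) = P (σ m) ∨ α (P m) = -P (σ m) := by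
  choose f hf using fun m => h.cover (α (P m)) (by simpa using h.ne_zero m)
  have hinj : Function.Injective f := by
    intro i j hij
    apply h.inj
    have h1 := hf i
    have h2 := hf j
    rw [← hij] at h2
    rcases h1 with e | e <;> rcases h2 with e' | e'
    · left; exact α.injective (e.trans e'.symm)
    · right; apply α.injective; rw [map_neg, e, e', neg_neg]
    · right; apply α.injective; rw [map_neg, e, e']
    · left; exact α.injective (e.trans e'.symm)
  exact ⟨Equiv.ofBijective f (Finite.injective_iff_bijective.mp hinj), hf⟩

/-- A double transposition of the four lines is induced by elements of square `-1` only. -/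
lemma sq_eq_neg (h : LineSystem P) (α : A →+ A)
    (hα : ∀ m, α (P m) = P ((Equiv.swap 0 1 * Equiv.swap 2 3 : Equiv.Perm (Fin 4)) m) ∨
      α (P m) = -P ((Equiv.swap 0 1 * Equiv.swap 2 3 : Equiv.Perm (Fin 4)) m)) (a : A) : α (α a) = -a := by
  set σ : Equiv.Perm (Fin 4) := Equiv.swap 0 1 * Equiv.swap 2 3 with hσ
  have hσσ : ∀ m, σ (σ m) = m := by decide
  have hσne : ∀ m, σ m ≠ m := by decide
  have h1 : ∀ m, (α.comp α) (P m) = P m ∨ (α.comp α) (P m) = -P m := by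
    intro m
    rw [AddMonoidHom.comp_apply]
    have h2 := hα (σ m)
    rw [hσσ] at h2
    rcases hα m with e | e <;> rcases h2 with e' | e' <;> rw [e] <;> simp [e']
  rcases h.eq_one_or_neg _ h1 with h2 | h2
  -- If `α² = 1`, then `P 0 + α (P 0)` spans an invariant line when `α (P 0) = P 1`, and `P 0 - α (P
  -- 0)` when `α (P 0) = -P 1`. Both are `P 0 + P 1`, but `σ` fixes no line.
  · exfalso
    have hsum : P 0 + P 1 ≠ 0 := fun e => absurd (h.inj (Or.inr (eq_neg_of_add_eq_zero_left e)))
      (by decide)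
    have h0 := hα 0
    rw [show σ 0 = 1 by decide] at h0
    have hs : α (P 0 + P 1) = P 0 + P 1 ∨ α (P 0 + P 1) = -(P 0 + P 1) := by
      have h3 : α (α (P 0)) = P 0 := h2 (P 0)
      rcases h0 with e | e
      · rw [e] at h3; left; rw [map_add, e, h3, add_comm]
      · rw [e, map_neg, neg_eq_iff_eq_neg] at h3
        right; rw [map_add, e, h3]; abel
    obtain ⟨m, hm⟩ := h.cover _ hsum
    have hm2 : α (P m) = P m ∨ α (P m) = -P m := by
      rcases hm with e | e
      · rwa [e] at hs
      · rw [e] at hs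
        simpa [neg_eq_iff_eq_neg, or_comm] using hs
    have := hα m
    refine hσne m (h.inj ?_)
    rcases this with e | e <;> rcases hm2 with e' | e'
    · left; rw [← e, e']
    · right; rw [← e, e']
    · right; rw [← e', e, neg_neg]
    · left; exact neg_injective (e.symm.trans e')
  · exact h2 a

end LineSystem

lemma Equiv.Perm.eq_one_of_forall_commute_four : ∀ σ : Equiv.Perm (Fin 4),
    (∀ τ : Equiv.Perm (Fin 4), τ * σ = σ * τ) → σ = 1 := by
  decide

/-! ### The 3-division polynomial and the 3-torsion points -/

namespace WeierstrassCurve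

variable {F : Type*} [Field F] {W : WeierstrassCurve F}

lemma eval_Ψ₃ (x : F) : W.Ψ₃.eval x =
    3 * x ^ 4 + W.b₂ * x ^ 3 + 3 * W.b₄ * x ^ 2 + 3 * W.b₆ * x + W.b₈ := by
  simp [Ψ₃]

variable [DecidableEq F] [CharZero F] [W.IsElliptic]

/-- `3P = 0` means `2P = -P`, equivalently `x(2P) = x(P)` for `2P ≠ 0`, and the duplication formula
turns this into `Ψ₃`. For a point of order two a root of `Ψ₃` would contradict nonsingularity. -/
lemma three_torsion_iff {P : W.toAffine.Point} (hP : P ≠ 0) :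
    P + P + P = 0 ↔ W.Ψ₃.eval (xc P) = 0 := by
  obtain ⟨h, hP'⟩ := exists_eq_some hP
  have heq := (Affine.equation_iff ..).mp h.1
  have hns := (Affine.nonsingular_iff ..).mp h
  set x := xc P
  set y := yc P
  have hid : (3 * x ^ 2 + 2 * W.a₂ * x + W.a₄ - W.a₁ * y) ^ 2 +
      W.a₁ * (3 * x ^ 2 + 2 * W.a₂ * x + W.a₄ - W.a₁ * y) * (2 * y + W.a₁ * x + W.a₃) -
      (W.a₂ + 3 * x) * (2 * y + W.a₁ * x + W.a₃) ^ 2 = - W.Ψ₃.eval x := by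
    rw [eval_Ψ₃, b₂, b₄, b₆, b₈]
    linear_combination (-(W.a₁ ^ 2 + 12 * x + 4 * W.a₂)) * heq
  by_cases hy : 2 * y + W.a₁ * x + W.a₃ = 0
  · have hPP : P + P = 0 := by
      rw [← eq_neg_iff_add_eq_zero]
      refine point_ext hP (neg_ne_zero.mpr hP) (xc_neg _).symm ?_
      conv_rhs => rw [hP']
      rw [Affine.Point.neg_some, yc_some, Affine.negY]
      linear_combination hy
    rw [hPP, zero_add]
    refine iff_of_false hP fun h0 => ?_
    rw [hy, h0] at hid
    have h1 : 3 * x ^ 2 + 2 * W.a₂ * x + W.a₄ - W.a₁ * y = 0 := by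
      have : (3 * x ^ 2 + 2 * W.a₂ * x + W.a₄ - W.a₁ * y) ^ 2 = 0 := by linear_combination hid
      simpa using this
    rcases hns.2 with h2 | h2
    · apply h2; linear_combination -h1
    · apply h2; linear_combination hy
  · have hne : y ≠ W.toAffine.negY x y := by
      rw [Affine.negY]; intro h1; apply hy; linear_combination h1
    have hPP := Affine.Point.add_self_of_Y_ne (h₁ := h) hne
    rw [← hP'] at hPP
    have h0 : P + P ≠ 0 := by rw [hPP]; exact Affine.Point.some_ne_zero _
    have hx : xc (P + P) = x ↔ W.Ψ₃.eval x = 0 := by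
      rw [hPP, xc_some, Affine.addX, Affine.slope_of_Y_ne rfl hne, Affine.negY]
      have hd : y - (-y - W.a₁ * x - W.a₃) ≠ 0 := fun h => hy (by linear_combination h)
      have e : y - (-y - W.a₁ * x - W.a₃) = 2 * y + W.a₁ * x + W.a₃ := by ring
      rw [e] at hd ⊢
      have key : ∀ N D a a' : F, D ≠ 0 → ((N / D) ^ 2 + a * (N / D) - a' - x - x = x ↔
          N ^ 2 + a * N * D - (a' + 3 * x) * D ^ 2 = 0) := by
        intro N D a a' hD
        rw [← sub_eq_zero, show (N / D) ^ 2 + a * (N / D) - a' - x - x - x =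
          (N ^ 2 + a * N * D - (a' + 3 * x) * D ^ 2) / D ^ 2 by field_simp; ring,
          div_eq_zero_iff, or_iff_left (pow_ne_zero 2 hD)]
      rw [key _ _ _ _ hd, hid, neg_eq_zero]
    rw [← hx]
    constructor
    · intro h
      rw [eq_neg_of_add_eq_zero_left h, xc_neg]
    · intro h
      rcases eq_or_eq_neg h0 hP h with h1 | h1
      · exact absurd (by simpa using h1) hP
      · rw [h1, neg_add_cancel]

variable [IsAlgClosed F]

/-- The derivative of `Ψ₃` at `x(P)` is `3 (2y + a₁x + a₃)²`, so a multiple root would give a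
nonzero point killed by both 2 and 3. -/
lemma Ψ₃_separable : W.Ψ₃.roots.Nodup := by
  have h3 : (3 : F) ≠ 0 := by norm_num
  have h0 := W.Ψ₃_ne_zero h3
  refine Multiset.nodup_iff_count_le_one.mpr fun x => ?_
  rw [count_roots]
  by_contra! h1
  obtain ⟨hr, hd⟩ := (one_lt_rootMultiplicity_iff_isRoot h0).mp h1
  obtain ⟨P, hP, rfl⟩ := exists_xc_eq (W := W) x
  obtain ⟨h, hP'⟩ := exists_eq_some hP
  have heq := (Affine.equation_iff ..).mp h.1
  set x := xc P
  set y := yc P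
  have hd' : derivative W.Ψ₃ = 3 * (C 4 * X ^ 3 + C W.b₂ * X ^ 2 + C (2 * W.b₄) * X + C W.b₆) := by
    simp only [Ψ₃, derivative_add, derivative_mul, derivative_X_pow, derivative_C, derivative_X,
      derivative_ofNat, map_mul]
    push_cast
    rw [show (C (3 : F)) = 3 from map_ofNat C 3, show (C (2 : F)) = 2 from map_ofNat C 2,
      show (C (4 : F)) = 4 from map_ofNat C 4]
    ring
  have hD : (2 * y + W.a₁ * x + W.a₃) ^ 2 = 0 := by
    have : eval x (derivative W.Ψ₃) = 0 := hd
    rw [hd'] at this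
    simp at this
    rw [b₂, b₄, b₆] at this
    linear_combination this + 4 * heq
  have hP3 := (three_torsion_iff hP).mpr hr
  have hPP : P + P = 0 := by
    rw [← eq_neg_iff_add_eq_zero]
    refine point_ext hP (neg_ne_zero.mpr hP) (xc_neg _).symm ?_
    conv_rhs => rw [hP']
    rw [Affine.Point.neg_some, yc_some, Affine.negY]
    linear_combination (pow_eq_zero_iff two_ne_zero).mp hD
  rw [hPP, zero_add] at hP3
  exact hP hP3

/-- The three-torsion points of an elliptic curve. -/
lemma exists_three_torsion : ∃ P : Fin 4 → W.toAffine.Point,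
    (∀ i, P i ≠ 0 ∧ P i + P i + P i = 0) ∧ Function.Injective (fun i => xc (P i)) ∧
    ∀ Q : W.toAffine.Point, Q ≠ 0 → Q + Q + Q = 0 → ∃ i, Q = P i ∨ Q = - P i := by
  have h3 : (3 : F) ≠ 0 := by norm_num
  have hcard : W.Ψ₃.roots.toFinset.card = 4 := by
    rw [Multiset.toFinset_card_of_nodup Ψ₃_separable, ← W.natDegree_Ψ₃ h3]
    exact (IsAlgClosed.splits W.Ψ₃).natDegree_eq_card_roots.symm
  let e := W.Ψ₃.roots.toFinset.equivFinOfCardEq hcard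
  choose P hP hx using fun i => exists_xc_eq (W := W) (e.symm i : F)
  have hroot : ∀ x, x ∈ W.Ψ₃.roots.toFinset ↔ W.Ψ₃.eval x = 0 := by
    intro x
    rw [Multiset.mem_toFinset, mem_roots (W.Ψ₃_ne_zero h3)]; rfl
  refine ⟨P, fun i => ⟨hP i, ?_⟩, fun i j h => ?_, fun Q hQ hQ3 => ?_⟩
  · rw [three_torsion_iff (hP i), hx, ← hroot]
    exact (e.symm i).2
  · have h : xc (P i) = xc (P j) := h
    rw [hx, hx] at h
    exact e.symm.injective (Subtype.ext h)
  · rw [three_torsion_iff hQ, ← hroot] at hQ3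
    refine ⟨e ⟨_, hQ3⟩, eq_or_eq_neg hQ (hP _) ?_⟩
    rw [hx]; simp

end WeierstrassCurve

/-! ### Endomorphisms of a plane that commute with their conjugates -/

/-- An endomorphism of a plane which commutes with all of its conjugates is scalar. -/
lemma LinearMap.exists_eq_smul_of_commute_conj {K V : Type*} [Field K] [AddCommGroup V] [Module K V]
    (h2 : (2 : K) ≠ 0) (hV : Module.finrank K V = 2) (f : V →ₗ[K] V)
    (h : ∀ (α : V ≃ₗ[K] V) (v : V), f (α (f (α.symm v))) = α (f (α.symm (f v)))) :
    ∃ c : K, f = c • LinearMap.id := by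
  refine LinearMap.exists_eq_smul_id_of_forall_notLinearIndependent fun v hli => ?_
  set w := f v with hw
  -- Conjugation by the transvection fixing `v` and sending `w` to `w + v` is tested at `v`:
  -- commutation gives a linear relation in which `w` has coefficient 2.
  have hli' : LinearIndependent K ![v, w + v] := by
    rw [LinearIndependent.pair_iff] at hli ⊢
    intro s t hst
    have := hli (s + t) t (by rw [← hst]; module)
    exact ⟨by simpa [this.2] using this.1, this.2⟩
  let b := basisOfLinearIndependentOfCardEqFinrank hli (by rw [hV]; simp)
  let b' := basisOfLinearIndependentOfCardEqFinrank hli' (by rw [hV]; simp)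
  have hb : ⇑b = ![v, w] := coe_basisOfLinearIndependentOfCardEqFinrank hli _
  have hb' : ⇑b' = ![v, w + v] := coe_basisOfLinearIndependentOfCardEqFinrank hli' _
  let α : V ≃ₗ[K] V := b.equiv b' (Equiv.refl _)
  have hαv : α v = v := by
    have := b.equiv_apply 0 b' (Equiv.refl _)
    simpa [hb, hb'] using this
  have hαw : α w = w + v := by
    have := b.equiv_apply 1 b' (Equiv.refl _)
    simpa [hb, hb'] using this
  have hsv : α.symm v = v := by rw [LinearEquiv.symm_apply_eq, hαv]
  have hsw : α.symm w = w - v := by rw [LinearEquiv.symm_apply_eq, map_sub, hαv, hαw]; abel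
  have hspan := b.sum_repr (f w)
  rw [Fin.sum_univ_two, hb] at hspan
  simp only [Matrix.cons_val_zero, Matrix.cons_val_one] at hspan
  set x := b.repr (f w) 0
  set y := b.repr (f w) 1
  have key := h α v
  rw [hsv, ← hw, hαw, map_add, hsw, map_sub, ← hw, map_sub, hαw, ← hspan, map_add, map_smul,
    map_smul, hαv, hαw] at key
  have h3 : (1 - y) • v + (2 : K) • w = 0 := by
    rw [← sub_eq_zero] at key
    rw [← key]; module
  exact h2 ((LinearIndependent.pair_iff.mp hli) _ _ h3).2

lemma LineSystem.exists_eq_smul {A : Type*} [AddCommGroup A] {P : Fin 4 → A} (h : LineSystem P)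
    (f : A →+ A) (hf : ∀ (α : A ≃+ A) (v : A), f (α (f (α.symm v))) = α (f (α.symm (f v)))) :
    ∃ n : ℤ, ∀ a, f a = n • a := by
  let _ : Module (ZMod 3) A := AddCommGroup.zmodModule (n := 3) fun x => by
    rw [← h.three x, show 3 = 1 + 1 + 1 from rfl, add_smul, add_smul, one_smul]
  have : Finite A := Nat.finite_of_card_ne_zero (by rw [h.card_eq]; norm_num)
  have : Fintype A := Fintype.ofFinite A
  have hfin : Module.finrank (ZMod 3) A = 2 := by
    have h3 := Module.card_eq_pow_finrank (K := ZMod 3) (V := A)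
    rw [← Nat.card_eq_fintype_card, h.card_eq, ZMod.card] at h3
    exact (Nat.pow_right_injective (le_refl 3 |>.trans' (by norm_num)) (by simpa using h3.symm))
  obtain ⟨c, hc⟩ := LinearMap.exists_eq_smul_of_commute_conj (K := ZMod 3) (by decide) hfin
    (f.toZModLinearMap 3) (fun α v => hf α.toAddEquiv v)
  refine ⟨c.val, fun a => ?_⟩
  have := LinearMap.congr_fun hc a
  rw [natCast_zsmul, ← Nat.cast_smul_eq_nsmul (ZMod 3), ZMod.natCast_zmod_val]
  exact this

/-! ### The mod 3 representation as a permutation of four abscissae -/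

namespace WeierstrassCurve

open scoped Classical

variable {k : IntermediateField ℚ ℚbar} (C : WeierstrassCurve k) [C.IsElliptic]

instance : (C⁄ℚbar).IsElliptic := inferInstanceAs (C.map _).IsElliptic

lemma xc_map (g : ℚbar →ₐ[k] ℚbar) (Q : (C⁄ℚbar).toAffine.Point) :
    xc (Affine.Point.map (W' := C.toAffine) g Q : (C⁄ℚbar).toAffine.Point) = g (xc Q) := by
  rcases Q with _ | ⟨x, y, h⟩
  · exact (map_zero g).symm
  · rfl

lemma mem_torsionPoints_three (Q : (C⁄ℚbar).toAffine.Point) :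
    Q ∈ torsionPoints C 3 ↔ Q + Q + Q = 0 := by
  change ((3 : ℕ) : ℤ) • Q = 0 ↔ _
  rw [show ((3 : ℕ) : ℤ) = 1 + 1 + 1 by norm_num, add_zsmul, add_zsmul, one_zsmul]

theorem exists_lineSystem : ∃ P : Fin 4 → torsionPoints C 3, LineSystem P ∧
    (∀ i, (C⁄ℚbar).Ψ₃.eval (xc (P i : (C⁄ℚbar).toAffine.Point)) = 0) ∧
    Function.Injective fun i => xc (P i : (C⁄ℚbar).toAffine.Point) := by
  obtain ⟨P, h1, h2, h3⟩ := exists_three_torsion (W := C⁄ℚbar)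
  refine ⟨fun i => ⟨P i, (mem_torsionPoints_three C _).mpr (h1 i).2⟩, ⟨?_, ?_, ?_, ?_⟩, ?_, h2⟩
  · rintro ⟨a, ha⟩
    exact Subtype.ext ((mem_torsionPoints_three C _).mp ha)
  · intro i h
    exact (h1 i).1 (congrArg Subtype.val h)
  · rintro i j (h | h)
    · exact h2 (congrArg xc (congrArg Subtype.val h))
    · exact h2 ((congrArg xc (congrArg Subtype.val h)).trans (xc_neg _))
  · rintro ⟨a, ha⟩ h0
    obtain ⟨i, hi | hi⟩ := h3 a (fun h => h0 (Subtype.ext h)) ((mem_torsionPoints_three C _).mp ha)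
    · exact ⟨i, Or.inl (Subtype.ext hi)⟩
    · exact ⟨i, Or.inr (Subtype.ext hi)⟩
  · exact fun i => (three_torsion_iff (h1 i).1).mp (h1 i).2

section

variable {C} {P : Fin 4 → torsionPoints C 3}

lemma torsionRep_apply_iff (hP : LineSystem P) (g : ℚbar ≃ₐ[k] ℚbar) (i j : Fin 4) :
    (torsionRep C 3 g (P i) = P j ∨ torsionRep C 3 g (P i) = -P j) ↔
      g (xc (P i : (C⁄ℚbar).toAffine.Point)) = xc (P j : (C⁄ℚbar).toAffine.Point) := by
  have hx : xc ((torsionRep C 3 g (P i) : torsionPoints C 3) : (C⁄ℚbar).toAffine.Point) =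
      g (xc (P i : (C⁄ℚbar).toAffine.Point)) := xc_map C _ _
  rw [← hx]
  constructor
  · rintro (h | h)
    · rw [h]
    · rw [h]; exact xc_neg _
  · intro h
    have h0 : ((torsionRep C 3 g (P i) : torsionPoints C 3) : (C⁄ℚbar).toAffine.Point) ≠ 0 := by
      intro e
      have : torsionRep C 3 g (P i) = 0 := Subtype.ext e
      rw [LinearEquiv.map_eq_zero_iff] at this
      exact hP.ne_zero i this
    have h1 : ((P j : torsionPoints C 3) : (C⁄ℚbar).toAffine.Point) ≠ 0 := by
      intro e
      exact hP.ne_zero j (Subtype.ext e)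
    rcases eq_or_eq_neg h0 h1 h with e | e
    · exact Or.inl (Subtype.ext e)
    · exact Or.inr (Subtype.ext e)

/-- A central element commutes with lifts of all permutations of the lines. Its own permutation is
then central in S₄, so trivial; conversely an element fixing all lines is ±1. -/
lemma mem_ker_projectiveTorsionRep_iff (hP : LineSystem P) (g : ℚbar ≃ₐ[k] ℚbar) :
    g ∈ (projectiveTorsionRep C 3).ker ↔ ∀ i, g (xc (P i : (C⁄ℚbar).toAffine.Point)) =
      xc (P i : (C⁄ℚbar).toAffine.Point) := by
  have hk : g ∈ (projectiveTorsionRep C 3).ker ↔ torsionRep C 3 g ∈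
      Subgroup.center (torsionPoints C 3 ≃ₗ[ℤ] torsionPoints C 3) := by
    rw [MonoidHom.mem_ker]
    exact QuotientGroup.eq_one_iff _
  rw [hk, Subgroup.mem_center_iff]
  obtain ⟨τ, hτ⟩ := hP.exists_perm (torsionRep C 3 g).toAddEquiv
  have hτ' : ∀ i, torsionRep C 3 g (P i) = P (τ i) ∨ torsionRep C 3 g (P i) = -P (τ i) := hτ
  constructor
  · intro h
    have hτ1 : τ = 1 := by
      refine Equiv.Perm.eq_one_of_forall_commute_four τ fun σ => ?_
      obtain ⟨α, hα⟩ := hP.exists_equiv σ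
      have hc := h α.toIntLinearEquiv
      ext1 i
      have e : α (torsionRep C 3 g (P i)) = torsionRep C 3 g (α (P i)) := LinearEquiv.congr_fun hc (P i)
      have e1 : α (torsionRep C 3 g (P i)) = P (σ (τ i)) ∨
          α (torsionRep C 3 g (P i)) = - P (σ (τ i)) := by
        rcases hτ' i with e | e <;> rcases hα (τ i) with e' | e' <;> rw [e] <;> simp [e']
      have e2 : torsionRep C 3 g (α (P i)) = P (τ (σ i)) ∨
          torsionRep C 3 g (α (P i)) = - P (τ (σ i)) := by
        rcases hα i with e | e <;> rcases hτ' (σ i) with e' | e' <;> rw [e] <;> simp [e']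
      rw [← e] at e2
      apply hP.inj
      rcases e1 with e1 | e1 <;> rcases e2 with e2 | e2
      · left; exact e1.symm.trans e2
      · right; exact e1.symm.trans e2
      · right; exact neg_eq_iff_eq_neg.mp (e1.symm.trans e2)
      · left; exact neg_injective (e1.symm.trans e2)
    subst hτ1
    exact fun i => (torsionRep_apply_iff hP g i i).mp (hτ' i)
  · intro h α
    rcases hP.eq_one_or_neg (torsionRep C 3 g).toAddEquiv.toAddMonoidHom
      (fun i => (torsionRep_apply_iff hP g i i).mpr (h i)) with h1 | h1
    · have h1' : ∀ a, torsionRep C 3 g a = a := h1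
      ext1 a
      change α (torsionRep C 3 g a) = torsionRep C 3 g (α a)
      rw [h1', h1']
    · have h1' : ∀ a, torsionRep C 3 g a = -a := h1
      ext1 a
      change α (torsionRep C 3 g a) = torsionRep C 3 g (α a)
      rw [h1', h1', map_neg]

/-- An image mapping onto S₄ contains -1, the square of any lift of a double transposition, and -1
generates the kernel of GL₂(𝔽₃) → S₄. -/
theorem torsionRep_surjective_iff (hP : LineSystem P) : Function.Surjective (torsionRep C 3) ↔
    ∀ σ : Equiv.Perm (Fin 4), ∃ g : ℚbar ≃ₐ[k] ℚbar, ∀ i,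
      g (xc (P i : (C⁄ℚbar).toAffine.Point)) = xc (P (σ i) : (C⁄ℚbar).toAffine.Point) := by
  constructor
  · intro h σ
    obtain ⟨α, hα⟩ := hP.exists_equiv σ
    obtain ⟨g, hg⟩ := h α.toIntLinearEquiv
    refine ⟨g, fun i => (torsionRep_apply_iff hP g i _).mp ?_⟩
    rw [hg]; exact hα i
  · intro h α
    obtain ⟨σ, hσ⟩ := hP.exists_perm α.toAddEquiv
    have hσ' : ∀ i, α (P i) = P (σ i) ∨ α (P i) = -P (σ i) := hσ
    obtain ⟨g, hg⟩ := h σ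
    obtain ⟨g₂, hg₂⟩ := h (Equiv.swap 0 1 * Equiv.swap 2 3)
    have hneg : ∀ a, torsionRep C 3 (g₂ * g₂) a = -a := by
      intro a
      rw [map_mul]
      exact hP.sq_eq_neg (torsionRep C 3 g₂).toAddEquiv.toAddMonoidHom
        (fun i => (torsionRep_apply_iff hP g₂ i _).mpr (hg₂ i)) a
    have hfix : ∀ i, α.symm (torsionRep C 3 g (P i)) = P i ∨
        α.symm (torsionRep C 3 g (P i)) = -P i := by
      intro i
      have h1 := (torsionRep_apply_iff hP g i _).mpr (hg i)
      rcases h1 with e | e <;> rcases hσ' i with e' | e' <;> rw [e]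
      · left; rw [← e']; simp
      · right; rw [← neg_eq_iff_eq_neg.mpr e']; simp
      · right; rw [← e']; simp
      · left; rw [← e']; simp
    rcases hP.eq_one_or_neg (α.symm.toLinearMap.comp
      (torsionRep C 3 g).toLinearMap).toAddMonoidHom hfix with h1 | h1
    · refine ⟨g, ?_⟩
      ext1 a
      have := h1 a
      exact (LinearEquiv.symm_apply_eq α).mp this
    · refine ⟨g * (g₂ * g₂), ?_⟩
      ext1 a
      have h2 : torsionRep C 3 g a = α (-a) := (LinearEquiv.symm_apply_eq α).mp (h1 a)
      rw [map_mul]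
      change torsionRep C 3 g (torsionRep C 3 (g₂ * g₂) a) = _
      rw [hneg, map_neg, h2, map_neg, neg_neg]

end

/-- A Galois conjugate of an isogeny is an isogeny. -/
lemma isIsogeny_conj {φ : (C⁄ℚbar).toAffine.Point →+ (C⁄ℚbar).toAffine.Point} (h : IsIsogeny φ)
    (g : ℚbar ≃ₐ[k] ℚbar) : IsIsogeny (((Affine.Point.map (W' := C.toAffine) (g : ℚbar →ₐ[k] ℚbar)).comp
      φ).comp (Affine.Point.map (W' := C.toAffine) (g.symm : ℚbar →ₐ[k] ℚbar)) :
      (C⁄ℚbar).toAffine.Point →+ (C⁄ℚbar).toAffine.Point) := by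
  set G : (C⁄ℚbar).toAffine.Point →+ (C⁄ℚbar).toAffine.Point :=
    Affine.Point.map (W' := C.toAffine) (g : ℚbar →ₐ[k] ℚbar) with hG
  set G' : (C⁄ℚbar).toAffine.Point →+ (C⁄ℚbar).toAffine.Point :=
    Affine.Point.map (W' := C.toAffine) (g.symm : ℚbar →ₐ[k] ℚbar) with hG'
  have hGG : ∀ P, G (G' P) = P := by
    intro P
    rcases P with _ | ⟨x, y, h⟩
    · rfl
    · simp [hG, hG', Affine.Point.map_some]
  have hG'inj : Function.Injective G' := Function.LeftInverse.injective hGG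
  obtain ⟨p, q, r, s, hfin⟩ := h
  let f : ℚbar →+* ℚbar := (g : ℚbar →+* ℚbar)
  have hev : ∀ (p : ℚbar[X][Y]) x y, (p.map (mapRingHom f)).evalEval x y =
      g (p.evalEval (g.symm x) (g.symm y)) := by
    intro p x y
    have := map_mapRingHom_evalEval (f := f) (p := p) (g.symm x) (g.symm y)
    simpa [f] using this
  refine ⟨p.map (mapRingHom f), q.map (mapRingHom f), r.map (mapRingHom f), s.map (mapRingHom f),
    (hfin.preimage hG'inj.injOn).subset fun P hP hgood => hP ?_⟩
  obtain ⟨x, y, hns, hPe, hq, hs, h', hφ⟩ := hgood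
  have hPG : P = G (.some x y hns) := by rw [← hPe, hGG]
  refine ⟨g x, g y, (C.toAffine.baseChange_nonsingular (f := (g : ℚbar →ₐ[k] ℚbar)) g.injective ..).mpr hns, hPG, ?_, ?_, ?_⟩
  · rw [hev]; simpa using hq
  · rw [hev]; simpa using hs
  · simp only [hev, AlgEquiv.symm_apply_apply]
    have hns2 := (C.toAffine.baseChange_nonsingular (f := (g : ℚbar →ₐ[k] ℚbar)) g.injective ..).mpr h'
    simp only [AlgEquiv.coe_toAlgHom, map_div₀] at hns2
    refine ⟨hns2, ?_⟩
    change G (φ (G' P)) = _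
    rw [hφ]
    simp [hG, Affine.Point.map_some]

/-- An endomorphism commutes with its Galois conjugates, as these are endomorphisms too. By
surjectivity they induce on `C[3]` all conjugates under `Aut(C[3])`, so the action on `C[3]` is
scalar. -/
theorem nonCM_of_surjective [(C⁄ℚbar).IsCharNeTwoNF] (h : Function.Surjective (torsionRep C 3)) :
    NonCM (C⁄ℚbar) := by
  obtain ⟨P, hP, -, -⟩ := exists_lineSystem C
  refine nonCM_of_scalar ?_ fun φ hφ => ?_
  · rw [← hP.card_eq]
    refine Nat.card_congr (Equiv.subtypeEquivRight fun Q => ?_)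
    exact (mem_torsionPoints_three C Q).symm
  · have hmem : ∀ Q ∈ torsionPoints C 3, φ Q ∈ torsionPoints C 3 := by
      intro Q hQ
      rw [mem_torsionPoints_three] at hQ ⊢
      rw [← map_add, ← map_add, hQ, map_zero]
    let f : torsionPoints C 3 →+ torsionPoints C 3 :=
      (φ.comp (torsionPoints C 3).subtype).codRestrict _ fun Q => hmem _ Q.2
    obtain ⟨n, hn⟩ := hP.exists_eq_smul f fun α v => by
      obtain ⟨g, hg⟩ := h α.toIntLinearEquiv
      have h1 : ∀ v, α v = torsionRep C 3 g v := fun v => by rw [hg]; rfl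
      have h2 : ∀ v, α.symm v = torsionRep C 3 g.symm v := fun v => by
        rw [AddEquiv.symm_apply_eq, h1]
        change v = (torsionRep C 3 g * torsionRep C 3 g⁻¹) v
        rw [← map_mul]; simp
      have hc := (IsIsogeny.commute hφ (isIsogeny_conj C hφ g))
      have hc' := DFunLike.congr_fun hc (v : (C⁄ℚbar).toAffine.Point)
      rw [h1, h1, h2, h2]
      exact Subtype.ext hc'
    refine ⟨n, fun Q hQ => ?_⟩
    have := congrArg Subtype.val (hn ⟨Q, (mem_torsionPoints_three C Q).mpr hQ⟩)
    exact this

end WeierstrassCurve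

/-! ### Galois action on four elements through S₄ -/

section FullQuartic

variable {F E : Type*} [Field F] [Field E] [Algebra F E]

lemma IntermediateField.mem_fixingSubgroup_adjoin_iff (S : Set E) (g : E ≃ₐ[F] E) :
    g ∈ (IntermediateField.adjoin F S).fixingSubgroup ↔ ∀ x ∈ S, g x = x := by
  constructor
  · exact fun h x hx => (IntermediateField.mem_fixingSubgroup_iff _ _).mp h x
      (IntermediateField.subset_adjoin F S hx)
  · intro h
    have h1 : IntermediateField.adjoin F S ≤ IntermediateField.fixedField (Subgroup.zpowers g) := by
      rw [IntermediateField.adjoin_le_iff]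
      rintro x hx ⟨τ, hτ⟩
      have : Subgroup.zpowers g ≤ MulAction.stabilizer (E ≃ₐ[F] E) x := by
        rw [Subgroup.zpowers_le]; exact h x hx
      exact this hτ
    exact (IntermediateField.le_iff_le _ _).mp h1 (Subgroup.mem_zpowers g)

variable (F) in
/-- Four distinct elements which are permuted by the Galois group, through the full symmetric
group. -/
structure FullQuartic (x : Fin 4 → E) : Prop where
  inj : Function.Injective x
  perm : ∀ g : E ≃ₐ[F] E, ∃ σ : Equiv.Perm (Fin 4), ∀ i, g (x i) = x (σ i)
  full : ∀ σ : Equiv.Perm (Fin 4), ∃ g : E ≃ₐ[F] E, ∀ i, g (x i) = x (σ i)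

lemma mem_fixingSubgroup_adjoin_range {ι : Type*} (x : ι → E) (g : E ≃ₐ[F] E) :
    g ∈ (IntermediateField.adjoin F (Set.range x)).fixingSubgroup ↔ ∀ i, g (x i) = x i := by
  rw [IntermediateField.mem_fixingSubgroup_adjoin_iff, Set.forall_mem_range]

variable {x : Fin 4 → E}

namespace FullQuartic

/-- The permutation action of the Galois group. -/
noncomputable def permHom (h : FullQuartic F x) : (E ≃ₐ[F] E) →* Equiv.Perm (Fin 4) :=
  MonoidHom.mk' (fun g => (h.perm g).choose) fun g g' => by
    ext1 i
    apply h.inj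
    rw [← (h.perm (g * g')).choose_spec i, Equiv.Perm.mul_apply, ← (h.perm g).choose_spec,
      ← (h.perm g').choose_spec]
    rfl

lemma apply_eq (h : FullQuartic F x) (g : E ≃ₐ[F] E) (i : Fin 4) :
    g (x i) = x (h.permHom g i) := (h.perm g).choose_spec i

lemma permHom_eq (h : FullQuartic F x) {g : E ≃ₐ[F] E} {σ : Equiv.Perm (Fin 4)}
    (hσ : ∀ i, g (x i) = x (σ i)) : h.permHom g = σ := by
  ext1 i
  apply h.inj
  rw [← h.apply_eq, hσ]

lemma permHom_surjective (h : FullQuartic F x) : Function.Surjective h.permHom := fun σ => by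
  obtain ⟨g, hg⟩ := h.full σ
  exact ⟨g, h.permHom_eq hg⟩

lemma ker_permHom (h : FullQuartic F x) :
    h.permHom.ker = (IntermediateField.adjoin F (Set.range x)).fixingSubgroup := by
  ext g
  rw [mem_fixingSubgroup_adjoin_range, MonoidHom.mem_ker]
  constructor
  · intro hg i
    rw [h.apply_eq, hg]; rfl
  · exact fun hg => h.permHom_eq hg

end FullQuartic

variable [IsGalois F E]

lemma IntermediateField.normal_adjoin_range
    (h : ∀ g : E ≃ₐ[F] E, ∃ σ : Equiv.Perm (Fin 4), ∀ i, g (x i) = x (σ i)) :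
    Normal F (IntermediateField.adjoin F (Set.range x)) := by
  rw [IntermediateField.normal_iff_forall_map_le']
  intro g
  rw [IntermediateField.adjoin_map]
  apply IntermediateField.adjoin.mono
  rintro _ ⟨_, ⟨i, rfl⟩, rfl⟩
  obtain ⟨σ, hσ⟩ := h g
  exact ⟨σ i, (hσ i).symm⟩

lemma FullQuartic.isGalois_and_nonempty (h : FullQuartic F x) :
    IsGalois F (IntermediateField.adjoin F (Set.range x)) ∧
    Nonempty ((IntermediateField.adjoin F (Set.range x) ≃ₐ[F]
      IntermediateField.adjoin F (Set.range x)) ≃* Equiv.Perm (Fin 4)) := by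
  have := IntermediateField.normal_adjoin_range h.perm
  refine ⟨⟨⟩, ⟨?_⟩⟩
  have e1 := QuotientGroup.quotientKerEquivOfSurjective _ h.permHom_surjective
  have e2 := QuotientGroup.quotientKerEquivOfSurjective _ (AlgEquiv.restrictNormalHom_surjective
    (F := F) (K₁ := IntermediateField.adjoin F (Set.range x)) E)
  refine e2.symm.trans ((QuotientGroup.quotientMulEquivOfEq ?_).trans e1)
  rw [IntermediateField.restrictNormalHom_ker, h.ker_permHom]

lemma IsGalois.finrank_eq_of_equiv_perm {K : IntermediateField F E} [IsGalois F K]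
    (e : (K ≃ₐ[F] K) ≃* Equiv.Perm (Fin 4)) : Module.finrank F K = 24 ∧ FiniteDimensional F K := by
  have : Finite (K ≃ₐ[F] K) := Finite.of_equiv _ e.symm.toEquiv
  have hfin : FiniteDimensional F K := IsGalois.finiteDimensional_of_finite F K
  refine ⟨?_, hfin⟩
  rw [← IsGalois.card_aut_eq_finrank, Nat.card_congr e.toEquiv, Nat.card_eq_fintype_card,
    Fintype.card_perm]
  rfl

/-- Four distinct elements, permuted by the Galois group and generating an octahedral extension. -/
lemma FullQuartic.of_equiv_perm (hinj : Function.Injective x)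
    (hperm : ∀ g : E ≃ₐ[F] E, ∃ σ : Equiv.Perm (Fin 4), ∀ i, g (x i) = x (σ i))
    {K : IntermediateField F E} (hK : IntermediateField.adjoin F (Set.range x) = K)
    (e : (K ≃ₐ[F] K) ≃* Equiv.Perm (Fin 4)) : FullQuartic F x := by
  subst hK
  have := IntermediateField.normal_adjoin_range hperm
  choose f hf using hperm
  let φ : (E ≃ₐ[F] E) →* Equiv.Perm (Fin 4) := MonoidHom.mk' f fun g g' => by
    ext1 i
    apply hinj
    rw [← hf, Equiv.Perm.mul_apply, ← hf, ← hf]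
    rfl
  have hker : (AlgEquiv.restrictNormalHom (IntermediateField.adjoin F (Set.range x))).ker = φ.ker := by
    rw [IntermediateField.restrictNormalHom_ker]
    ext g
    rw [mem_fixingSubgroup_adjoin_range, MonoidHom.mem_ker, Equiv.ext_iff]
    refine forall_congr' fun i => ?_
    rw [hf, hinj.eq_iff]; rfl
  have e2 := QuotientGroup.quotientKerEquivOfSurjective _ (AlgEquiv.restrictNormalHom_surjective
    (F := F) (K₁ := IntermediateField.adjoin F (Set.range x)) E)
  have e3 := QuotientGroup.quotientKerEquivRange φ
  have e4 : φ.range ≃* Equiv.Perm (Fin 4) :=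
    e3.symm.trans ((QuotientGroup.quotientMulEquivOfEq hker.symm).trans (e2.trans e))
  have htop : φ.range = ⊤ := by
    apply Subgroup.eq_top_of_card_eq
    exact Nat.card_congr e4.toEquiv
  refine ⟨hinj, fun g => ⟨f g, hf g⟩, fun σ => ?_⟩
  obtain ⟨g, rfl⟩ : σ ∈ φ.range := htop ▸ Subgroup.mem_top σ
  exact ⟨g, hf g⟩

/-- The commutator of two automorphisms acts trivially on quadratic extensions. -/
lemma commutator_apply_of_finrank_eq_two {k : IntermediateField F E}
    (hk : Module.finrank F k = 2) (g h : E ≃ₐ[F] E) {y : E} (hy : y ∈ k) :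
    (g * h * g⁻¹ * h⁻¹) y = y := by
  have : Algebra.IsQuadraticExtension F k := { finrank_eq_two' := hk }
  have hc : ∀ a b : k ≃ₐ[F] k, a * b = b * a := IsMulCommutative.is_comm.comm
  have h1 : AlgEquiv.restrictNormalHom k (g * h * g⁻¹ * h⁻¹) = 1 := by
    simp only [map_mul, map_inv]
    rw [hc (AlgEquiv.restrictNormalHom k g) (AlgEquiv.restrictNormalHom k h)]
    group
  have h2 : g * h * g⁻¹ * h⁻¹ ∈ k.fixingSubgroup := by
    rw [← IntermediateField.restrictNormalHom_ker]; exact h1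
  exact (IntermediateField.mem_fixingSubgroup_iff _ _).mp h2 y hy

/-- Let `τ` fix `K`. For every `g` the commutator of `g` and `τ` fixes `K`, which is normal, and
`k`, whose group is abelian. So it fixes the `x i`, and the permutation of `τ` is central in S₄,
hence trivial. The resulting inclusion is between fields of degree 24. -/
lemma FullQuartic.eq_of_sup_eq (h : FullQuartic F x)
    {k K : IntermediateField F E} (hk : Module.finrank F k = 2) [IsGalois F K]
    (e : (K ≃ₐ[F] K) ≃* Equiv.Perm (Fin 4))
    (hsup : K ⊔ k = IntermediateField.adjoin F (Set.range x) ⊔ k) :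
    K = IntermediateField.adjoin F (Set.range x) := by
  have hle : IntermediateField.adjoin F (Set.range x) ≤ K := by
    rw [← InfiniteGalois.fixedField_fixingSubgroup K, IntermediateField.le_iff_le, ← h.ker_permHom]
    intro τ hτ
    rw [MonoidHom.mem_ker]
    refine Equiv.Perm.eq_one_of_forall_commute_four _ fun σ => ?_
    obtain ⟨g, rfl⟩ := h.permHom_surjective σ
    have hfix : g * τ * g⁻¹ * τ⁻¹ ∈ (K ⊔ k).fixingSubgroup := by
      rw [IntermediateField.fixingSubgroup_sup, Subgroup.mem_inf]
      constructor
      · rw [← IntermediateField.restrictNormalHom_ker] at hτ ⊢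
        exact mul_mem (Subgroup.Normal.conj_mem inferInstance _ hτ g) (inv_mem hτ)
      · rw [IntermediateField.mem_fixingSubgroup_iff]
        exact fun y hy => commutator_apply_of_finrank_eq_two hk g τ hy
    rw [hsup, IntermediateField.fixingSubgroup_sup, Subgroup.mem_inf, ← h.ker_permHom] at hfix
    have := hfix.1
    rw [MonoidHom.mem_ker, map_mul, map_mul, map_mul, map_inv, map_inv, mul_inv_eq_one,
      mul_inv_eq_iff_eq_mul] at this
    exact this
  have h1 := IsGalois.finrank_eq_of_equiv_perm e
  obtain ⟨_, ⟨e'⟩⟩ := h.isGalois_and_nonempty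
  have h2 := IsGalois.finrank_eq_of_equiv_perm e'
  have := h1.2
  exact (IntermediateField.eq_of_le_of_finrank_eq hle (h2.1.trans h1.1.symm)).symm

/-- Two quantities on which the Galois group acts by the sign of the permutation have a rational
product. -/
lemma FullQuartic.mul_mem_range [CharZero E] {y : Fin 4 → E} (hx : FullQuartic F x)
    (hy : FullQuartic F y)
    (hxy : IntermediateField.adjoin F (Set.range x) = IntermediateField.adjoin F (Set.range y))
    {D D' : E} (hD : ∀ (g : E ≃ₐ[F] E) (σ : Equiv.Perm (Fin 4)), (∀ i, g (x i) = x (σ i)) →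
      g D = ((Equiv.Perm.sign σ : ℤ) : E) * D)
    (hD' : ∀ (g : E ≃ₐ[F] E) (σ : Equiv.Perm (Fin 4)), (∀ i, g (y i) = y (σ i)) →
      g D' = ((Equiv.Perm.sign σ : ℤ) : E) * D') : D * D' ∈ Set.range (algebraMap F E) := by
  rw [InfiniteGalois.mem_range_algebraMap_iff_fixed]
  intro g
  have hker : hx.permHom.ker = hy.permHom.ker := by rw [hx.ker_permHom, hy.ker_permHom, hxy]
  -- The permutations of `x` and of `y` may differ by an automorphism of S₄, but the sign is its
  -- only surjection onto ±1, so the two signs agree.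
  let s : Equiv.Perm (Fin 4) →* ℤˣ := hx.permHom.liftOfSurjective hx.permHom_surjective
    ⟨Equiv.Perm.sign.comp hy.permHom, fun a ha => by
      rw [hker] at ha
      rw [MonoidHom.mem_ker] at ha ⊢
      rw [MonoidHom.comp_apply, ha, map_one]⟩
  have hs : ∀ g, s (hx.permHom g) = Equiv.Perm.sign (hy.permHom g) := fun g =>
    MonoidHom.liftOfRightInverse_comp_apply _ _ _ _ g
  have hs1 : s = Equiv.Perm.sign := by
    apply Equiv.Perm.eq_sign_of_surjective_hom
    intro u
    obtain ⟨σ, hσ⟩ := Equiv.Perm.sign_surjective (Fin 4) u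
    obtain ⟨g, rfl⟩ := hy.permHom_surjective σ
    exact ⟨hx.permHom g, by rw [hs, hσ]⟩
  rw [map_mul, hD g _ (hx.apply_eq g), hD' g _ (hy.apply_eq g), ← hs, hs1]
  have h1 : ((Equiv.Perm.sign (hx.permHom g) : ℤ) : E) * ((Equiv.Perm.sign (hx.permHom g) : ℤ) : E) = 1 := by
    rw [← Int.cast_mul, ← Units.val_mul, Int.units_mul_self]; simp
  linear_combination D * D' * h1

lemma algEquiv_det_vandermonde (g : E ≃ₐ[F] E) {σ : Equiv.Perm (Fin 4)}
    (h : ∀ i, g (x i) = x (σ i)) : g (Matrix.vandermonde x).det =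
      ((Equiv.Perm.sign σ : ℤ) : E) * (Matrix.vandermonde x).det := by
  rw [← Matrix.det_permute, AlgEquiv.map_det]
  congr 1
  ext i j
  simp [Matrix.vandermonde, h]

/-- A family of conjugates generating the normal closure of a quartic extension, with a square root of
the discriminant. -/
lemma exists_conjugates [IsAlgClosed E] {ι : Type*} [Fintype ι] [DecidableEq ι] (K₁ : IntermediateField F E)
    [FiniteDimensional F K₁] (b : Module.Basis ι F K₁)
    (h4 : Module.finrank F K₁ = 4) : ∃ (y : Fin 4 → E) (D : E), Function.Injective y ∧
      IntermediateField.adjoin F (Set.range y) = IntermediateField.normalClosure F K₁ E ∧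
      (∀ g : E ≃ₐ[F] E, ∃ σ : Equiv.Perm (Fin 4), ∀ i, g (y i) = y (σ i)) ∧
      D ^ 2 = algebraMap F E (Algebra.discr F b) ∧
      ∀ (g : E ≃ₐ[F] E) (σ : Equiv.Perm (Fin 4)), (∀ i, g (y i) = y (σ i)) →
        g D = ((Equiv.Perm.sign σ : ℤ) : E) * D := by
  obtain ⟨α, hα⟩ := Field.exists_primitive_element F K₁
  have hcard : Fintype.card (K₁ →ₐ[F] E) = 4 := by rw [AlgHom.card, h4]
  have hι : Fintype.card ι = 4 := by rw [← Module.finrank_eq_card_basis b, h4]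
  let e : Fin 4 ≃ (K₁ →ₐ[F] E) := (Fintype.equivFinOfCardEq hcard).symm
  let e' : Fin 4 ≃ ι := (Fintype.equivFinOfCardEq hι).symm
  have hext : ∀ f f' : K₁ →ₐ[F] E, f α = f' α → f = f' := by
    intro f f' hff
    refine AlgHom.ext_of_adjoin_eq_top (s := {α}) ?_ (by rintro _ rfl; exact hff)
    rw [← IntermediateField.adjoin_simple_toSubalgebra_of_isAlgebraic (Algebra.IsAlgebraic.isAlgebraic α),
      hα, IntermediateField.top_toSubalgebra]
  have hinj : Function.Injective fun i => e i α := fun i j hij => e.injective (hext _ _ hij)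
  have hperm : ∀ g : E ≃ₐ[F] E, ∃ σ : Equiv.Perm (Fin 4), ∀ i, g.toAlgHom.comp (e i) = e (σ i) := by
    intro g
    refine ⟨Equiv.ofBijective (fun i => e.symm (g.toAlgHom.comp (e i))) ?_, fun i => ?_⟩
    · rw [← Finite.injective_iff_bijective]
      intro i j hij
      apply e.injective
      have := e.symm.injective hij
      ext a
      exact g.injective (DFunLike.congr_fun this a)
    · simp
  refine ⟨fun i => e i α, (Algebra.embeddingsMatrixReindex F E b (e'.symm.trans e)).det, hinj, ?_, ?_, ?_, ?_⟩
  · rw [_root_.normalClosure_def]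
    apply le_antisymm
    · rw [IntermediateField.adjoin_le_iff]
      rintro _ ⟨i, rfl⟩
      exact (le_iSup (fun f : K₁ →ₐ[F] E => f.fieldRange) (e i)) ⟨α, rfl⟩
    · refine iSup_le fun f => ?_
      rw [AlgHom.fieldRange_eq_map, ← hα, IntermediateField.adjoin_map]
      apply IntermediateField.adjoin.mono
      rintro _ ⟨_, rfl, rfl⟩
      exact ⟨e.symm f, by simp⟩
  · intro g
    obtain ⟨σ, hσ⟩ := hperm g
    exact ⟨σ, fun i => DFunLike.congr_fun (hσ i) α⟩
  · exact (Algebra.discr_eq_det_embeddingsMatrixReindex_pow_two F E b _).symm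
  · intro g σ hσ
    have hσ' : ∀ i, g.toAlgHom.comp (e i) = e (σ i) := fun i => hext _ _ (hσ i)
    rw [AlgEquiv.map_det, ← Equiv.Perm.sign_permCongr e' σ, ← Matrix.det_permute']
    congr 1
    ext i j
    have := DFunLike.congr_fun (hσ' (e'.symm j)) (b i)
    simpa [Algebra.embeddingsMatrixReindex, Algebra.embeddingsMatrix] using this

end FullQuartic

/-! ### Quartics X⁴ + bX + c: roots, discriminant and Galois group -/

section QuarticRoots

variable {E : Type*} [Field E] {x : Fin 4 → E} {b c : E}

/-- Successive divided differences of the equation at distinct roots replace a factorisation. -/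
lemma quartic_vieta (hinj : Function.Injective x) (hx : ∀ i, x i ^ 4 + b * x i + c = 0) :
    x 2 + x 3 = -(x 0 + x 1) ∧ x 2 * x 3 = (x 0 + x 1) ^ 2 - x 0 * x 1 ∧
    b = -(x 0 + x 1) * (x 0 ^ 2 + x 1 ^ 2) ∧ c = x 0 * x 1 * (x 0 ^ 2 + x 0 * x 1 + x 1 ^ 2) := by
  have hne : ∀ i j, i ≠ j → x i - x j ≠ 0 := fun i j h => sub_ne_zero.mpr (hinj.ne h)
  have h3 : ∀ i j, i ≠ j → x i ^ 3 + x i ^ 2 * x j + x i * x j ^ 2 + x j ^ 3 + b = 0 := by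
    intro i j h
    apply mul_left_cancel₀ (hne i j h)
    linear_combination hx i - hx j
  have h2 : ∀ i j l, i ≠ j → i ≠ l → j ≠ l →
      x i ^ 2 + x j ^ 2 + x l ^ 2 + x i * x j + x i * x l + x j * x l = 0 := by
    intro i j l hij hil hjl
    apply mul_left_cancel₀ (hne j l hjl)
    linear_combination h3 i j hij - h3 i l hil
  have h1 : x 0 + x 1 + x 2 + x 3 = 0 := by
    apply mul_left_cancel₀ (hne 2 3 (by decide))
    linear_combination h2 0 1 2 (by decide) (by decide) (by decide) -
      h2 0 1 3 (by decide) (by decide) (by decide)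
  have e3 := h3 0 1 (by decide)
  refine ⟨by linear_combination h1, ?_, by linear_combination e3, by
    linear_combination hx 0 - x 0 * e3⟩
  linear_combination x 2 * h1 - h2 0 1 2 (by decide) (by decide) (by decide)

lemma det_vandermonde_sq (hinj : Function.Injective x)
    (hx : ∀ i, x i ^ 4 + b * x i + c = 0) :
    (Matrix.vandermonde x).det ^ 2 = 256 * c ^ 3 - 27 * b ^ 4 := by
  obtain ⟨h1, h2, rfl, rfl⟩ := quartic_vieta hinj hx
  have e : (Matrix.vandermonde x).det = (x 1 - x 0) * ((x 2 - x 0) * (x 3 - x 0)) *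
      ((x 2 - x 1) * (x 3 - x 1)) * (x 3 - x 2) := by
    rw [Matrix.det_vandermonde]
    simp only [Fin.prod_univ_four, show Finset.Ioi (0 : Fin 4) = {1, 2, 3} by decide,
      show Finset.Ioi (1 : Fin 4) = {2, 3} by decide, show Finset.Ioi (2 : Fin 4) = {3} by decide,
      show Finset.Ioi (3 : Fin 4) = ∅ by decide]
    rw [Finset.prod_insert (by decide), Finset.prod_insert (by decide), Finset.prod_insert (by decide)]
    simp only [Finset.prod_singleton, Finset.prod_empty]
    ring
  have e0 : (x 2 - x 0) * (x 3 - x 0) = 3 * x 0 ^ 2 + 2 * x 0 * x 1 + x 1 ^ 2 := by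
    linear_combination h2 - x 0 * h1
  have e1 : (x 2 - x 1) * (x 3 - x 1) = x 0 ^ 2 + 2 * x 0 * x 1 + 3 * x 1 ^ 2 := by
    linear_combination h2 - x 1 * h1
  have e2 : (x 3 - x 2) ^ 2 = (x 0 + x 1) ^ 2 - 4 * ((x 0 + x 1) ^ 2 - x 0 * x 1) := by
    linear_combination (x 2 + x 3 - (x 0 + x 1)) * h1 - 4 * h2
  rw [e, e0, e1, mul_pow, e2]
  ring

lemma exists_eq_of_quartic (hinj : Function.Injective x) (hx : ∀ i, x i ^ 4 + b * x i + c = 0)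
    {y : E} (hy : y ^ 4 + b * y + c = 0) : ∃ i, y = x i := by
  obtain ⟨h1, h2, rfl, rfl⟩ := quartic_vieta hinj hx
  have h : (y - x 0) * ((y - x 1) * ((y - x 2) * (y - x 3))) = 0 := by
    linear_combination hy - (y - x 0) * (y - x 1) * (y * h1 - h2)
  rcases mul_eq_zero.mp h with h | h
  · exact ⟨0, sub_eq_zero.mp h⟩
  rcases mul_eq_zero.mp h with h | h
  · exact ⟨1, sub_eq_zero.mp h⟩
  rcases mul_eq_zero.mp h with h | h
  · exact ⟨2, sub_eq_zero.mp h⟩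
  · exact ⟨3, sub_eq_zero.mp h⟩

variable {F : Type*} [Field F] [Algebra F E]

lemma mem_rootSet_quartic {b c : F} {y : E} : y ∈ (X ^ 4 + C b * X + C c : F[X]).rootSet E ↔
    y ^ 4 + algebraMap F E b * y + algebraMap F E c = 0 := by
  have hm : (X ^ 4 + C b * X + C c : F[X]) ≠ 0 := by
    apply Monic.ne_zero
    monicity!
  rw [mem_rootSet_of_ne hm]
  simp

lemma ncard_rootSet_quartic_le (b c : F) : ((X ^ 4 + C b * X + C c : F[X]).rootSet E).ncard ≤ 4 := by
  refine (ncard_rootSet_le _ _).trans ?_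
  compute_degree!

/-- The Galois group of `F(S)` acts faithfully on a stable finite set `S`. -/
lemma card_algEquiv_le_factorial [IsGalois F E] {S : Set E} (hS : S.Finite)
    (hst : ∀ (g : E ≃ₐ[F] E), ∀ s ∈ S, g s ∈ S) {K : IntermediateField F E} [Normal F K]
    (hK : K = IntermediateField.adjoin F S) : Nat.card (K ≃ₐ[F] K) ≤ S.ncard.factorial := by
  classical
  have := hS.fintype
  let ψ : (K ≃ₐ[F] K) → Equiv.Perm S := fun τ =>
    Equiv.ofBijective (fun s => ⟨τ.liftNormal E s, hst _ _ s.2⟩) (by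
      rw [← Finite.injective_iff_bijective]
      intro s s' h
      exact Subtype.ext ((τ.liftNormal E).injective (congrArg Subtype.val h)))
  have hψ : Function.Injective ψ := by
    intro τ τ' h
    have h1 : (τ'.liftNormal E)⁻¹ * τ.liftNormal E ∈ K.fixingSubgroup := by
      have h0 : ∀ g : E ≃ₐ[F] E, (∀ s ∈ S, g s = s) → g ∈ K.fixingSubgroup := by
        subst hK
        exact fun g => (IntermediateField.mem_fixingSubgroup_adjoin_iff S g).mpr
      refine h0 _ fun s hs => ?_
      have h2 : τ.liftNormal E s = τ'.liftNormal E s :=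
        congrArg Subtype.val (DFunLike.congr_fun h (⟨s, hs⟩ : S))
      rw [AlgEquiv.mul_apply, h2]
      exact (τ'.liftNormal E).symm_apply_apply s
    ext y
    have h2 := (IntermediateField.mem_fixingSubgroup_iff _ _).mp h1 y y.2
    have h3 : τ.liftNormal E y = τ'.liftNormal E y := by
      rw [AlgEquiv.mul_apply] at h2
      conv_rhs => rw [← h2]
      exact ((τ'.liftNormal E).apply_symm_apply _).symm
    have h4 := τ.liftNormal_commutes E y
    have h5 := τ'.liftNormal_commutes E y
    exact h4.symm.trans (h3.trans h5)
  refine (Nat.card_le_card_of_injective ψ hψ).trans ?_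
  rw [Nat.card_eq_fintype_card, Fintype.card_perm, ← Nat.card_eq_fintype_card, Nat.card_coe_set_eq]

/-- A quartic `X⁴ + b X + c` whose splitting field is octahedral has full Galois group. -/
lemma exists_fullQuartic_of_equiv_perm [IsGalois F E] {b c : F} {K : IntermediateField F E}
    (hK : K = IntermediateField.adjoin F ((X ^ 4 + C b * X + C c : F[X]).rootSet E)) [Normal F K]
    (e : (K ≃ₐ[F] K) ≃* Equiv.Perm (Fin 4)) : ∃ x : Fin 4 → E, FullQuartic F x ∧
      K = IntermediateField.adjoin F (Set.range x) ∧
      ∀ i, x i ^ 4 + algebraMap F E b * x i + algebraMap F E c = 0 := by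
  classical
  set S := (X ^ 4 + C b * X + C c : F[X]).rootSet E with hS
  have hfin : S.Finite := rootSet_finite _ _
  have hst : ∀ (g : E ≃ₐ[F] E), ∀ s ∈ S, g s ∈ S := by
    intro g s hs
    rw [hS, mem_rootSet_quartic] at hs ⊢
    rw [← map_zero g, ← hs]
    simp
  have h1 := card_algEquiv_le_factorial hfin hst hK
  rw [Nat.card_congr e.toEquiv, Nat.card_eq_fintype_card, Fintype.card_perm, Fintype.card_fin] at h1
  -- The group of order 24 acts faithfully on the roots, so there cannot be fewer than four.
  have h2 : S.ncard = 4 := by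
    refine le_antisymm (ncard_rootSet_quartic_le b c) ?_
    by_contra h
    exact absurd (h1.trans (Nat.factorial_le (by lia : S.ncard ≤ 3))) (by decide)
  have := hfin.fintype
  have h3 : Fintype.card S = 4 := by
    rw [← Nat.card_eq_fintype_card, Nat.card_coe_set_eq, h2]
  let f : Fin 4 ≃ S := (Fintype.equivFinOfCardEq h3).symm
  have hr : Set.range (fun i => (f i : E)) = S := by
    rw [Set.range_comp' Subtype.val f, f.surjective.range_eq, Set.image_univ, Subtype.range_coe]
  have hinj : Function.Injective fun i => (f i : E) := Subtype.val_injective.comp f.injective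
  refine ⟨fun i => f i, FullQuartic.of_equiv_perm hinj (fun g => ?_) (by rw [hr]; exact hK.symm) e, by rw [hr]; exact hK,
    fun i => mem_rootSet_quartic.mp (f i).2⟩
  refine ⟨Equiv.ofBijective (fun i => f.symm ⟨g (f i), hst g _ (f i).2⟩) ?_, fun i => by rw [Equiv.ofBijective_apply, Equiv.apply_symm_apply]⟩
  rw [← Finite.injective_iff_bijective]
  intro i j hij
  have := congrArg Subtype.val (f.symm.injective hij)
  exact hinj (g.injective this)

/-- The field generated by one of the four roots. -/
lemma FullQuartic.finrank_adjoin [IsGalois F E] (h : FullQuartic F x) {p : F[X]} (hp : p.Monic)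
    (hp4 : p.natDegree = 4) (hx : ∀ i, aeval (x i) p = 0) :
    Module.finrank F (IntermediateField.adjoin F {x 0}) = 4 ∧
    IntermediateField.normalClosure F (IntermediateField.adjoin F {x 0}) E =
      IntermediateField.adjoin F (Set.range x) := by
  have htr : ∀ i, ∃ g : E ≃ₐ[F] E, g (x 0) = x i := fun i => by
    obtain ⟨g, hg⟩ := h.full (Equiv.swap 0 i)
    exact ⟨g, by rw [hg]; simp⟩
  have hint : IsIntegral F (x 0) := Algebra.IsIntegral.isIntegral _
  constructor
  · rw [IntermediateField.adjoin.finrank hint]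
    refine le_antisymm ?_ ?_
    · exact (natDegree_le_natDegree (minpoly.min F _ hp (hx 0))).trans hp4.le
    · have h1 : Set.range x ⊆ (minpoly F (x 0)).rootSet E := by
        rintro _ ⟨i, rfl⟩
        obtain ⟨g, hg⟩ := htr i
        rw [mem_rootSet_of_ne (minpoly.ne_zero hint), ← hg]
        change aeval (g.toAlgHom (x 0)) _ = 0
        rw [aeval_algHom_apply, minpoly.aeval, map_zero]
      calc 4 = (Set.range x).ncard := by
            rw [← Set.image_univ, Set.ncard_image_of_injective _ h.inj, Set.ncard_univ]; simp
        _ ≤ _ := Set.ncard_le_ncard h1 (rootSet_finite _ _)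
        _ ≤ _ := ncard_rootSet_le _ _
  · rw [IntermediateField.normalClosure_def'']
    apply le_antisymm
    · refine iSup_le fun g => ?_
      rw [IntermediateField.adjoin_map]
      apply IntermediateField.adjoin.mono
      rintro _ ⟨_, rfl, rfl⟩
      exact ⟨_, (h.apply_eq g 0).symm⟩
    · rw [IntermediateField.adjoin_le_iff]
      rintro _ ⟨i, rfl⟩
      obtain ⟨g, hg⟩ := htr i
      refine (le_iSup (fun g : E ≃ₐ[F] E =>
        (IntermediateField.adjoin F {x 0}).map (g : E →ₐ[F] E)) g) ?_
      exact ⟨x 0, IntermediateField.mem_adjoin_simple_self F _, hg⟩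

end QuarticRoots

/-! ### From the 3-division polynomial to z⁴ + tz + t -/

section QuarticCoord

variable {E : Type*} [Field E]

/-- A cubic transformation carrying the 3-division polynomial of `y² = x³ + 4x² + 2(1 + s)x` to a
quartic of the form `z⁴ + t z + t`. -/
def quarticCoord (s x : E) : E :=
  (4 * (s + 1) - 2 * (9 * s - 7) * x - 10 * x ^ 2 - 3 * x ^ 3) / (6 * (s ^ 2 - 1))

variable [CharZero E] {s x y : E}

lemma quarticCoord_root (hs : s ^ 2 ≠ 1)
    (hx : 3 * x ^ 4 + 16 * x ^ 3 + 12 * (1 + s) * x ^ 2 - 4 * (1 + s) ^ 2 = 0) :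
    quarticCoord s x ^ 4 + 256 / (27 * (1 - s ^ 2)) * quarticCoord s x +
      256 / (27 * (1 - s ^ 2)) = 0 := by
  have hs' : s ^ 2 - 1 ≠ 0 := sub_ne_zero.mpr hs
  have hs'' : 1 - s ^ 2 ≠ 0 := sub_ne_zero.mpr hs.symm
  have e : quarticCoord s x * (6 * (s ^ 2 - 1)) =
      4 * (s + 1) - 2 * (9 * s - 7) * x - 10 * x ^ 2 - 3 * x ^ 3 :=
    div_mul_cancel₀ _ (mul_ne_zero (by norm_num) hs')
  set N := 4 * (s + 1) - 2 * (9 * s - 7) * x - 10 * x ^ 2 - 3 * x ^ 3 with hN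
  -- The quartic in `z` with the denominator 6(s² - 1) cleared. The cofactor comes from polynomial
  -- division by the 3-division polynomial.
  have key : N ^ 4 - 2048 * (s ^ 2 - 1) ^ 2 * N - 12288 * (s ^ 2 - 1) ^ 3 = 0 := by
    rw [hN]
    linear_combination (((-1088) + (3968)*s + (-2112)*s^2 + (-4096)*s^3 + (3072)*s^4) +
      ((6272) + (-23296)*s + (26752)*s^2 + (-9216)*s^3)*x + ((-12448) + (38144)*s +
      (-34400)*s^2 + (9216)*s^3)*x^2 + ((8864) + (-16192)*s + (6432)*s^2)*x^3 + ((460) +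
      (-4968)*s + (3708)*s^2)*x^4 + ((-2240) + (2592)*s)*x^5 + ((36) + (540)*s)*x^6 +
      ((216))*x^7 + ((27))*x^8) * hx
  set z := quarticCoord s x
  have h1 : (1296 * (s ^ 2 - 1) ^ 4) * (z ^ 4 + 256 / (27 * (1 - s ^ 2)) * z +
      256 / (27 * (1 - s ^ 2))) = 0 := by
    have e2 : 256 / (27 * (1 - s ^ 2)) * (s ^ 2 - 1) = -(256 / 27) := by
      field_simp
      ring
    rw [← e] at key
    linear_combination key + 1296 * (s ^ 2 - 1) ^ 3 * (z + 1) * e2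
  exact (mul_eq_zero.mp h1).resolve_left (mul_ne_zero (by norm_num) (pow_ne_zero _ hs'))

lemma quarticCoord_inj (hs : s ^ 2 ≠ 1) (hs0 : s ≠ 0)
    (hx : 3 * x ^ 4 + 16 * x ^ 3 + 12 * (1 + s) * x ^ 2 - 4 * (1 + s) ^ 2 = 0)
    (hy : 3 * y ^ 4 + 16 * y ^ 3 + 12 * (1 + s) * y ^ 2 - 4 * (1 + s) ^ 2 = 0)
    (h : quarticCoord s x = quarticCoord s y) : x = y := by
  have hs' : s ^ 2 - 1 ≠ 0 := sub_ne_zero.mpr hs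
  -- The inverse transformation: modulo the quartic, `x` is a cubic polynomial in `z` once `s` and
  -- `s² - 1` are inverted.
  have inv : ∀ x : E, 3 * x ^ 4 + 16 * x ^ 3 + 12 * (1 + s) * x ^ 2 - 4 * (1 + s) ^ 2 = 0 →
      1536 * s * (s ^ 2 - 1) ^ 2 * x = 1536 * (s ^ 2 - 1) ^ 2 * (3 - 7 / 3 * s) -
        192 * (s ^ 2 - 1) ^ 2 * (6 * (s ^ 2 - 1) * quarticCoord s x) +
        24 * (s ^ 2 - 1) * (6 * (s ^ 2 - 1) * quarticCoord s x) ^ 2 +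
        (s - 3) * (6 * (s ^ 2 - 1) * quarticCoord s x) ^ 3 := by
    intro x hx
    have e : 6 * (s ^ 2 - 1) * quarticCoord s x =
        4 * (s + 1) - 2 * (9 * s - 7) * x - 10 * x ^ 2 - 3 * x ^ 3 :=
      mul_div_cancel₀ _ (mul_ne_zero (by norm_num) hs')
    rw [e]
    linear_combination (-1536) * (((-17/32) + (95/48)*s + (-203/96)*s^2 + (17/24)*s^3) +
      ((77/64) + (-87/32)*s + (113/64)*s^2 + (-5/16)*s^3)*x + ((-69/128) + (9/16)*s +
      (-11/128)*s^2)*x^2 + ((-43/256) + (29/96)*s + (-21/256)*s^2)*x^3 + ((21/256) +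
      (-7/256)*s)*x^4 + ((9/512) + (-3/512)*s)*x^5) * hx
  have h1 : 1536 * s * (s ^ 2 - 1) ^ 2 * x = 1536 * s * (s ^ 2 - 1) ^ 2 * y := by
    rw [inv x hx, inv y hy, h]
  exact mul_left_cancel₀ (mul_ne_zero (mul_ne_zero (by norm_num) hs0) (pow_ne_zero _ hs')) h1

/-- In the variable `12x + b₂` the equation involves only `c₄` and `c₆`, so it can be compared
between twists. -/
lemma WeierstrassCurve.Ψ₃_root_short {W : WeierstrassCurve E} (hx : W.Ψ₃.eval x = 0) :
    (12 * x + W.b₂) ^ 4 - 6 * W.c₄ * (12 * x + W.b₂) ^ 2 - 8 * W.c₆ * (12 * x + W.b₂) -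
      3 * W.c₄ ^ 2 = 0 := by
  rw [eval_Ψ₃] at hx
  rw [c₄, c₆]
  linear_combination 6912 * hx - 1728 * W.b_relation

end QuarticCoord

lemma WeierstrassCurve.c₄_c₆_of_j_eq {E : Type*} [Field E] {W W' : WeierstrassCurve E}
    [W.IsElliptic] [W'.IsElliptic] (h : W.j = W'.j) :
    W.c₄ ^ 3 * W'.c₆ ^ 2 = W'.c₄ ^ 3 * W.c₆ ^ 2 := by
  have hj : ∀ (V : WeierstrassCurve E) [V.IsElliptic], V.j * V.Δ = V.c₄ ^ 3 := by
    intro V _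
    rw [WeierstrassCurve.j, mul_right_comm, ← coe_Δ', Units.inv_mul, one_mul]
  have e1 := hj W
  have e2 := hj W'
  have r1 := W.c_relation
  have r2 := W'.c_relation
  rw [h] at e1
  linear_combination 1728 * W'.Δ * e1 - 1728 * W.Δ * e2 + W.c₄ ^ 3 * r2 - W'.c₄ ^ 3 * r1

/-- If `C` has the `j`-invariant of `y² = x³ + 4x² + 2(1 + s)x`, then its 3-division polynomial is
transformed to `z⁴ + t z + t`, where `27 (1 - s²) t = 256`. -/
theorem WeierstrassCurve.exists_quartic_map {k E : Type*} [Field k] [Field E] [CharZero k] [CharZero E]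
    (f : k →+* E) (C : WeierstrassCurve k) {s : k}
    (hs0 : s ≠ 0) (hs1 : s ^ 2 ≠ 1) (h4 : C.c₄ ≠ 0) (h6 : C.c₆ ≠ 0)
    (hJ : (32 * (5 - 3 * s)) ^ 3 * C.c₆ ^ 2 = C.c₄ ^ 3 * (256 * (9 * s - 7)) ^ 2) :
    ∃ Φ : E → E, (∀ x, (C.map f).Ψ₃.eval x = 0 → Φ x ^ 4 + f (256 / (27 * (1 - s ^ 2))) * Φ x +
        f (256 / (27 * (1 - s ^ 2))) = 0) ∧
      (∀ x y, (C.map f).Ψ₃.eval x = 0 → (C.map f).Ψ₃.eval y = 0 → Φ x = Φ y → x = y) ∧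
      ∀ g : E →+* E, (∀ a, g (f a) = f a) → ∀ x, g (Φ x) = Φ (g x) := by
  have h5 : 5 - 3 * s ≠ 0 := by
    intro h
    rw [h] at hJ
    have h1 : C.c₄ ^ 3 * (256 * (9 * s - 7)) ^ 2 = 0 := by rw [← hJ]; ring
    have h2 : 9 * s - 7 = 0 := by simpa [h4] using h1
    have h3 : (8 : k) = 0 := by linear_combination h2 + 3 * h
    norm_num at h3
  have h9 : 9 * s - 7 ≠ 0 := by
    intro h
    rw [h] at hJ
    have h1 : (32 * (5 - 3 * s)) ^ 3 * C.c₆ ^ 2 = 0 := by rw [hJ]; ring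
    simp [h6, h5] at h1
  -- `l` is the twisting factor from `C` to the model, whose invariants are `c₄ = 32(5 - 3s)` and
  -- `c₆ = 256(9s - 7)`. It lies in `k`, so the transformation stays defined over `k` whatever the
  -- twist.
  obtain ⟨l, hl⟩ : ∃ l : k, l * (32 * (5 - 3 * s) * C.c₆) = 256 * (9 * s - 7) * C.c₄ :=
    ⟨_, div_mul_cancel₀ _ (by simp [h5, h6])⟩
  have hl2 : l ^ 2 * C.c₄ = 32 * (5 - 3 * s) := by
    apply mul_right_cancel₀ (pow_ne_zero 2 (mul_ne_zero (mul_ne_zero (by norm_num : (32 : k) ≠ 0) h5) h6))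
    linear_combination (l * (32 * (5 - 3 * s) * C.c₆) + 256 * (9 * s - 7) * C.c₄) * C.c₄ * hl - hJ
  have hl3 : l ^ 3 * C.c₆ = 256 * (9 * s - 7) := by
    apply mul_right_cancel₀ h4
    linear_combination hl + l * C.c₆ * hl2
  have hl0 : f l ≠ 0 := by
    rw [Ne, map_eq_zero]
    rintro rfl
    exact h5 (by linear_combination (-1/32) * hl2)
  have hroot : ∀ x, (C.map f).Ψ₃.eval x = 0 → ∀ y, 12 * y + 16 = f l * (12 * x + f C.b₂) →
      3 * y ^ 4 + 16 * y ^ 3 + 12 * (1 + f s) * y ^ 2 - 4 * (1 + f s) ^ 2 = 0 := by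
    intro x hx y e
    have h := Ψ₃_root_short hx
    rw [map_b₂, map_c₄, map_c₆] at h
    have hl2' : f l ^ 2 * f C.c₄ = 32 * (5 - 3 * f s) := by
      simpa [map_ofNat] using congrArg f hl2
    have hl3' : f l ^ 3 * f C.c₆ = 256 * (9 * f s - 7) := by
      simpa [map_ofNat] using congrArg f hl3
    have h' : (12 * y + 16) ^ 4 - 6 * (32 * (5 - 3 * f s)) * (12 * y + 16) ^ 2 -
        8 * (256 * (9 * f s - 7)) * (12 * y + 16) - 3 * (32 * (5 - 3 * f s)) ^ 2 = 0 := by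
      rw [e, ← hl2', ← hl3']
      linear_combination f l ^ 4 * h
    linear_combination (1 / 6912) * h'
  have hfs0 : f s ≠ 0 := by simpa using hs0
  have hfs1 : f s ^ 2 ≠ 1 := by
    rw [← map_pow, ← map_one f]
    exact f.injective.ne hs1
  have hxe : ∀ x, 12 * ((f l * (12 * x + f C.b₂) - 16) / 12) + 16 = f l * (12 * x + f C.b₂) := by
    intro x; ring
  refine ⟨fun x => quarticCoord (f s) ((f l * (12 * x + f C.b₂) - 16) / 12), fun x hx => ?_,
    fun x y hx hy h => ?_, fun g hg x => ?_⟩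
  · simpa [map_ofNat] using quarticCoord_root hfs1 (hroot x hx _ (hxe x))
  · have := quarticCoord_inj hfs1 hfs0 (hroot x hx _ (hxe x)) (hroot y hy _ (hxe y)) h
    apply mul_left_cancel₀ hl0
    linear_combination this
  · simp [quarticCoord, hg, map_ofNat]

/-! ### The projective 3-torsion field as a compositum with k -/

instance : IsGalois ℚ ℚbar :=
  have : Algebra.IsAlgebraic ℚ ℚbar := AlgebraicClosure.isAlgebraic ℚ
  have : IsAlgClosure ℚ ℚbar := ⟨inferInstance, inferInstance⟩
  have : Normal ℚ ℚbar := IsAlgClosure.normal ℚ ℚbar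
  ⟨⟩

instance (k : IntermediateField ℚ ℚbar) : IsGalois k ℚbar := IsGalois.tower_top_of_isGalois ℚ k ℚbar

namespace WeierstrassCurve

open scoped Classical

variable {k : IntermediateField ℚ ℚbar} {C : WeierstrassCurve k} [C.IsElliptic]
  {P : Fin 4 → torsionPoints C 3} {s : k}

theorem exists_quartic_roots
    (hP : ∀ i, (C⁄ℚbar).Ψ₃.eval (xc (P i : (C⁄ℚbar).toAffine.Point)) = 0)
    (hinj : Function.Injective fun i => xc (P i : (C⁄ℚbar).toAffine.Point))
    (hs0 : s ≠ 0) (hs1 : s ^ 2 ≠ 1) (h4 : C.c₄ ≠ 0) (h6 : C.c₆ ≠ 0)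
    (hJ : (32 * (5 - 3 * s)) ^ 3 * C.c₆ ^ 2 = C.c₄ ^ 3 * (256 * (9 * s - 7)) ^ 2) :
    ∃ z : Fin 4 → ℚbar, Function.Injective z ∧
      (∀ i, z i ^ 4 + algebraMap k ℚbar (256 / (27 * (1 - s ^ 2))) * z i +
        algebraMap k ℚbar (256 / (27 * (1 - s ^ 2))) = 0) ∧
      ∀ (g : ℚbar ≃ₐ[k] ℚbar) (i j : Fin 4), g (z i) = z j ↔
        g (xc (P i : (C⁄ℚbar).toAffine.Point)) = xc (P j : (C⁄ℚbar).toAffine.Point) := by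
  obtain ⟨Φ, h1, h2, h3⟩ := exists_quartic_map (algebraMap k ℚbar) C hs0 hs1 h4 h6 hJ
  refine ⟨fun i => Φ (xc (P i : (C⁄ℚbar).toAffine.Point)), fun i j hij => hinj (h2 _ _ (hP i) (hP j) hij),
    fun i => h1 _ (hP i), fun g i j => ?_⟩
  have hg : g (Φ (xc (P i : (C⁄ℚbar).toAffine.Point))) = Φ (g (xc (P i : (C⁄ℚbar).toAffine.Point))) :=
    h3 (g : ℚbar →+* ℚbar) (fun a => g.commutes a) _
  rw [hg]
  refine ⟨h2 _ _ ?_ (hP j), fun h => by rw [h]⟩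
  have h := hP i
  rw [eval_Ψ₃] at h ⊢
  have h' := congrArg (g : ℚbar →+* ℚbar) h
  have hb : ∀ a : k, (g : ℚbar →+* ℚbar) (algebraMap k ℚbar a) = algebraMap k ℚbar a := g.commutes
  have e2 : (C⁄ℚbar).b₂ = algebraMap k ℚbar C.b₂ := C.map_b₂ _
  have e4 : (C⁄ℚbar).b₄ = algebraMap k ℚbar C.b₄ := C.map_b₄ _
  have e6 : (C⁄ℚbar).b₆ = algebraMap k ℚbar C.b₆ := C.map_b₆ _
  have e8 : (C⁄ℚbar).b₈ = algebraMap k ℚbar C.b₈ := C.map_b₈ _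
  rw [e2, e4, e6, e8] at h'
  change _ + (C⁄ℚbar).b₂ * _ + 3 * (C⁄ℚbar).b₄ * _ + 3 * (C⁄ℚbar).b₆ * _ + (C⁄ℚbar).b₈ = 0
  rw [e2, e4, e6, e8]
  simp only [map_add, map_mul, map_pow, hb, map_zero, map_ofNat] at h'
  exact h'

end WeierstrassCurve

lemma FullQuartic.isOctahedral {x : Fin 4 → ℚbar} (h : FullQuartic ℚ x) :
    IsOctahedral (IntermediateField.adjoin ℚ (Set.range x)) :=
  h.isGalois_and_nonempty

lemma FullQuartic.eq_of_isOctahedral {x : Fin 4 → ℚbar} (h : FullQuartic ℚ x)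
    {k K : IntermediateField ℚ ℚbar} (hk : Module.finrank ℚ k = 2) (hK : IsOctahedral K)
    (hsup : K ⊔ k = IntermediateField.adjoin ℚ (Set.range x) ⊔ k) :
    K = IntermediateField.adjoin ℚ (Set.range x) := by
  obtain ⟨hK1, ⟨e⟩⟩ := hK
  have : @IsGalois ℚ _ K _ K.algebra' := hK1
  exact FullQuartic.eq_of_sup_eq (F := ℚ) h hk e hsup

lemma exists_perm_of_quartic {F E : Type*} [Field F] [Field E] [Algebra F E] {x : Fin 4 → E}
    {b c : F} (hinj : Function.Injective x)
    (hx : ∀ i, x i ^ 4 + algebraMap F E b * x i + algebraMap F E c = 0) (g : E ≃ₐ[F] E) :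
    ∃ σ : Equiv.Perm (Fin 4), ∀ i, g (x i) = x (σ i) := by
  have h : ∀ i, ∃ j, g (x i) = x j := fun i => by
    refine exists_eq_of_quartic hinj hx ?_
    have := congrArg g (hx i)
    simpa using this
  choose f hf using h
  refine ⟨Equiv.ofBijective f ?_, hf⟩
  rw [← Finite.injective_iff_bijective]
  intro i j hij
  apply hinj
  apply g.injective
  rw [hf, hf, hij]

lemma exists_perm_eq_of_quartic {E : Type*} [Field E] {x y : Fin 4 → E}
    {b c : E} (hinj : Function.Injective x) (hx : ∀ i, x i ^ 4 + b * x i + c = 0)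
    (hinj' : Function.Injective y) (hy : ∀ i, y i ^ 4 + b * y i + c = 0) :
    ∃ σ : Equiv.Perm (Fin 4), ∀ i, y i = x (σ i) := by
  choose f hf using fun i => exists_eq_of_quartic hinj hx (hy i)
  refine ⟨Equiv.ofBijective f ?_, hf⟩
  rw [← Finite.injective_iff_bijective]
  intro i j hij
  apply hinj'
  rw [hf, hf, hij]

namespace WeierstrassCurve

open scoped Classical

variable {k : IntermediateField ℚ ℚbar} {C : WeierstrassCurve k} [C.IsElliptic] {s : k} {δ : ℚ}

/-- The quartic depends on `s` through `s² = δ` only and is therefore rational, although the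
transformation from the division polynomial needs `s`. Elements of Gal(ℚbar/k) permute the `z i` as
they permute the four lines. -/
theorem exists_rational_quartic_roots (hs : s ^ 2 = algebraMap ℚ k δ) (hδ0 : δ ≠ 0) (hδ1 : δ ≠ 1)
    (h4 : C.c₄ ≠ 0) (h6 : C.c₆ ≠ 0)
    (hJ : (32 * (5 - 3 * s)) ^ 3 * C.c₆ ^ 2 = C.c₄ ^ 3 * (256 * (9 * s - 7)) ^ 2) :
    ∃ z : Fin 4 → ℚbar, Function.Injective z ∧
      (∀ i, z i ^ 4 + algebraMap ℚ ℚbar (256 / (27 * (1 - δ))) * z i +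
        algebraMap ℚ ℚbar (256 / (27 * (1 - δ))) = 0) ∧
      IntermediateField.restrictScalars ℚ (projectiveTorsionField C 3) =
        IntermediateField.adjoin ℚ (Set.range z) ⊔ k ∧
      (Function.Surjective (torsionRep C 3) ↔ ∀ σ : Equiv.Perm (Fin 4), ∃ g : ℚbar ≃ₐ[k] ℚbar,
        ∀ i, g (z i) = z (σ i)) := by
  have hs0 : s ≠ 0 := by
    rintro rfl
    apply hδ0
    apply (algebraMap ℚ k).injective
    rw [← hs, map_zero]; ring
  have hs1 : s ^ 2 ≠ 1 := by
    rw [hs, ← map_one (algebraMap ℚ k)]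
    exact (algebraMap ℚ k).injective.ne hδ1
  obtain ⟨P, hP, hΨ, hinj⟩ := exists_lineSystem C
  obtain ⟨z, hz, hroot, hg⟩ := exists_quartic_roots hΨ hinj hs0 hs1 h4 h6 hJ
  have hcoef : algebraMap k ℚbar (256 / (27 * (1 - s ^ 2))) =
      algebraMap ℚ ℚbar (256 / (27 * (1 - δ))) := by
    rw [hs, eq_ratCast, eq_ratCast]
    have : (256 / (27 * (1 - ((δ : ℚ) : k)))) = ((256 / (27 * (1 - δ)) : ℚ) : k) := by push_cast; rfl
    rw [this, map_ratCast]
  rw [hcoef] at hroot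
  refine ⟨z, hz, hroot, ?_, ?_⟩
  · have hker : (projectiveTorsionRep C 3).ker =
        (IntermediateField.adjoin k (Set.range z)).fixingSubgroup := by
      ext g
      rw [mem_ker_projectiveTorsionRep_iff hP, mem_fixingSubgroup_adjoin_range]
      exact forall_congr' fun i => (hg g i i).symm
    rw [projectiveTorsionField, hker, InfiniteGalois.fixedField_fixingSubgroup, sup_comm]
    exact IntermediateField.restrictScalars_adjoin_eq_sup ℚ k (Set.range z)
  · rw [torsionRep_surjective_iff hP]
    exact forall_congr' fun σ => exists_congr fun g => forall_congr' fun i => (hg g i (σ i)).symm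

lemma fullQuartic_of_surjective {b c : ℚ} {z : Fin 4 → ℚbar} (hz : Function.Injective z)
    (hroot : ∀ i, z i ^ 4 + algebraMap ℚ ℚbar b * z i + algebraMap ℚ ℚbar c = 0)
    (h : ∀ σ : Equiv.Perm (Fin 4), ∃ g : ℚbar ≃ₐ[k] ℚbar, ∀ i, g (z i) = z (σ i)) :
    FullQuartic ℚ z := by
  refine ⟨hz, exists_perm_of_quartic hz hroot, fun σ => ?_⟩
  obtain ⟨g, hg⟩ := h σ
  exact ⟨g.restrictScalars ℚ, hg⟩

lemma isOctahedralFieldOf_of_fullQuartic {z : Fin 4 → ℚbar} (hz : FullQuartic ℚ z)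
    (hk : Module.finrank ℚ k = 2)
    (h : IntermediateField.restrictScalars ℚ (projectiveTorsionField C 3) =
        IntermediateField.adjoin ℚ (Set.range z) ⊔ k) :
    IsOctahedralFieldOf C (IntermediateField.adjoin ℚ (Set.range z)) ∧
    ∀ K' : IntermediateField ℚ ℚbar, IsOctahedralFieldOf C K' →
      K' = IntermediateField.adjoin ℚ (Set.range z) :=
  ⟨⟨hz.isOctahedral, h.symm⟩, fun _ hK' => hz.eq_of_isOctahedral hk hK'.1 (hK'.2.trans h)⟩

end WeierstrassCurve

/-- The square class of the discriminant of a quartic field with octahedral Galois closure. -/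
lemma exists_discr_mul_eq_sq {K₁ : IntermediateField ℚ ℚbar} [NumberField K₁]
    (hK₁ : Module.finrank ℚ K₁ = 4) {z : Fin 4 → ℚbar} (hz : FullQuartic ℚ z)
    (hK : galoisClosure K₁ = IntermediateField.adjoin ℚ (Set.range z)) {b c : ℚ}
    (hroot : ∀ i, z i ^ 4 + algebraMap ℚ ℚbar b * z i + algebraMap ℚ ℚbar c = 0) :
    ∃ q : ℚ, (NumberField.discr K₁ : ℚ) * (256 * c ^ 3 - 27 * b ^ 4) = q ^ 2 := by
  classical
  obtain ⟨y, D, hinj, hadj, hperm, hD, hsign⟩ :=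
    exists_conjugates (F := ℚ) (E := ℚbar) K₁ (NumberField.integralBasis K₁) hK₁
  obtain ⟨_, ⟨e⟩⟩ := hz.isGalois_and_nonempty
  have hy : FullQuartic ℚ y := FullQuartic.of_equiv_perm hinj hperm (hadj.trans hK) e
  -- Square roots of both discriminants change by the same sign under Galois, so their product is
  -- rational.
  obtain ⟨q, hq⟩ := hy.mul_mem_range hz (hadj.trans hK) hsign
    (fun g σ h => algEquiv_det_vandermonde g h)
  refine ⟨q, (algebraMap ℚ ℚbar).injective ?_⟩
  have hΔ := det_vandermonde_sq hz.inj hroot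
  have hd : (NumberField.discr K₁ : ℚ) = Algebra.discr ℚ (NumberField.integralBasis K₁) :=
    NumberField.coe_discr K₁
  have hD' : D ^ 2 = algebraMap ℚ ℚbar (NumberField.discr K₁ : ℚ) := by
    rw [hd]; exact hD
  rw [map_pow, hq, mul_pow, hΔ, hD', map_mul]
  simp

/-- The field generated by a root of `z⁴ + b z + c` is a principal quartic. -/
lemma exists_isPrincipalQuartic {z : Fin 4 → ℚbar} (hz : FullQuartic ℚ z) {b c : ℚ}
    (hroot : ∀ i, z i ^ 4 + algebraMap ℚ ℚbar b * z i + algebraMap ℚ ℚbar c = 0) :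
    ∃ (K₁ : IntermediateField ℚ ℚbar) (_ : NumberField K₁), IsPrincipalQuartic K₁ ∧
      galoisClosure K₁ = IntermediateField.adjoin ℚ (Set.range z) ∧
      ∃ q : ℚ, (NumberField.discr K₁ : ℚ) * (256 * c ^ 3 - 27 * b ^ 4) = q ^ 2 := by
  have h := hz.finrank_adjoin (p := X ^ 4 + C b * X + C c) (by monicity!) (by compute_degree!)
    (fun i => by simpa using hroot i)
  have h4 : Module.finrank ℚ (IntermediateField.adjoin ℚ {z 0}) = 4 := h.1
  have hcl : galoisClosure (IntermediateField.adjoin ℚ {z 0}) =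
      IntermediateField.adjoin ℚ (Set.range z) := h.2
  have hfin : FiniteDimensional ℚ (IntermediateField.adjoin ℚ {z 0}) :=
    Module.finite_of_finrank_pos (by rw [h4]; norm_num)
  have hn : NumberField (IntermediateField.adjoin ℚ {z 0}) := ⟨⟩
  refine ⟨_, hn, ⟨h4, b, c, ?_⟩, hcl, exists_discr_mul_eq_sq h4 hz hcl hroot⟩
  rw [hcl]
  congr 1
  ext y
  rw [mem_rootSet_quartic]
  constructor
  · rintro ⟨i, rfl⟩
    exact hroot i
  · intro hy
    obtain ⟨i, rfl⟩ := exists_eq_of_quartic hz.inj hroot hy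
    exact ⟨i, rfl⟩

/-! ### The parameter s of a ℚ-curve of degree 2 -/

namespace WeierstrassCurve

section

variable {E : Type*} [Field E]

lemma j_congr {W W' : WeierstrassCurve E} [W.IsElliptic] [W'.IsElliptic] (h : W = W') :
    W.j = W'.j := by
  subst h; rfl

lemma twoCurve_map {E' : Type*} [Field E'] (τ : E →+* E') (a b : E) :
    (twoCurve a b).map τ = twoCurve (τ a) (τ b) := by
  simp [twoCurve, WeierstrassCurve.map]

variable [CharZero E] [IsAlgClosed E] [DecidableEq E] {r : E} [(twoCurve 1 r).IsElliptic]
  [(twoCurve 1 (1 / 4 - r)).IsElliptic]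

lemma isElliptic_twoCurve_map (τ : E →+* E) : (twoCurve 1 (τ r)).IsElliptic := by
  have : (twoCurve 1 (τ r)) = (twoCurve 1 r).map τ := by rw [twoCurve_map, map_one]
  rw [this]
  infer_instance

lemma j_twoCurve_map (τ : E →+* E) [(twoCurve 1 (τ r)).IsElliptic] :
    (twoCurve 1 (τ r)).j = τ (twoCurve 1 r).j := by
  rw [← map_j]
  exact j_congr (by rw [twoCurve_map, map_one])

lemma map_dual (τ : E →+* E) (r : E) : τ (1 / 4 - r) = 1 / 4 - τ r := by
  simp [map_ofNat]

/-- An automorphism exchanging the `j`-invariants of two 2-isogenous curves without complex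
multiplication exchanges the two isogenies. -/
lemma apply_eq_dual_of_j (h : NonCM (twoCurve 1 r)) (τ : E →+* E)
    (h1 : τ (twoCurve 1 r).j = (twoCurve 1 (1 / 4 - r)).j)
    (h2 : τ (twoCurve 1 (1 / 4 - r)).j = (twoCurve 1 r).j) : τ r = 1 / 4 - r := by
  have := isElliptic_twoCurve_map (r := r) τ
  have hd : (twoCurve 1 (τ (1 / 4 - r))).IsElliptic :=
    have : (twoCurve 1 (1 / 4 - (1 / 4 - r))).IsElliptic := by rwa [sub_sub_cancel]
    isElliptic_twoCurve_map (r := 1 / 4 - r) τ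
  have hd' : (twoCurve 1 (1 / 4 - τ r)).IsElliptic := by rwa [← map_dual]
  refine eq_of_j_eq_of_nonCM h ((j_twoCurve_map τ).trans h1) ?_
  rw [← h2, ← map_j]
  exact j_congr (by rw [twoCurve_map, map_one, map_dual])

/-- The uniqueness statement `eq_of_j_eq_of_nonCM` is applied to the dual parameter `1/4 - τ r`. -/
lemma apply_eq_self_of_j (h : NonCM (twoCurve 1 r)) (τ : E →+* E)
    (h1 : τ (twoCurve 1 r).j = (twoCurve 1 r).j)
    (h2 : τ (twoCurve 1 (1 / 4 - r)).j = (twoCurve 1 (1 / 4 - r)).j) : τ r = r := by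
  have := isElliptic_twoCurve_map (r := r) τ
  have hd : (twoCurve 1 (τ (1 / 4 - r))).IsElliptic :=
    have : (twoCurve 1 (1 / 4 - (1 / 4 - r))).IsElliptic := by rwa [sub_sub_cancel]
    isElliptic_twoCurve_map (r := 1 / 4 - r) τ
  have hd' : (twoCurve 1 (1 / 4 - τ r)).IsElliptic := by rwa [← map_dual]
  have hd'' : (twoCurve 1 (1 / 4 - (1 / 4 - τ r))).IsElliptic := by rwa [sub_sub_cancel]
  have key : 1 / 4 - τ r = 1 / 4 - r := by
    refine eq_of_j_eq_of_nonCM h ?_ ?_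
    · rw [← h2, ← map_j]
      exact j_congr (by rw [twoCurve_map, map_one, map_dual])
    · rw [← h1, ← j_twoCurve_map]
      exact j_congr (by rw [sub_sub_cancel])
  linear_combination -key

end

/-- The isogeny class of a curve with a cyclic isogeny of degree 2. -/
lemma exists_parameter {E : Type*} [Field E] [CharZero E] [IsAlgClosed E] [DecidableEq E]
    {W W' : WeierstrassCurve E} [W.IsElliptic] [W'.IsElliptic] (hj : W.j ≠ 1728) (hW : NonCM W)
    {φ : W.toAffine.Point →+ W'.toAffine.Point} (hφ : IsIsogenyOfDegree φ 2) :
    ∃ (r : E) (_ : (twoCurve 1 r).IsElliptic) (_ : (twoCurve 1 (1 / 4 - r)).IsElliptic),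
      (twoCurve 1 r).j = W.j ∧ (twoCurve 1 (1 / 4 - r)).j = W'.j ∧ NonCM (twoCurve 1 r) := by
  obtain ⟨h1, h2⟩ := hφ
  have hcard : 1 < Nat.card φ.ker := by rw [h2]; norm_num
  have : Finite φ.ker := Nat.finite_of_card_ne_zero (by rw [h2]; norm_num)
  have : Nontrivial φ.ker := Finite.one_lt_card_iff_nontrivial.mp hcard
  obtain ⟨⟨T, hT⟩, hT0⟩ := exists_ne (0 : φ.ker)
  have hT0' : T ≠ 0 := fun h => hT0 (Subtype.ext h)
  have hT2 : T + T = 0 := by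
    have := card_nsmul_eq_zero' (x := (⟨T, hT⟩ : φ.ker))
    rw [h2, two_nsmul] at this
    exact congrArg Subtype.val this
  obtain ⟨r, hr, hjr, ι, i1, i2, hι⟩ := exists_equiv_twoCurve hj hT0' hT2
  have hr' := isElliptic_twoCurve_dual r
  refine ⟨r, hr, hr', hjr, ?_, nonCM_of_equiv ι i1 i2 hW⟩
  refine (j_eq_of_ker_eq (h1.comp i2) ?_ ?_).symm
  · rw [← h2]
    refine Nat.card_congr (Equiv.subtypeEquiv ι.symm.toEquiv fun P => ?_)
    rfl
  · rw [← hι]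
    change φ (ι.symm (ι T)) = 0
    rw [ι.symm_apply_apply]
    exact hT

end WeierstrassCurve

lemma forall_apply_eq_or {F E : Type*} [Field F] [Field E] [Algebra F E] [IsGalois F E]
    {k : IntermediateField F E} (hk : Module.finrank F k = 2) {σ : k ≃ₐ[F] k} (hσ : σ ≠ 1) :
    (∀ y, σ (σ y) = y) ∧
    ∀ g : E ≃ₐ[F] E, (∀ y : k, g y = y) ∨ ∀ y : k, g y = σ y := by
  have : Algebra.IsQuadraticExtension F k := { finrank_eq_two' := hk }
  have hc : Nat.card (k ≃ₐ[F] k) = 2 := by rw [IsGalois.card_aut_eq_finrank, hk]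
  have : Finite (k ≃ₐ[F] k) := Nat.finite_of_card_ne_zero (by rw [hc]; norm_num)
  constructor
  · intro y
    have h := pow_card_eq_one' (x := σ)
    rw [hc, sq] at h
    exact DFunLike.congr_fun h y
  · intro g
    have h : AlgEquiv.restrictNormalHom k g = 1 ∨ AlgEquiv.restrictNormalHom k g = σ := by
      by_contra! hne
      have := Nat.card_eq_two_iff' (1 : k ≃ₐ[F] k) |>.mp hc
      obtain ⟨u, -, hu⟩ := this
      exact hne.2 ((hu _ hne.1).trans (hu _ hσ).symm)
    refine h.imp (fun h y => ?_) (fun h y => ?_)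
    · rw [← AlgEquiv.restrictNormalHom_apply, h]; rfl
    · rw [← AlgEquiv.restrictNormalHom_apply, h]

namespace WeierstrassCurve

open scoped Classical

variable {k : IntermediateField ℚ ℚbar} {C : WeierstrassCurve k} [C.IsElliptic]

/-- The parameter `s` of a `ℚ`-curve of degree 2. -/
theorem exists_sqrt_of_isQCurveOfDegree (h : IsQCurveOfDegree 2 C) :
    ∃ (s : k) (δ : ℚ), s ^ 2 = algebraMap ℚ k δ ∧ (¬ ∃ q : ℚ, δ = q ^ 2) ∧ C.c₄ ≠ 0 ∧ C.c₆ ≠ 0 ∧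
      (32 * (5 - 3 * s)) ^ 3 * C.c₆ ^ 2 = C.c₄ ^ 3 * (256 * (9 * s - 7)) ^ 2 := by
  obtain ⟨hk, ⟨-, hCM, -⟩, hj, σ, hσ, φ, hφ⟩ := h
  have hW : (C⁄ℚbar).j = algebraMap k ℚbar C.j := map_j C _
  have hjne : ∀ n : ℚ, C.j ≠ algebraMap ℚ k n := fun n hn => hj ⟨n, hn.symm⟩
  have hj1728 : (C⁄ℚbar).j ≠ 1728 := by
    rw [hW]
    intro h
    apply hjne 1728
    apply (algebraMap k ℚbar).injective
    rw [h]
    simp [map_ofNat]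
  have hell : ((C.map (σ : k →+* k))⁄ℚbar).IsElliptic :=
    inferInstanceAs ((C.map (σ : k →+* k)).map _).IsElliptic
  obtain ⟨r, hr, hr', hjr, hjr', hNC⟩ := exists_parameter hj1728 hCM hφ
  have hW' : ((C.map (σ : k →+* k))⁄ℚbar).j = algebraMap k ℚbar (σ C.j) := by
    rw [show ((C.map (σ : k →+* k))⁄ℚbar).j = algebraMap k ℚbar (C.map (σ : k →+* k)).j from map_j _ _,
      map_j]
    rfl
  rw [hW] at hjr
  rw [hW'] at hjr'
  obtain ⟨hσσ, hcase⟩ := forall_apply_eq_or (F := ℚ) hk hσ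
  have hself : ∀ g : ℚbar ≃ₐ[ℚ] ℚbar, (∀ y : k, g y = y) → g r = r := by
    intro g hg
    refine apply_eq_self_of_j hNC (g : ℚbar →+* ℚbar) ?_ ?_
    · rw [hjr]; exact hg _
    · rw [hjr']; exact hg _
  have hdual : ∀ g : ℚbar ≃ₐ[ℚ] ℚbar, (∀ y : k, g y = σ y) → g r = 1 / 4 - r := by
    intro g hg
    refine apply_eq_dual_of_j hNC (g : ℚbar →+* ℚbar) ?_ ?_
    · rw [hjr, hjr']; exact hg _
    · rw [hjr, hjr']
      exact (hg _).trans (congrArg (algebraMap k ℚbar) (hσσ _))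
  -- Centred coordinate: `r ↦ 1/4 - r` becomes `s ↦ -s`, and `16 r = 2(1 + s)` is the coefficient
  -- after scaling `a = 1` to `a = 4`.
  obtain ⟨s, hs⟩ : ∃ s : k, algebraMap k ℚbar s = 8 * r - 1 := by
    rw [← Set.mem_range, InfiniteGalois.mem_range_algebraMap_iff_fixed]
    intro g
    have := hself (g.restrictScalars ℚ) (fun y => g.commutes y)
    have e : g r = r := this
    rw [map_sub, map_mul, e, map_one, map_ofNat]
  have hgs : ∀ g : ℚbar ≃ₐ[ℚ] ℚbar, g ((8 * r - 1) ^ 2) = (8 * r - 1) ^ 2 := by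
    intro g
    rcases hcase g with hg | hg
    · simp only [map_pow, map_sub, map_mul, map_one, map_ofNat, hself g hg]
    · simp only [map_pow, map_sub, map_mul, map_one, map_ofNat, hdual g hg]
      ring
  obtain ⟨δ, hδ⟩ := (InfiniteGalois.mem_range_algebraMap_iff_fixed (k := ℚ) _).mpr hgs
  have hsδ : s ^ 2 = algebraMap ℚ k δ := by
    apply (algebraMap k ℚbar).injective
    rw [map_pow, hs, ← hδ]
    simp
  -- A rational `r` would make `j` rational; hence `s` is irrational and `δ` is not a square.
  have hnr : ∀ q : ℚ, r ≠ algebraMap ℚ ℚbar q := by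
    intro q hq
    have h1 : ∀ g : ℚbar ≃ₐ[ℚ] ℚbar, g (twoCurve 1 r).j = (twoCurve 1 r).j := by
      intro g
      have hgr : g r = r := by rw [hq]; exact g.commutes q
      have e := map_j (twoCurve 1 r) (g : ℚbar →+* ℚbar)
      refine e.symm.trans (j_congr ?_)
      rw [twoCurve_map, map_one]
      exact congrArg _ hgr
    obtain ⟨n, hn⟩ := (InfiniteGalois.mem_range_algebraMap_iff_fixed (k := ℚ) _).mpr h1
    apply hjne n
    apply (algebraMap k ℚbar).injective
    rw [← hjr, ← hn]
    simp
  have hj0 : C.j ≠ 0 := by simpa using hjne 0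
  have hj1 : C.j ≠ 1728 := by simpa using hjne 1728
  have hjΔ : C.j * C.Δ = C.c₄ ^ 3 := by
    rw [WeierstrassCurve.j, mul_right_comm, ← coe_Δ', Units.inv_mul, one_mul]
  have hΔ : C.Δ ≠ 0 := C.isUnit_Δ.ne_zero
  refine ⟨s, δ, hsδ, ?_, ?_, ?_, ?_⟩
  · rintro ⟨q, rfl⟩
    have h2 : (8 * r - 1 - algebraMap ℚ ℚbar q) * (8 * r - 1 + algebraMap ℚ ℚbar q) = 0 := by
      rw [map_pow] at hδ
      linear_combination -hδ
    rcases mul_eq_zero.mp h2 with h2 | h2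
    · apply hnr ((1 + q) / 8)
      simp only [map_div₀, map_add, map_one, map_ofNat]
      linear_combination h2 / 8
    · apply hnr ((1 - q) / 8)
      simp only [map_div₀, map_sub, map_one, map_ofNat]
      linear_combination h2 / 8
  · intro h
    rw [h] at hjΔ
    have : C.j = 0 ∨ C.Δ = 0 := by simpa using hjΔ
    tauto
  · intro h
    have h1 := C.c_relation
    rw [h] at h1
    apply hj1
    apply mul_right_cancel₀ hΔ
    linear_combination hjΔ - h1
  · have hc := c₄_c₆_of_j_eq (W := C⁄ℚbar) (W' := twoCurve 1 r) (by rw [hW, hjr])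
    rw [twoCurve_c₄, twoCurve_c₆, show (C⁄ℚbar).c₄ = algebraMap k ℚbar C.c₄ from map_c₄ C _,
      show (C⁄ℚbar).c₆ = algebraMap k ℚbar C.c₆ from map_c₆ C _] at hc
    apply (algebraMap k ℚbar).injective
    simp only [map_mul, map_pow, map_sub, map_ofNat, hs]
    linear_combination (-4096) * hc

/-- The discriminant of z⁴ + tz + t is -3δ modulo squares. This is the source of both the field
ℚ(√(-3d)) and the excluded class -3. -/
lemma discr_quartic {δ : ℚ} (hδ : 1 - δ ≠ 0) : 256 * (256 / (27 * (1 - δ))) ^ 3 -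
    27 * (256 / (27 * (1 - δ))) ^ 4 = -27 * δ * (256 / (27 * (1 - δ))) ^ 4 := by
  field_simp
  ring

/-- The octahedral field of a `ℚ`-curve of degree 2. -/
theorem exists_octahedralField (h : IsQCurveOfDegree 2 C)
    (hsurj : Function.Surjective (torsionRep C 3)) : ∃ K : IntermediateField ℚ ℚbar,
        IsOctahedralFieldOf C K ∧
        (∀ K' : IntermediateField ℚ ℚbar, IsOctahedralFieldOf C K' → K' = K) ∧
        ∃ (K₁ : IntermediateField ℚ ℚbar) (_ : NumberField K₁),
          IsPrincipalQuartic K₁ ∧ galoisClosure K₁ = K ∧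
          ¬ ∃ q : ℚ, (NumberField.discr K₁ : ℚ) = -3 * q ^ 2 := by
  have hk := h.1
  obtain ⟨s, δ, hs, hδ, h4, h6, hJ⟩ := exists_sqrt_of_isQCurveOfDegree h
  have hδ0 : δ ≠ 0 := fun h => hδ ⟨0, by rw [h]; norm_num⟩
  have hδ1 : δ ≠ 1 := fun h => hδ ⟨1, by rw [h]; norm_num⟩
  obtain ⟨z, hz, hroot, hfield, hiff⟩ := exists_rational_quartic_roots hs hδ0 hδ1 h4 h6 hJ
  have hfull := fullQuartic_of_surjective hz hroot (hiff.mp hsurj)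
  obtain ⟨h1, h2⟩ := isOctahedralFieldOf_of_fullQuartic hfull hk hfield
  obtain ⟨K₁, hK₁, hp, hcl, q, hq⟩ := exists_isPrincipalQuartic hfull hroot
  refine ⟨_, h1, h2, K₁, hK₁, hp, hcl, ?_⟩
  rintro ⟨q', hq'⟩
  have hd1 : 1 - δ ≠ 0 := sub_ne_zero.mpr hδ1.symm
  rw [discr_quartic hd1, hq'] at hq
  set t := 256 / (27 * (1 - δ)) with ht
  have ht0 : t ≠ 0 := div_ne_zero (by norm_num) (mul_ne_zero (by norm_num) hd1)
  have hq0 : q' ≠ 0 := by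
    rintro rfl
    have : (NumberField.discr K₁ : ℚ) = 0 := by rw [hq']; ring
    exact NumberField.discr_ne_zero K₁ (by exact_mod_cast this)
  refine hδ ⟨q / (9 * q' * t ^ 2), ?_⟩
  rw [div_pow, eq_div_iff (by positivity), ← hq]
  ring

end WeierstrassCurve

/-! ### Tschirnhaus transformations: infinitely many quartics X⁴ + tX + t -/

section Tschirnhaus

/-- The element `α x + β x² + γ (x³ + 3b/4)` of trace zero, where `x⁴ + b x + c = 0`. -/
def tschirnhaus {R : Type*} [Field R] (b α β γ x : R) : R := α * x + β * x ^ 2 + γ * (x ^ 3 + 3 * b / 4)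

variable {R : Type*} [CommRing R] (b c α β γ : R)

/-- The linear coefficient of the characteristic polynomial of `tschirnhaus b α β γ x`, up to a factor
8. -/
def tschirnhausLin : R :=
  -b ^ 3 * γ ^ 3 - 12 * b ^ 2 * α * β * γ - 8 * b ^ 2 * β ^ 3 - 8 * b * c * α * γ ^ 2 -
    32 * b * c * β ^ 2 * γ + 8 * b * α ^ 3 - 32 * c ^ 2 * β * γ ^ 2 + 32 * c * α ^ 2 * β

/-- The constant coefficient of the characteristic polynomial of `tschirnhaus b α β γ x`, up to a factor
256. -/
def tschirnhausConst : R :=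
  -3 * b ^ 4 * γ ^ 4 - 144 * b ^ 3 * α * β * γ ^ 2 + 192 * b ^ 3 * β ^ 3 * γ -
    128 * b ^ 2 * c * α * γ ^ 3 + 480 * b ^ 2 * c * β ^ 2 * γ ^ 2 - 192 * b ^ 2 * α ^ 3 * γ +
    512 * b * c ^ 2 * β * γ ^ 3 - 256 * b * c * α * β ^ 3 + 256 * c ^ 3 * γ ^ 4 +
    512 * c ^ 2 * α ^ 2 * γ ^ 2 - 1024 * c ^ 2 * α * β ^ 2 * γ + 256 * c ^ 2 * β ^ 4 + 256 * c * α ^ 4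

/-- The left side of `h` is -4 times the trace of the square of the element. The trace being zero,
`h` removes the quadratic term of the characteristic polynomial as well. -/
lemma tschirnhaus_root {E : Type*} [Field E] [CharZero E] {b c α β γ x : E}
    (hx : x ^ 4 + b * x + c = 0)
    (h : -3 * b ^ 2 * γ ^ 2 + 24 * b * α * β + 32 * c * α * γ + 16 * c * β ^ 2 = 0) :
    tschirnhaus b α β γ x ^ 4 + tschirnhausLin b c α β γ / 8 * tschirnhaus b α β γ x +
      tschirnhausConst b c α β γ / 256 = 0 := by
  rw [tschirnhaus, tschirnhausLin, tschirnhausConst]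
  linear_combination (b ^ 2 * α * γ ^ 3 + b ^ 2 * β * γ ^ 3 * x + b ^ 2 * γ ^ 4 * x ^ 2 - b * c * β * γ ^ 3 - b * c *
    γ ^ 4 * x + 3 * b * α ^ 2 * β * γ + 3 * b * α ^ 2 * γ ^ 2 * x - b * α * β ^ 3 + 3 * b * α * β ^
    2 * γ * x + 9 * b * α * β * γ ^ 2 * x ^ 2 + 5 * b * α * γ ^ 3 * x ^ 3 - b * β ^ 4 * x - b * β ^
    3 * γ * x ^ 2 + 3 * b * β ^ 2 * γ ^ 2 * x ^ 3 + 5 * b * β * γ ^ 3 * x ^ 4 + 2 * b * γ ^ 4 * x ^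
    5 + c ^ 2 * γ ^ 4 + 2 * c * α ^ 2 * γ ^ 2 - 4 * c * α * β ^ 2 * γ - 4 * c * α * β * γ ^ 2 * x +
    c * β ^ 4 - 4 * c * β ^ 2 * γ ^ 2 * x ^ 2 - 4 * c * β * γ ^ 3 * x ^ 3 - c * γ ^ 4 * x ^ 4 + α ^
    4 + 4 * α ^ 3 * β * x + 4 * α ^ 3 * γ * x ^ 2 + 6 * α ^ 2 * β ^ 2 * x ^ 2 + 12 * α ^ 2 * β * γ
    * x ^ 3 + 6 * α ^ 2 * γ ^ 2 * x ^ 4 + 4 * α * β ^ 3 * x ^ 3 + 12 * α * β ^ 2 * γ * x ^ 4 + 12 *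
    α * β * γ ^ 2 * x ^ 5 + 4 * α * γ ^ 3 * x ^ 6 + β ^ 4 * x ^ 4 + 4 * β ^ 3 * γ * x ^ 5 + 6 * β ^
    2 * γ ^ 2 * x ^ 6 + 4 * β * γ ^ 3 * x ^ 7 + γ ^ 4 * x ^ 8) * hx - (1 / 8) * (α * x + β * x ^ 2 + γ * (x ^ 3 + 3 * b / 4)) ^ 2 * h

end Tschirnhaus

section Family

/-- A rational parametrization of the conic of elements of trace zero whose square has trace zero. -/
lemma tschirnhaus_conic {R : Type*} [CommRing R] (b c η : R) :
    -3 * b ^ 2 * (-72 * b ^ 2 * η) ^ 2 + 24 * b * (27 * b ^ 4 - 16 * c * (4 * c + η) ^ 2) *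
      (24 * b * η * (4 * c + η)) + 32 * c * (27 * b ^ 4 - 16 * c * (4 * c + η) ^ 2) *
      (-72 * b ^ 2 * η) + 16 * c * (24 * b * η * (4 * c + η)) ^ 2 = 0 := by
  -- The conic contains (1 : 0 : 0), which is the root itself. The parameter `η` runs through the
  -- lines β : γ = (4c + η) : -3b through that point, and `η = 0` gives the tangent there.
  ring

/-- An infinite fibre would give `p⁴ = t q³` as polynomials in `η`. At `η = 0` the derivative of `p`
vanishes while `p`, `q` and the derivative of `q` do not, so comparing values and first derivatives
is contradictory. -/
lemma finite_setOf_lin_pow_eq {F : Type*} [Field F] [CharZero F] {b c : F} (hb : b ≠ 0) (hc : c ≠ 0)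
    (hd : 256 * c ^ 3 - 27 * b ^ 4 ≠ 0) (t : F) :
    {η : F | tschirnhausLin b c (27 * b ^ 4 - 16 * c * (4 * c + η) ^ 2) (24 * b * η * (4 * c + η))
        (-72 * b ^ 2 * η) ^ 4 = t * tschirnhausConst b c (27 * b ^ 4 - 16 * c * (4 * c + η) ^ 2)
        (24 * b * η * (4 * c + η)) (-72 * b ^ 2 * η) ^ 3}.Finite := by
  by_contra hinf
  let a : F[X] := 27 * C b ^ 4 - 16 * C c * (4 * C c + X) ^ 2
  let e : F[X] := 24 * C b * X * (4 * C c + X)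
  let g : F[X] := -72 * C b ^ 2 * X
  set p := tschirnhausLin (C b) (C c) a e g with hp
  set q := tschirnhausConst (C b) (C c) a e g with hq
  have hpq : p ^ 4 = C t * q ^ 3 := by
    refine eq_of_infinite_eval_eq _ _ (Set.Infinite.mono (fun η hη => ?_) hinf)
    simpa [hp, hq, a, e, g, tschirnhausLin, tschirnhausConst] using hη
  set A := 27 * b ^ 4 - 256 * c ^ 3 with hA
  have hA0 : A ≠ 0 := fun h => hd (by linear_combination -h)
  have p0 : p.eval 0 = 8 * b * A ^ 3 := by
    simp only [hp, a, e, g, tschirnhausLin, hA, eval_sub, eval_add, eval_mul, eval_pow, eval_neg, eval_X,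
      eval_C, eval_ofNat]
    ring
  have q0 : q.eval 0 = 256 * c * A ^ 4 := by
    simp only [hq, a, e, g, tschirnhausConst, hA, eval_sub, eval_add, eval_mul, eval_pow, eval_neg, eval_X,
      eval_C, eval_ofNat]
    ring
  have p1 : (derivative p).eval 0 = 0 := by
    simp only [hp, a, e, g, tschirnhausLin, derivative_sub, derivative_add, derivative_mul, derivative_pow,
      derivative_neg, derivative_X, derivative_C, derivative_ofNat, eval_sub, eval_add, eval_mul, eval_pow,
      eval_neg, eval_X, eval_C, eval_ofNat, eval_zero, eval_one]
    ring
  have q1 : (derivative q).eval 0 = 512 * A ^ 4 := by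
    simp only [hq, a, e, g, tschirnhausConst, hA, derivative_sub, derivative_add, derivative_mul,
      derivative_pow, derivative_neg, derivative_X, derivative_C, derivative_ofNat, eval_sub, eval_add,
      eval_mul, eval_pow, eval_neg, eval_X, eval_C, eval_ofNat, eval_zero, eval_one]
    ring
  have h0 := congrArg (eval 0) hpq
  have h1 := congrArg (fun r => eval 0 (derivative r)) hpq
  simp only [derivative_mul, derivative_pow, derivative_C, eval_add, eval_mul, eval_pow, eval_C, p0, q0,
    p1, q1, eval_zero] at h0 h1
  have ht : t ≠ 0 := by
    rintro rfl
    have : (8 * b * A ^ 3) ^ 4 = 0 := by rw [h0]; ring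
    simp [hb, hA0] at this
  have h2 : t * c ^ 2 * A ^ 12 = 0 := by
    have h3 : (100663296 : F) * (t * c ^ 2 * A ^ 12) = 0 := by
      push_cast at h1
      linear_combination -h1
    exact (mul_eq_zero.mp h3).resolve_left (by norm_num)
  simp [ht, hc, hA0] at h2

variable {F E : Type*} [Field F] [Field E] [Algebra F E] {x : Fin 4 → E}

/-- A rational function of the four elements has the same Galois action, unless it is constant. -/
lemma FullQuartic.comp [IsGalois F E] (h : FullQuartic F x) {f : E → E}
    (hf : ∀ (g : E ≃ₐ[F] E) (i : Fin 4), g (f (x i)) = f (g (x i))) (hne : ∃ i j, f (x i) ≠ f (x j)) :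
    FullQuartic F (f ∘ x) ∧ IntermediateField.adjoin F (Set.range (f ∘ x)) =
      IntermediateField.adjoin F (Set.range x) := by
  have hg : ∀ (g : E ≃ₐ[F] E) (σ : Equiv.Perm (Fin 4)), (∀ i, g (x i) = x (σ i)) →
      ∀ i, g ((f ∘ x) i) = (f ∘ x) (σ i) := by
    intro g σ hσ i
    rw [Function.comp_apply, hf, hσ]; rfl
  obtain ⟨i, j, hij⟩ := hne
  have hij' : i ≠ j := fun h => hij (by rw [h])
  have hinj : Function.Injective (f ∘ x) := by
    intro i' j' h'
    by_contra hne
    -- S₄ is doubly transitive, so a coincidence at one pair of indices would spread to the pair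
    -- `i`, `j`.
    obtain ⟨σ, hi, hj⟩ : ∃ σ : Equiv.Perm (Fin 4), σ i' = i ∧ σ j' = j := by
      refine ⟨Equiv.swap (Equiv.swap i' i j') j * Equiv.swap i' i, ?_, ?_⟩
      · rw [Equiv.Perm.mul_apply, Equiv.swap_apply_left, Equiv.swap_apply_of_ne_of_ne _ hij']
        intro h
        exact hne ((Equiv.swap i' i).injective (by rw [← h, Equiv.swap_apply_left]))
      · rw [Equiv.Perm.mul_apply, Equiv.swap_apply_left]
    obtain ⟨g, hg'⟩ := h.full σ
    apply hij
    have h1 := hg g σ hg' i'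
    rw [h', hg g σ hg' j', hi, hj] at h1
    exact h1.symm
  have hy : FullQuartic F (f ∘ x) := by
    refine ⟨hinj, fun g => ?_, fun σ => ?_⟩
    · obtain ⟨σ, hσ⟩ := h.perm g
      exact ⟨σ, hg g σ hσ⟩
    · obtain ⟨g, hg'⟩ := h.full σ
      exact ⟨g, hg g σ hg'⟩
  refine ⟨hy, ?_⟩
  rw [← InfiniteGalois.fixedField_fixingSubgroup (IntermediateField.adjoin F (Set.range (f ∘ x))),
    ← InfiniteGalois.fixedField_fixingSubgroup (IntermediateField.adjoin F (Set.range x)),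
    ← hy.ker_permHom, ← h.ker_permHom]
  congr 1
  ext g
  rw [MonoidHom.mem_ker, MonoidHom.mem_ker, hy.permHom_eq (hg g _ (h.apply_eq g))]

/-- With `b = 0` the roots come in pairs ±x, a structure that S₄ does not preserve; with `c = 0`
there is the rational root 0. -/
lemma FullQuartic.coeff_ne_zero [CharZero E] {b c : F} (h : FullQuartic F x)
    (hx : ∀ i, x i ^ 4 + algebraMap F E b * x i + algebraMap F E c = 0) : b ≠ 0 ∧ c ≠ 0 := by
  constructor
  · rintro rfl
    rw [map_zero] at hx
    obtain ⟨i, hi⟩ := exists_eq_of_quartic h.inj hx (y := -x 0) (by linear_combination hx 0)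
    have key : ∀ j, j ≠ 0 → j = i := by
      intro j hj
      by_contra hji
      by_cases hi0 : i = 0
      · rw [hi0, neg_eq_self] at hi
        have hc := hx 0
        have hj' := hx j
        rw [hi] at hc
        have h4 : x j ^ 4 = 0 := by linear_combination hj' - hc
        exact hj (h.inj ((pow_eq_zero_iff (by norm_num)).mp h4 |>.trans hi.symm))
      · obtain ⟨g, hg⟩ := h.full (Equiv.swap i j)
        have h1 := congrArg g hi
        rw [map_neg, hg, hg, Equiv.swap_apply_left, Equiv.swap_apply_of_ne_of_ne (Ne.symm hi0) hj.symm] at h1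
        exact hji (h.inj (h1.symm.trans hi))
    exact absurd ((key 1 (by decide)).trans (key 2 (by decide)).symm) (by decide)
  · rintro rfl
    rw [map_zero] at hx
    obtain ⟨i, hi⟩ := exists_eq_of_quartic h.inj hx (y := 0) (by ring)
    obtain ⟨j, hj⟩ := exists_ne i
    obtain ⟨g, hg⟩ := h.full (Equiv.swap i j)
    have h1 := hg i
    rw [← hi, map_zero, Equiv.swap_apply_left, hi] at h1
    exact hj (h.inj h1.symm)

/-- A polynomial of degree exactly 3 cannot take one value at four points; divided differences make
this explicit. -/
lemma tschirnhaus_ne [CharZero E] {b α β γ : E} (hx : Function.Injective x) (hγ : γ ≠ 0) :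
    ∃ i j, tschirnhaus b α β γ (x i) ≠ tschirnhaus b α β γ (x j) := by
  by_contra! h
  have hne : ∀ i j, i ≠ j → x i - x j ≠ 0 := fun i j hij => sub_ne_zero.mpr (hx.ne hij)
  have h2 : ∀ i j, i ≠ j → α + β * (x i + x j) + γ * (x i ^ 2 + x i * x j + x j ^ 2) = 0 := by
    intro i j hij
    apply mul_left_cancel₀ (hne i j hij)
    have := h i j
    rw [tschirnhaus, tschirnhaus] at this
    linear_combination this
  have h3 : ∀ i j l, i ≠ j → i ≠ l → j ≠ l → β + γ * (x i + x j + x l) = 0 := by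
    intro i j l hij hil hjl
    apply mul_left_cancel₀ (hne j l hjl)
    linear_combination h2 i j hij - h2 i l hil
  apply mul_ne_zero hγ (hne 2 3 (by decide))
  linear_combination h3 0 1 2 (by decide) (by decide) (by decide) -
    h3 0 1 3 (by decide) (by decide) (by decide)

/-- An octahedral field which is the splitting field of a polynomial `X⁴ + b X + c` is the splitting
field of infinitely many polynomials `X⁴ + t X + t`. -/
theorem FullQuartic.infinite_setOf_parameter [CharZero F] [CharZero E] [IsGalois F E] {b c : F}
    (h : FullQuartic F x)
    (hx : ∀ i, x i ^ 4 + algebraMap F E b * x i + algebraMap F E c = 0) :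
    {t : F | ∃ w : Fin 4 → E, FullQuartic F w ∧
      IntermediateField.adjoin F (Set.range w) = IntermediateField.adjoin F (Set.range x) ∧
      ∀ i, w i ^ 4 + algebraMap F E t * w i + algebraMap F E t = 0}.Infinite := by
  obtain ⟨hb, hc⟩ := h.coeff_ne_zero hx
  have hd : 256 * c ^ 3 - 27 * b ^ 4 ≠ 0 := by
    intro hd
    have h1 := det_vandermonde_sq h.inj hx
    have h2 : 256 * algebraMap F E c ^ 3 - 27 * algebraMap F E b ^ 4 = 0 := by
      rw [← map_zero (algebraMap F E), ← hd]; simp [map_ofNat]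
    rw [h2] at h1
    exact Matrix.det_vandermonde_ne_zero_iff.mpr h.inj ((pow_eq_zero_iff (by norm_num)).mp h1)
  let p : F → F := fun η => tschirnhausLin b c (27 * b ^ 4 - 16 * c * (4 * c + η) ^ 2)
    (24 * b * η * (4 * c + η)) (-72 * b ^ 2 * η) / 8
  let q : F → F := fun η => tschirnhausConst b c (27 * b ^ 4 - 16 * c * (4 * c + η) ^ 2)
    (24 * b * η * (4 * c + η)) (-72 * b ^ 2 * η) / 256
  have hmem : ∀ η : F, η ≠ 0 → q η ≠ 0 ∧ p η ^ 4 / q η ^ 3 ∈ {t : F | ∃ w : Fin 4 → E,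
      FullQuartic F w ∧
      IntermediateField.adjoin F (Set.range w) = IntermediateField.adjoin F (Set.range x) ∧
      ∀ i, w i ^ 4 + algebraMap F E t * w i + algebraMap F E t = 0} := by
    intro η hη
    set f := algebraMap F E with hf
    set z : E → E := tschirnhaus (f b) (f (27 * b ^ 4 - 16 * c * (4 * c + η) ^ 2))
      (f (24 * b * η * (4 * c + η))) (f (-72 * b ^ 2 * η)) with hz
    have hγ : f (-72 * b ^ 2 * η) ≠ 0 := by
      rw [Ne, map_eq_zero]
      simp [hb, hη]
    have hzroot : ∀ i, z (x i) ^ 4 + f (p η) * z (x i) + f (q η) = 0 := by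
      intro i
      have h1 := tschirnhaus_root (hx i) (α := f (27 * b ^ 4 - 16 * c * (4 * c + η) ^ 2))
        (β := f (24 * b * η * (4 * c + η))) (γ := f (-72 * b ^ 2 * η)) (by
          have := congrArg f (tschirnhaus_conic b c η)
          simp only [map_add, map_mul, map_pow, map_neg, map_ofNat, map_zero, map_sub] at this ⊢
          exact this)
      have e1 : f (p η) = tschirnhausLin (f b) (f c) (f (27 * b ^ 4 - 16 * c * (4 * c + η) ^ 2))
          (f (24 * b * η * (4 * c + η))) (f (-72 * b ^ 2 * η)) / 8 := by
        simp only [p, tschirnhausLin, map_div₀, map_add, map_sub, map_mul, map_pow, map_neg, map_ofNat]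
      have e2 : f (q η) = tschirnhausConst (f b) (f c) (f (27 * b ^ 4 - 16 * c * (4 * c + η) ^ 2))
          (f (24 * b * η * (4 * c + η))) (f (-72 * b ^ 2 * η)) / 256 := by
        simp only [q, tschirnhausConst, map_div₀, map_add, map_sub, map_mul, map_pow, map_neg, map_ofNat]
      rw [e1, e2]
      exact h1
    have hzg : ∀ (g : E ≃ₐ[F] E) (y : E), g (z y) = z (g y) := by
      intro g y
      simp only [hz, tschirnhaus, map_add, map_mul, map_pow, map_div₀, map_ofNat, hf, g.commutes]
    obtain ⟨hz1, -⟩ := h.comp (fun g i => hzg g (x i)) (tschirnhaus_ne h.inj hγ)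
    obtain ⟨hp0, hq0⟩ := hz1.coeff_ne_zero hzroot
    have hu : f (p η / q η) ≠ 0 := by
      rw [Ne, map_eq_zero]; exact div_ne_zero hp0 hq0
    -- Multiplying the roots of X⁴ + pX + q by p/q makes both coefficients equal to p⁴/q³.
    obtain ⟨hw1, hw2⟩ := h.comp (f := fun y => f (p η / q η) * z y)
      (fun g i => by rw [map_mul, hzg, hf, g.commutes]) (by
        obtain ⟨i, j, hij⟩ := tschirnhaus_ne h.inj hγ
        exact ⟨i, j, fun e => hij (mul_left_cancel₀ hu e)⟩)
    refine ⟨hq0, _, hw1, hw2, fun i => ?_⟩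
    have hfp : f (p η) ≠ 0 := by rwa [Ne, map_eq_zero]
    have hfq : f (q η) ≠ 0 := by rwa [Ne, map_eq_zero]
    have e := hzroot i
    simp only [Function.comp_apply, map_div₀, map_pow]
    have : (f (p η) / f (q η) * z (x i)) ^ 4 + f (p η) ^ 4 / f (q η) ^ 3 *
        (f (p η) / f (q η) * z (x i)) + f (p η) ^ 4 / f (q η) ^ 3 =
        (f (p η) / f (q η)) ^ 4 * (z (x i) ^ 4 + f (p η) * z (x i) + f (q η)) := by
      field_simp
    rw [this, e, mul_zero]
  intro hfin
  have hfin' : {η : F | η ≠ 0}.Finite := by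
    refine Set.Finite.of_finite_fibers (fun η => p η ^ 4 / q η ^ 3) (hfin.subset ?_) fun t ht => ?_
    · rintro _ ⟨η, hη, rfl⟩
      exact (hmem η hη).2
    · refine (finite_setOf_lin_pow_eq hb hc hd (t * (8 ^ 4 / 256 ^ 3))).subset ?_
      rintro η ⟨hη, hηt⟩
      have hq0 := (hmem η hη).1
      have e : p η ^ 4 / q η ^ 3 = t := hηt
      rw [div_eq_iff (pow_ne_zero 3 hq0)] at e
      simp only [p, q] at e
      change _ = _
      linear_combination 8 ^ 4 * e
  have : (Set.univ : Set F).Finite := by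
    refine ((hfin'.union (Set.finite_singleton 0))).subset fun η _ => ?_
    by_cases hη : η = 0
    · exact Or.inr hη
    · exact Or.inl hη
  exact Set.infinite_univ this

end Family

/-! ### The curves E_s as ℚ-curves -/

section Quadratic

variable {F E : Type*} [Field F] [Field E] [Algebra F E]

lemma IntermediateField.finrank_adjoin_sqrt {D : F} {r : E} (hr : r ^ 2 = algebraMap F E D)
    (hD : ¬ ∃ q : F, D = q ^ 2) : Module.finrank F (IntermediateField.adjoin F {r}) = 2 := by
  have hint : IsIntegral F r := ⟨X ^ 2 - C D, by monicity!, by simp [hr]⟩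
  rw [IntermediateField.adjoin.finrank hint]
  have h1 : (minpoly F r).natDegree ≤ 2 := by
    refine (natDegree_le_natDegree (minpoly.min F r (p := X ^ 2 - C D) (by monicity!) ?_)).trans ?_
    · simp [hr]
    · compute_degree!
  have h2 : 0 < (minpoly F r).natDegree := minpoly.natDegree_pos hint
  have h3 : (minpoly F r).natDegree ≠ 1 := by
    intro h
    obtain ⟨q, hq⟩ := minpoly.natDegree_eq_one_iff.mp h
    apply hD
    refine ⟨q, (algebraMap F E).injective ?_⟩
    rw [← hr, map_pow, hq]
  lia

lemma IntermediateField.exists_conj_eq_neg [IsGalois F E] {k : IntermediateField F E}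
    (hk : Module.finrank F k = 2) {s : k} {δ : F} (hs : s ^ 2 = algebraMap F k δ)
    (hδ : ¬ ∃ q : F, δ = q ^ 2) : ∃ σ : k ≃ₐ[F] k, σ ≠ 1 ∧ σ s = -s := by
  have : Algebra.IsQuadraticExtension F k := { finrank_eq_two' := hk }
  have hfin : FiniteDimensional F k := Module.finite_of_finrank_pos (by rw [hk]; norm_num)
  by_contra! h
  have hfix : ∀ σ : k ≃ₐ[F] k, σ s = s := by
    intro σ
    by_cases hσ : σ = 1
    · rw [hσ]; rfl
    · have h1 : (σ s - s) * (σ s + s) = 0 := by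
        have h2 : σ s ^ 2 = s ^ 2 := by rw [← map_pow, hs, σ.commutes]
        linear_combination h2
      rcases mul_eq_zero.mp h1 with h1 | h1
      · exact sub_eq_zero.mp h1
      · exact absurd (eq_neg_of_add_eq_zero_left h1) (h σ hσ)
  obtain ⟨q, hq⟩ := (IsGalois.mem_range_algebraMap_iff_fixed s).mpr hfix
  exact hδ ⟨q, (algebraMap F k).injective (by rw [← hs, map_pow, hq])⟩

end Quadratic

namespace WeierstrassCurve

/-- The quotient by (0,0) is y² = x³ - 8x² + 8(1 - s)x, and scaling with `u² = -2` brings it to the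
family with `s` replaced by `-s`. -/
lemma exists_isIsogenyOfDegree_two {E : Type*} [Field E] [CharZero E] [IsAlgClosed E] [DecidableEq E]
    (s : E) [(twoCurve 4 (2 * (1 + s))).IsElliptic] :
    ∃ φ : (twoCurve 4 (2 * (1 + s))).toAffine.Point →+ (twoCurve 4 (2 * (1 - s))).toAffine.Point,
      IsIsogenyOfDegree φ 2 := by
  obtain ⟨h1, h2⟩ := b_ne_zero_of_twoCurve (a := 4) (b := 2 * (1 + s))
  have hell : (twoCurve (-2 * 4) (4 ^ 2 - 4 * (2 * (1 + s)))).IsElliptic := by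
    refine isElliptic_twoCurve h2 ?_
    intro h; apply h1; linear_combination h / 16
  obtain ⟨π, hπ, hT, hP⟩ := exists_twoIsogeny 4 (2 * (1 + s))
  obtain ⟨u, hu⟩ := IsAlgClosed.exists_pow_nat_eq (-2 : E) (n := 2) two_pos
  have hu0 : u ≠ 0 := by rintro rfl; norm_num at hu
  have hv : (⟨Units.mk0 u hu0, 0, 0, 0⟩ : VariableChange E) •
      twoCurve (-2 * 4) (4 ^ 2 - 4 * (2 * (1 + s))) = twoCurve 4 (2 * (1 - s)) := by
    have h4 : (u ^ 4) = 4 := by rw [show 4 = 2 * 2 from rfl, pow_mul, hu]; norm_num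
    ext
    · simp [variableChange_a₁, twoCurve]
    · simp [variableChange_a₂, twoCurve, hu]
    · simp [variableChange_a₃, twoCurve]
    · simp [variableChange_a₄, twoCurve, h4]; ring
    · simp [variableChange_a₆, twoCurve]
  have : (twoCurve 4 (2 * (1 - s))).IsElliptic := by rw [← hv]; infer_instance
  obtain ⟨ι, i, -, -⟩ := exists_variableChange_equiv _ hv
  refine ⟨ι.toAddMonoidHom.comp π, i.comp hπ, ?_⟩
  have hker : ∀ P, (ι.toAddMonoidHom.comp π) P = 0 ↔ P = 0 ∨ P = twoPoint 4 (2 * (1 + s)) := by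
    intro P
    change ι (π P) = 0 ↔ _
    rw [EmbeddingLike.map_eq_zero_iff]
    constructor
    · intro h
      by_contra! h'
      exact (hP P h'.1 h'.2).1 h
    · rintro (rfl | rfl)
      · exact map_zero π
      · exact hT
  refine (Nat.card_congr (Equiv.subtypeEquivRight hker)).trans ?_
  exact (Nat.card_coe_set_eq _).trans (Set.ncard_pair twoPoint_ne_zero.symm)

lemma exists_isogeny_congr {E : Type*} [Field E] [DecidableEq E] {V V' W W' : WeierstrassCurve E}
    (hW : W = V) (hW' : W' = V') (p : ∀ {V V' : WeierstrassCurve E},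
      (V.toAffine.Point →+ V'.toAffine.Point) → Prop)
    (h : ∃ φ : V.toAffine.Point →+ V'.toAffine.Point, p φ) :
    ∃ φ : W.toAffine.Point →+ W'.toAffine.Point, p φ := by
  subst hW hW'
  exact h

end WeierstrassCurve

namespace WeierstrassCurve

open scoped Classical

variable {k : IntermediateField ℚ ℚbar} {s : k} {δ : ℚ}

/-- A rational `j` takes equal values at `s` and `-s`, which reduces to s(81s² + 175) = 0; this
explains the exceptional `δ`. -/
lemma j_twoCurve_not_mem_range [(twoCurve 4 (2 * (1 + s))).IsElliptic] {σ : k ≃ₐ[ℚ] k} (hσs : σ s = -s)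
    (hs : s ^ 2 = algebraMap ℚ k δ) (hδ : ¬ ∃ q : ℚ, δ = q ^ 2) (hδ' : δ ≠ -175 / 81) :
    (twoCurve 4 (2 * (1 + s))).j ∉ (algebraMap ℚ k).range := by
  rintro ⟨q, hq⟩
  have hjΔ : (twoCurve 4 (2 * (1 + s))).j * (twoCurve 4 (2 * (1 + s))).Δ =
      (twoCurve 4 (2 * (1 + s))).c₄ ^ 3 := by
    rw [WeierstrassCurve.j, mul_right_comm, ← coe_Δ', Units.inv_mul, one_mul]
  rw [← hq, twoCurve_Δ, twoCurve_c₄] at hjΔ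
  have hjΔ' := congrArg σ hjΔ
  simp only [map_mul, map_pow, map_add, map_sub, map_ofNat, map_one, AlgEquiv.commutes, hσs] at hjΔ'
  have hs0 : s ≠ 0 := by
    rintro rfl
    refine hδ ⟨0, (algebraMap ℚ k).injective ?_⟩
    rw [← hs]; simp
  have key : s * (81 * s ^ 2 + 175) = 0 := by
    linear_combination (1 / 131072) * ((1 - s) * hjΔ - (1 + s) * hjΔ')
  have h3 := (mul_eq_zero.mp key).resolve_left hs0
  apply hδ'
  apply (algebraMap ℚ k).injective
  rw [← hs]
  simp only [map_div₀, map_neg, map_ofNat]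
  linear_combination h3 / 81

theorem isQCurveOfDegree_twoCurve (hk : Module.finrank ℚ k = 2)
    [(twoCurve 4 (2 * (1 + s))).IsElliptic] (hs : s ^ 2 = algebraMap ℚ k δ)
    (hδ : ¬ ∃ q : ℚ, δ = q ^ 2) (hδ' : δ ≠ -175 / 81)
    (hsurj : Function.Surjective (torsionRep (twoCurve 4 (2 * (1 + s))) 3)) :
    IsQCurveOfDegree 2 (twoCurve 4 (2 * (1 + s))) := by
  obtain ⟨σ, hσ, hσs⟩ := IntermediateField.exists_conj_eq_neg (F := ℚ) hk hs hδ
  obtain ⟨-, hcase⟩ := forall_apply_eq_or (F := ℚ) hk hσ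
  have hC : (twoCurve 4 (2 * (1 + s)))⁄ℚbar = twoCurve 4 (2 * (1 + algebraMap k ℚbar s)) := by
    refine (twoCurve_map (algebraMap k ℚbar) _ _).trans ?_
    simp only [map_mul, map_add, map_one, map_ofNat]
  have hconj : ((twoCurve 4 (2 * (1 + s))).map (σ : k →+* k))⁄ℚbar =
      twoCurve 4 (2 * (1 - algebraMap k ℚbar s)) := by
    have e : (σ : k →+* k) s = -s := hσs
    rw [twoCurve_map]
    refine (twoCurve_map (algebraMap k ℚbar) _ _).trans ?_
    simp only [map_mul, map_add, map_one, map_ofNat, e, map_neg, sub_eq_add_neg]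
  have hell : (twoCurve 4 (2 * (1 + algebraMap k ℚbar s))).IsElliptic := by
    rw [← hC]; infer_instance
  have hNF : ((twoCurve 4 (2 * (1 + s)))⁄ℚbar).IsCharNeTwoNF := by
    rw [hC]; infer_instance
  have hφ := exists_isIsogenyOfDegree_two (algebraMap k ℚbar s)
  refine ⟨hk, ⟨inferInstance, nonCM_of_surjective _ hsurj, fun g => ?_⟩, ?_, σ, hσ, ?_⟩
  · have hg : ((twoCurve 4 (2 * (1 + s)))⁄ℚbar).map (g : ℚbar →+* ℚbar) =
        twoCurve 4 (2 * (1 + g (algebraMap k ℚbar s))) := by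
      rw [hC, twoCurve_map]
      simp [map_ofNat]
    rcases hcase g with h | h
    · have h' : g (algebraMap k ℚbar s) = algebraMap k ℚbar s := h s
      rw [h'] at hg
      exact exists_isogeny_congr hC hg IsIsogeny ⟨_, IsIsogeny.id⟩
    · have h' : g (algebraMap k ℚbar s) = -algebraMap k ℚbar s := by
        exact (h s).trans ((congrArg (algebraMap k ℚbar) hσs).trans (map_neg _ _))
      rw [h', ← sub_eq_add_neg] at hg
      obtain ⟨φ, hφ'⟩ := hφ
      exact exists_isogeny_congr hC hg IsIsogeny ⟨φ, hφ'.1⟩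
  · exact j_twoCurve_not_mem_range hσs hs hδ hδ'
  · exact exists_isogeny_congr hC hconj (fun φ => IsIsogenyOfDegree φ 2) hφ

end WeierstrassCurve

/-! ### Surjectivity over ℚ(√(-3d)) and the infinite family -/

section CubeRoots

variable {F E : Type*} [Field F] [Field E] [Algebra F E]

lemma exists_isPrimitiveRoot_three [CharZero E] {K : IntermediateField F E} {θ : E} (hθ : θ ∈ K)
    (h : θ ^ 2 = -3) : ∃ ζ ∈ K, IsPrimitiveRoot ζ 3 := by
  refine ⟨(-1 + θ) / 2, div_mem (add_mem (neg_mem (one_mem K)) hθ) (ofNat_mem K 2), ?_⟩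
  rw [IsPrimitiveRoot.iff_orderOf]
  refine orderOf_eq_prime ?_ fun h1 => ?_
  · linear_combination (-3 / 8 + θ / 8) * h
  · have h2 : θ = 3 := by linear_combination 2 * h1
    rw [h2] at h
    norm_num at h

lemma det_vandermonde_mem {x : Fin 4 → E} {K : IntermediateField F E} (hx : ∀ i, x i ∈ K) :
    (Matrix.vandermonde x).det ∈ K := by
  rw [Matrix.det_vandermonde]
  exact prod_mem fun i _ => prod_mem fun j _ => sub_mem (hx j) (hx i)

/-- If an octahedral extension contains `√d` but not `√-3`, then its Galois group is not reduced by
adjoining `√(-3d)`. -/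
lemma FullQuartic.exists_fixing [IsGalois F E] [CharZero E] {x : Fin 4 → E} (h : FullQuartic F x)
    {K : IntermediateField F E} (hK : IntermediateField.adjoin F (Set.range x) = K)
    (hζ : ¬ ∃ ζ ∈ K, IsPrimitiveRoot ζ 3) {d : F} (hd : d ≠ 0) {e r : E} (he : e ∈ K)
    (hed : e ^ 2 = algebraMap F E d) (hr : r ^ 2 = algebraMap F E (-3 * d)) (σ : Equiv.Perm (Fin 4)) :
    ∃ g : E ≃ₐ[F] E, g r = r ∧ ∀ i, g (x i) = x (σ i) := by
  have hneg : ∀ (g : E ≃ₐ[F] E), g r = r ∨ g r = -r := by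
    intro g
    rw [← sq_eq_sq_iff_eq_or_eq_neg, ← map_pow, hr, g.commutes]
  have he0 : e ≠ 0 := by
    rintro rfl
    apply hd
    apply (algebraMap F E).injective
    rw [← hed, map_zero]; ring
  have hr0 : r ≠ 0 := by
    intro h0
    have h1 : (algebraMap F E) (-3 * d) = 0 := by rw [← hr, h0]; ring
    simp only [map_mul, map_neg, map_ofNat, mul_eq_zero, neg_eq_zero, map_eq_zero] at h1
    rcases h1 with h1 | h1
    · norm_num at h1
    · exact hd h1
  -- If everything fixing `K` fixed `r`, then `r / e`, a square root of -3, would lie in `K`. The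
  -- resulting `τ` corrects the sign of `r` without moving the roots.
  obtain ⟨τ, hτK, hτ⟩ : ∃ τ ∈ K.fixingSubgroup, τ r = -r := by
    by_contra! hc
    apply hζ
    refine exists_isPrimitiveRoot_three (θ := r / e) ?_ ?_
    · refine div_mem ?_ he
      rw [← InfiniteGalois.fixedField_fixingSubgroup K]
      rintro ⟨τ, hτ⟩
      exact (hneg τ).resolve_right (hc τ hτ)
    · rw [div_pow, hed, hr, div_eq_iff (by rw [← hed]; exact pow_ne_zero 2 he0)]
      simp [map_ofNat]
  obtain ⟨g, hg⟩ := h.full σ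
  rcases hneg g with hgr | hgr
  · exact ⟨g, hgr, hg⟩
  · refine ⟨g * τ, ?_, fun i => ?_⟩
    · rw [AlgEquiv.mul_apply, hτ, map_neg, hgr, neg_neg]
    · rw [AlgEquiv.mul_apply, (IntermediateField.mem_fixingSubgroup_iff _ _).mp hτK, hg]
      rw [← hK]
      exact IntermediateField.subset_adjoin F _ ⟨i, rfl⟩

end CubeRoots

namespace WeierstrassCurve

section

variable {F : Type*} [Field F] [CharZero F]

lemma isElliptic_twoCurve_four {s : F} (hs : s ^ 2 ≠ 1) : (twoCurve 4 (2 * (1 + s))).IsElliptic := by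
  refine isElliptic_twoCurve (fun h => hs ?_) (fun h => hs ?_)
  · linear_combination (s - 1) / 2 * h
  · linear_combination (-(s + 1) / 8) * h

lemma j_twoCurve_four (s : F) [(twoCurve 4 (2 * (1 + s))).IsElliptic] :
    (twoCurve 4 (2 * (1 + s))).j = 64 * (5 - 3 * s) ^ 3 / ((1 + s) ^ 2 * (1 - s)) := by
  obtain ⟨h1, h2⟩ := b_ne_zero_of_twoCurve (a := 4) (b := 2 * (1 + s))
  have hjΔ : (twoCurve 4 (2 * (1 + s))).j * (twoCurve 4 (2 * (1 + s))).Δ =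
      (twoCurve 4 (2 * (1 + s))).c₄ ^ 3 := by
    rw [WeierstrassCurve.j, mul_right_comm, ← coe_Δ', Units.inv_mul, one_mul]
  rw [twoCurve_Δ, twoCurve_c₄] at hjΔ
  rw [eq_div_iff]
  · linear_combination hjΔ / 512
  · refine mul_ne_zero (pow_ne_zero 2 fun h => h1 ?_) fun h => h2 ?_
    · linear_combination 2 * h
    · linear_combination 8 * h

/-- The equation `j = a` is polynomial in `s`, and at `s = -1` the polynomial has a nonzero value
independent of `a`. -/
lemma finite_setOf_j_eq (a : F) :
    {s : F | s ^ 2 ≠ 1 ∧ 64 * (5 - 3 * s) ^ 3 / ((1 + s) ^ 2 * (1 - s)) = a}.Finite := by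
  set p : F[X] := 64 * (5 - 3 * X) ^ 3 - C a * ((1 + X) ^ 2 * (1 - X)) with hp
  have hp0 : p ≠ 0 := by
    intro h
    have h1 := congrArg (eval (-1)) h
    simp only [hp, eval_sub, eval_mul, eval_pow, eval_add, eval_X, eval_C, eval_ofNat, eval_one,
      eval_zero] at h1
    norm_num at h1
  refine (finite_setOfPred_isRoot hp0).subset ?_
  rintro s ⟨hs, h⟩
  have h1 : (1 + s) ^ 2 * (1 - s) ≠ 0 := by
    intro h1
    rcases mul_eq_zero.mp h1 with h1 | h1
    · exact hs (by linear_combination (s - 1) * (pow_eq_zero_iff (by norm_num)).mp h1)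
    · exact hs (by linear_combination (-(s + 1)) * h1)
  rw [div_eq_iff h1] at h
  simp only [IsRoot, hp, Set.mem_ofPred_eq, eval_sub, eval_mul, eval_pow, eval_add, eval_X, eval_C,
    eval_ofNat, eval_one]
  linear_combination h

end

end WeierstrassCurve

lemma sqrtField_eq {D : ℚ} {r : ℚbar} (hr : r ^ 2 = algebraMap ℚ ℚbar D) :
    sqrtField D = IntermediateField.adjoin ℚ {r} := by
  apply le_antisymm
  · refine IntermediateField.adjoin_le_iff.mpr fun y hy => ?_
    have hy' : y ^ 2 = r ^ 2 := hr ▸ hy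
    rcases sq_eq_sq_iff_eq_or_eq_neg.mp hy' with rfl | rfl
    · exact IntermediateField.mem_adjoin_simple_self ℚ _
    · exact neg_mem (IntermediateField.mem_adjoin_simple_self ℚ _)
  · refine IntermediateField.adjoin.mono ℚ _ _ ?_
    rintro _ rfl
    exact hr

namespace WeierstrassCurve

open scoped Classical

set_option maxHeartbeats 800000 in
/-- The curve attached to a polynomial `X⁴ + t X + t`. -/
theorem exists_twoCurve_of_parameter {K₁ : IntermediateField ℚ ℚbar} [NumberField K₁]
    (h4 : Module.finrank ℚ K₁ = 4) {k : IntermediateField ℚ ℚbar} (hk : Module.finrank ℚ k = 2)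
    {r : k} (hr : r ^ 2 = algebraMap ℚ k (-3 * (NumberField.discr K₁ : ℚ)))
    (hD : ¬ ∃ q : ℚ, -3 * (NumberField.discr K₁ : ℚ) = q ^ 2) {t : ℚ} {w : Fin 4 → ℚbar}
    (hw : FullQuartic ℚ w) (hK : IntermediateField.adjoin ℚ (Set.range w) = galoisClosure K₁)
    (hroot : ∀ i, w i ^ 4 + algebraMap ℚ ℚbar t * w i + algebraMap ℚ ℚbar t = 0)
    (hfull : ∀ σ : Equiv.Perm (Fin 4), ∃ g : ℚbar ≃ₐ[k] ℚbar, ∀ i, g (w i) = w (σ i))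
    (ht' : 1 - 256 / (27 * t) ≠ -175 / 81) :
    ∃ s : k, s ^ 2 = algebraMap ℚ k (1 - 256 / (27 * t)) ∧ s ^ 2 ≠ 1 ∧
      ∃ _ : (twoCurve 4 (2 * (1 + s))).IsElliptic, IsQCurveOfDegree 2 (twoCurve 4 (2 * (1 + s))) ∧
        Function.Surjective (torsionRep (twoCurve 4 (2 * (1 + s))) 3) ∧
        IsOctahedralFieldOf (twoCurve 4 (2 * (1 + s))) (galoisClosure K₁) ∧
        ∀ K' : IntermediateField ℚ ℚbar, IsOctahedralFieldOf (twoCurve 4 (2 * (1 + s))) K' →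
          K' = galoisClosure K₁ := by
  obtain ⟨ht, -⟩ := hw.coeff_ne_zero hroot
  set d : ℚ := (NumberField.discr K₁ : ℚ) with hd
  have hd0 : d ≠ 0 := by
    rw [hd]; exact_mod_cast NumberField.discr_ne_zero K₁
  obtain ⟨q, hq⟩ := exists_discr_mul_eq_sq h4 hw hK.symm hroot
  rw [← hd] at hq
  have hq0 : q ≠ 0 := by
    rintro rfl
    have h1 : 256 * t ^ 3 - 27 * t ^ 4 = 0 := by
      refine (mul_eq_zero.mp ?_).resolve_left hd0
      rw [hq]; ring
    have h2 := det_vandermonde_sq hw.inj hroot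
    have h3 : 256 * algebraMap ℚ ℚbar t ^ 3 - 27 * algebraMap ℚ ℚbar t ^ 4 = 0 := by
      rw [← map_zero (algebraMap ℚ ℚbar), ← h1]; simp
    rw [h3] at h2
    exact Matrix.det_vandermonde_ne_zero_iff.mpr hw.inj ((pow_eq_zero_iff (by norm_num)).mp h2)
  set δ : ℚ := 1 - 256 / (27 * t) with hδ
  -- Since d(256t³ - 27t⁴) = -27 d t⁴ δ is the square of `q`, this `u` satisfies δ = -3d u², and `u
  -- r` is a square root of `δ` in `k`.
  set u : ℚ := q / (9 * d * t ^ 2) with hu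
  have hu0 : u ≠ 0 := div_ne_zero hq0 (by positivity)
  have hδu : δ = -3 * d * u ^ 2 := by
    have h1 : δ * (27 * t) = 27 * t - 256 := by rw [hδ]; field_simp
    have h2 : u * (9 * d * t ^ 2) = q := div_mul_cancel₀ _ (by positivity)
    rw [← h2] at hq
    have h3 : (27 * d * t ^ 4) * (δ - -3 * d * u ^ 2) = 0 := by
      linear_combination d * t ^ 3 * h1 - hq
    exact sub_eq_zero.mp ((mul_eq_zero.mp h3).resolve_left (by positivity))
  have hδsq : ¬ ∃ v : ℚ, δ = v ^ 2 := by
    rintro ⟨v, hv⟩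
    refine hD ⟨v / u, ?_⟩
    rw [div_pow, eq_div_iff (pow_ne_zero 2 hu0), ← hδu, hv]
  have hδ0 : δ ≠ 0 := fun h => hδsq ⟨0, by rw [h]; norm_num⟩
  have hδ1 : δ ≠ 1 := fun h => hδsq ⟨1, by rw [h]; norm_num⟩
  set s : k := algebraMap ℚ k u * r with hs
  have hsδ : s ^ 2 = algebraMap ℚ k δ := by
    rw [hs, mul_pow, hr, hδu, map_mul _ _ (u ^ 2), map_pow]; ring
  have hs1 : s ^ 2 ≠ 1 := by
    rw [hsδ, ← map_one (algebraMap ℚ k)]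
    exact (algebraMap ℚ k).injective.ne hδ1
  have hnr : ∀ v : ℚ, s ≠ algebraMap ℚ k v := by
    rintro v hv
    apply hδsq
    refine ⟨v, (algebraMap ℚ k).injective ?_⟩
    rw [← hsδ, hv, map_pow]
  have hell := isElliptic_twoCurve_four hs1
  refine ⟨s, hsδ, hs1, hell, ?_⟩
  have hc4 : (twoCurve 4 (2 * (1 + s))).c₄ = 32 * (5 - 3 * s) := by rw [twoCurve_c₄]; ring
  have hc6 : (twoCurve 4 (2 * (1 + s))).c₆ = 256 * (9 * s - 7) := by rw [twoCurve_c₆]; ring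
  have h4' : (twoCurve 4 (2 * (1 + s))).c₄ ≠ 0 := by
    rw [hc4]
    refine mul_ne_zero (by norm_num) fun h => hnr (5 / 3) ?_
    simp only [map_div₀, map_ofNat]
    linear_combination (-1 / 3) * h
  have h6' : (twoCurve 4 (2 * (1 + s))).c₆ ≠ 0 := by
    rw [hc6]
    refine mul_ne_zero (by norm_num) fun h => hnr (7 / 9) ?_
    simp only [map_div₀, map_ofNat]
    linear_combination (1 / 9) * h
  obtain ⟨z, hz, hzroot, hfield, hiff⟩ := exists_rational_quartic_roots hsδ hδ0 hδ1 h4' h6'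
    (by rw [hc4, hc6])
  have htδ : 256 / (27 * (1 - δ)) = t := by
    rw [hδ]; field_simp; ring
  rw [htδ] at hzroot
  obtain ⟨π, hπ⟩ := exists_perm_eq_of_quartic hw.inj hroot hz hzroot
  have hrange : Set.range z = Set.range w := by
    rw [show z = w ∘ π from funext hπ, π.surjective.range_comp]
  have hsurj : Function.Surjective (torsionRep (twoCurve 4 (2 * (1 + s))) 3) := by
    rw [hiff]
    intro σ
    obtain ⟨g, hg⟩ := hfull (π * σ * π⁻¹)
    refine ⟨g, fun i => ?_⟩
    rw [hπ, hg, hπ]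
    simp
  have hzfull := fullQuartic_of_surjective hz hzroot (hiff.mp hsurj)
  have hoct := isOctahedralFieldOf_of_fullQuartic hzfull hk hfield
  rw [hrange, hK] at hoct
  exact ⟨isQCurveOfDegree_twoCurve hk hsδ hδsq ht' hsurj, hsurj, hoct⟩

end WeierstrassCurve

/-- A family of pairwise non-isomorphic curves with given octahedral field. -/
theorem exists_qCurves (K₁ : IntermediateField ℚ ℚbar) [NumberField K₁] (hK₁ : IsPrincipalQuartic K₁)
    (hS₄ : Nonempty ((galoisClosure K₁ ≃ₐ[ℚ] galoisClosure K₁) ≃* Equiv.Perm (Fin 4)))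
    (hζ : ¬ ∃ ζ ∈ galoisClosure K₁, IsPrimitiveRoot ζ 3) :
    ∃ C : ℕ → WeierstrassCurve (sqrtField (-3 * (NumberField.discr K₁ : ℚ))),
      (∀ n, ∃ _ : (C n).IsElliptic,
        IsQCurveOfDegree 2 (C n) ∧
        Function.Surjective (torsionRep (C n) 3) ∧
        IsOctahedralFieldOf (C n) (galoisClosure K₁) ∧
        (∀ K' : IntermediateField ℚ ℚbar, IsOctahedralFieldOf (C n) K' → K' = galoisClosure K₁)) ∧
      ∀ m n, m ≠ n → ¬ GeometricallyIsomorphic (C m) (C n) := by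
  classical
  obtain ⟨h4, b, c, hbc⟩ := hK₁
  obtain ⟨e⟩ := hS₄
  have hnormal : @Normal ℚ (galoisClosure K₁) _ _ (galoisClosure K₁).algebra' := inferInstance
  obtain ⟨x, hx, hKx, hroot⟩ := exists_fullQuartic_of_equiv_perm (F := ℚ) (E := ℚbar) hbc e
  set d : ℚ := (NumberField.discr K₁ : ℚ) with hd
  have hd0 : d ≠ 0 := by
    rw [hd]; exact_mod_cast NumberField.discr_ne_zero K₁
  obtain ⟨q, hq⟩ := exists_discr_mul_eq_sq h4 hx hKx hroot
  rw [← hd] at hq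
  have hΔ := det_vandermonde_sq hx.inj hroot
  have hΔ0 := Matrix.det_vandermonde_ne_zero_iff.mpr hx.inj
  -- The Vandermonde determinant of the roots lies in `K` and is a square root of the discriminant
  -- of the quartic, hence of `d` up to a rational factor.
  obtain ⟨ε, hεK, hε⟩ : ∃ ε ∈ galoisClosure K₁, ε ^ 2 = algebraMap ℚ ℚbar d := by
    refine ⟨algebraMap ℚ ℚbar q / (Matrix.vandermonde x).det, div_mem ?_ ?_, ?_⟩
    · exact (galoisClosure K₁).algebraMap_mem q
    · refine det_vandermonde_mem fun i => ?_
      rw [hKx]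
      exact IntermediateField.subset_adjoin ℚ _ ⟨i, rfl⟩
    · rw [div_pow, div_eq_iff (pow_ne_zero 2 hΔ0), hΔ, ← map_pow, ← hq, map_mul]
      simp
  have hD : ¬ ∃ q : ℚ, -3 * d = q ^ 2 := by
    rintro ⟨v, hv⟩
    have hε0 : ε ≠ 0 := by
      rintro rfl
      apply hd0
      apply (algebraMap ℚ ℚbar).injective
      rw [← hε, map_zero]; ring
    refine hζ (exists_isPrimitiveRoot_three (θ := algebraMap ℚ ℚbar v / ε)
      (div_mem ((galoisClosure K₁).algebraMap_mem v) hεK) ?_)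
    rw [div_pow, div_eq_iff (pow_ne_zero 2 hε0), hε, ← map_pow, ← hv]
    simp
  obtain ⟨r, hr⟩ := IsAlgClosed.exists_pow_nat_eq (algebraMap ℚ ℚbar (-3 * d)) (n := 2) two_pos
  have hkr := sqrtField_eq hr
  set k := sqrtField (-3 * d) with hk
  have hk2 : Module.finrank ℚ k = 2 := by
    rw [hkr]; exact IntermediateField.finrank_adjoin_sqrt hr hD
  have hrk : r ∈ k := by rw [hkr]; exact IntermediateField.mem_adjoin_simple_self ℚ r
  have hr' : (⟨r, hrk⟩ : k) ^ 2 = algebraMap ℚ k (-3 * d) := by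
    apply (algebraMap k ℚbar).injective
    rw [map_pow]
    exact hr
  have hlift : ∀ g : ℚbar ≃ₐ[ℚ] ℚbar, g r = r → ∃ g' : ℚbar ≃ₐ[k] ℚbar, ∀ y, g' y = g y := by
    intro g hg
    have hgk : g ∈ k.fixingSubgroup := by
      rw [hkr, IntermediateField.mem_fixingSubgroup_adjoin_iff]
      rintro _ rfl
      exact hg
    exact ⟨IntermediateField.fixingSubgroupEquiv k ⟨g, hgk⟩, fun y => rfl⟩
  set S : Set k := {s | s ^ 2 ≠ 1 ∧ ∃ _ : (twoCurve 4 (2 * (1 + s))).IsElliptic,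
    IsQCurveOfDegree 2 (twoCurve 4 (2 * (1 + s))) ∧
    Function.Surjective (torsionRep (twoCurve 4 (2 * (1 + s))) 3) ∧
    IsOctahedralFieldOf (twoCurve 4 (2 * (1 + s))) (galoisClosure K₁) ∧
    ∀ K' : IntermediateField ℚ ℚbar, IsOctahedralFieldOf (twoCurve 4 (2 * (1 + s))) K' →
      K' = galoisClosure K₁} with hS
  have hSinf : S.Infinite := by
    intro hfin
    have hT := hx.infinite_setOf_parameter hroot
    -- The parameter `t` is recovered from `s` as 256/(27(1 - s²)), so finitely many `s` would leave
    -- finitely many `t`; the exceptional value of `δ` costs only one more.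
    have hfin' : (algebraMap ℚ k ⁻¹' ((fun s : k => 256 / (27 * (1 - s ^ 2))) '' S)).Finite :=
      (hfin.image _).preimage (algebraMap ℚ k).injective.injOn
    refine hT ((hfin'.union (Set.finite_singleton (256 / (27 * (1 - -175 / 81))))).subset ?_)
    rintro t ⟨w, hw, hwK, hwroot⟩
    obtain ⟨ht, -⟩ := hw.coeff_ne_zero hwroot
    by_cases ht' : 1 - 256 / (27 * t) = -175 / 81
    · right
      have h1 : 256 / (27 * t) = 1 - -175 / 81 := by linear_combination -ht'
      change t = _
      rw [← h1]
      field_simp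
    · left
      obtain ⟨s, hs, hs1, h⟩ := exists_twoCurve_of_parameter h4 hk2 hr' hD hw (hwK.trans hKx.symm) hwroot
        (fun σ => by
          obtain ⟨g, hgr, hg⟩ := hw.exists_fixing (hwK.trans hKx.symm) hζ hd0 hεK hε hr σ
          obtain ⟨g', hg'⟩ := hlift g hgr
          exact ⟨g', fun i => (hg' _).trans (hg i)⟩) ht'
      refine ⟨s, ⟨hs1, h⟩, ?_⟩
      change 256 / (27 * (1 - s ^ 2)) = algebraMap ℚ k t
      have h0 : algebraMap ℚ k t ≠ 0 := by rwa [Ne, map_eq_zero]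
      rw [hs]
      simp only [map_sub, map_div₀, map_mul, map_one, map_ofNat]
      field_simp
      ring
  let J : k → k := fun s => 64 * (5 - 3 * s) ^ 3 / ((1 + s) ^ 2 * (1 - s))
  have hJinf : (J '' S).Infinite := by
    intro hfin
    refine hSinf (Set.Finite.of_finite_fibers J hfin fun a _ => (finite_setOf_j_eq a).subset ?_)
    rintro s ⟨hs, hsa⟩
    exact ⟨hs.1, hsa⟩
  -- One `s` is chosen for each of infinitely many distinct j-invariants, so no two of the curves
  -- are isomorphic over ℚbar.
  let f := Set.Infinite.natEmbedding _ hJinf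
  choose s hsS hsJ using fun n => (f n).2
  refine ⟨fun n => twoCurve 4 (2 * (1 + s n)), fun n => (hsS n).2, fun m n hmn ⟨v, hv⟩ => hmn ?_⟩
  obtain ⟨hm, -⟩ := (hsS m).2
  obtain ⟨hn, -⟩ := (hsS n).2
  have hj := j_eq_of_smul_eq hv
  have hjm : ((twoCurve 4 (2 * (1 + s m)))⁄ℚbar).j = algebraMap k ℚbar (twoCurve 4 (2 * (1 + s m))).j :=
    map_j _ _
  have hjn : ((twoCurve 4 (2 * (1 + s n)))⁄ℚbar).j = algebraMap k ℚbar (twoCurve 4 (2 * (1 + s n))).j :=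
    map_j _ _
  rw [hjm, hjn] at hj
  have hj' := (algebraMap k ℚbar).injective hj
  rw [j_twoCurve_four, j_twoCurve_four] at hj'
  apply f.injective
  apply Subtype.ext
  rw [← hsJ m, ← hsJ n]
  exact hj'.symm

theorem proposition5p1 :
    (∀ (k : IntermediateField ℚ (AlgebraicClosure ℚ)) (C : WeierstrassCurve k) [C.IsElliptic],
      IsQCurveOfDegree 2 C → Function.Surjective (torsionRep C 3) →
      ∃ K : IntermediateField ℚ (AlgebraicClosure ℚ),
        IsOctahedralFieldOf C K ∧
        (∀ K' : IntermediateField ℚ (AlgebraicClosure ℚ), IsOctahedralFieldOf C K' → K' = K) ∧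
        ∃ (K₁ : IntermediateField ℚ (AlgebraicClosure ℚ)) (_ : NumberField K₁),
          IsPrincipalQuartic K₁ ∧ galoisClosure K₁ = K ∧
          ¬ ∃ q : ℚ, (NumberField.discr K₁ : ℚ) = -3 * q ^ 2) ∧
    (∀ (K₁ : IntermediateField ℚ (AlgebraicClosure ℚ)) [NumberField K₁],
      IsPrincipalQuartic K₁ →
      Nonempty ((galoisClosure K₁ ≃ₐ[ℚ] galoisClosure K₁) ≃* Equiv.Perm (Fin 4)) →
      (¬ ∃ ζ ∈ galoisClosure K₁, IsPrimitiveRoot ζ 3) →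
      ∃ C : ℕ → WeierstrassCurve (sqrtField (-3 * (NumberField.discr K₁ : ℚ))),
        (∀ n, ∃ _ : (C n).IsElliptic,
          IsQCurveOfDegree 2 (C n) ∧
          Function.Surjective (torsionRep (C n) 3) ∧
          IsOctahedralFieldOf (C n) (galoisClosure K₁) ∧
          (∀ K' : IntermediateField ℚ (AlgebraicClosure ℚ),
            IsOctahedralFieldOf (C n) K' → K' = galoisClosure K₁)) ∧
        ∀ m n, m ≠ n → ¬ GeometricallyIsomorphic (C m) (C n)) := by
  exact ⟨fun _ _ _ hC hρ => exists_octahedralField hC hρ,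
    fun K₁ _ h1 h2 h3 => exists_qCurves K₁ h1 h2 h3⟩
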